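/- For partitions $\alpha^1,\dots,\alpha^r$ and $\lambda$, let $\langle s_{\alpha^1}\cdots s_{\alpha^r},s_\lambda\rangle$ denote the multi-Littlewood–Richardson coefficient, i.e. the coefficient of $s_\lambda$ in the expansion of the product of Schur functions $s_{\alpha^1}\cdots s_{\alpha^r}$ in the Schur basis. Write $\ell(\lambda)$ for the number of parts of $\lambda$, $\lambda_1$ for its largest part, and $\log$ for the logarithm in base $2$. There are an algorithm (a deterministic multi-tape Turing machine) and a constant $C$ with the following property. Let $n\ge 1$, $k\ge 0$, $r\ge 1$ be integers and let $\lambda\vdash n$, $\alpha^1\vdash n-k$, and nonempty partitions $\alpha^2,\dots,\alpha^r$ with $|\alpha^2|+\cdots+|\alpha^r|=k$ be given ($\alpha^1$ may be empty). On input $(\lambda,\alpha^1,\dots,\alpha^r)$, with all parts written in binary, the algorithm outputs, in binary, the (nonnegative integer) value $\langle s_{\alpha^1}\cdots s_{\alpha^r},s_\lambda\rangle$ after at most $$C\,\ell(\lambda)\,\log(\lambda_1+1)\,k^{2k^2}$$ elementary steps, where $0^0=1$. That is, the coefficient can be computed in time $O(\ell(\lambda)\log(\lambda_1)\,k^{2k^2})$,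 where $\log(\lambda_1)$ is read as $\log(\lambda_1+1)$ so that it does not vanish for $\lambda_1=1$. -/

import Mathlib

/-! ### Schur functions and multi-Littlewood-Richardson coefficients

Partitions are Young diagrams: `μ.card` is the size `|μ|`, `μ.rowLens` is the list of the (positive)
parts `μ₁ ≥ μ₂ ≥ …`, `μ.rowLen 0` is the largest part `μ₁`, and `μ.colLen 0` is the number of
parts `ℓ(μ)`. -/

/-- The content (weight) of a semistandard tableau: the number of entries equal to `a`, for each
`a : ℕ`.  Entries, and hence variables, are numbered from `0`. -/
noncomputable def SemistandardYoungTableau.content {μ : YoungDiagram}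
    (T : SemistandardYoungTableau μ) : ℕ →₀ ℕ :=
  ∑ c ∈ μ.cells, Finsupp.single (T c.1 c.2) 1

/-- The Schur function `s_μ` in the variables `x₀, x₁, x₂, …`, as a formal power series: the
generating function of the semistandard tableaux of shape `μ`, i.e. the coefficient of `x ^ d`
is the number of semistandard tableaux of shape `μ` and content `d`. -/
noncomputable def schurFunction (μ : YoungDiagram) : MvPowerSeries ℕ ℚ :=
  fun d => (Nat.card {T : SemistandardYoungTableau μ // T.content = d} : ℚ)

/-- `IsMultiLR α lam m` says that `m` is the multi-Littlewood-Richardson coefficient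
`⟨s_{α¹} ⋯ s_{αʳ}, s_lam⟩` of the list `α = [α¹, …, αʳ]`: the product `s_{α¹} ⋯ s_{αʳ}` is a (finite)
linear combination of Schur functions in which `s_lam` has the coefficient `m`. The number `m` is
determined by `α` and `lam`, see `IsMultiLR.unique`. -/
def IsMultiLR (α : List YoungDiagram) (lam : YoungDiagram) (m : ℕ) : Prop :=
  ∃ c : YoungDiagram →₀ ℚ,
    (α.map schurFunction).prod = Finsupp.linearCombination ℚ schurFunction c ∧ c lam = m

/-! Schur functions are linearly independent, so that coefficients are well defined. -/

namespace SemistandardYoungTableau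

theorem content_apply {μ : YoungDiagram} (T : SemistandardYoungTableau μ) (a : ℕ) :
    T.content a = (μ.cells.filter fun c => T c.1 c.2 = a).card := by
  rw [content, Finsupp.finsetSum_apply, Finset.card_filter]
  exact Finset.sum_congr rfl fun c _ => Finsupp.single_apply

theorem row_le_entry {μ : YoungDiagram} (T : SemistandardYoungTableau μ) (i j : ℕ)
    (h : (i, j) ∈ μ) : i ≤ T i j := by
  induction i with
  | zero => exact Nat.zero_le _
  | succ i ih =>
    have h1 := ih (μ.up_left_mem (Nat.le_succ i) le_rfl h)
    have h2 := T.col_strict (Nat.lt_add_one i) h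
    omega

instance finite_content (μ : YoungDiagram) (d : ℕ →₀ ℕ) :
    Finite {T : SemistandardYoungTableau μ // T.content = d} := by
  have key : ∀ T : {T : SemistandardYoungTableau μ // T.content = d}, ∀ c : μ.cells,
      T.1 c.1.1 c.1.2 ∈ d.support := by
    rintro ⟨T, rfl⟩ ⟨c, hc⟩
    rw [Finsupp.mem_support_iff, content_apply]
    exact (Finset.card_pos.2 ⟨c, by simpa using hc⟩).ne'
  refine Finite.of_injective
    (β := μ.cells → d.support) (fun T c => ⟨T.1 c.1.1 c.1.2, key T c⟩) ?_
  intro T T' h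
  apply Subtype.ext
  ext i j
  by_cases hij : (i, j) ∈ μ
  · simpa using congrArg Subtype.val (congrFun h ⟨(i, j), hij⟩)
  · rw [T.1.zeros hij, T'.1.zeros hij]

theorem sum_content {μ : YoungDiagram} (T : SemistandardYoungTableau μ) (i : ℕ) :
    ∑ a ∈ Finset.range i, T.content a = (μ.cells.filter fun c => T c.1 c.2 < i).card := by
  simp_rw [content_apply]
  rw [← Finset.card_biUnion]
  · congr 1
    ext c
    simp only [Finset.mem_biUnion, Finset.mem_range, Finset.mem_filter]
    constructor
    · rintro ⟨a, ha, hc, rfl⟩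
      exact ⟨hc, ha⟩
    · rintro ⟨hc, ha⟩
      exact ⟨_, ha, hc, rfl⟩
  · intro a _ b _ hab
    rw [Function.onFun, Finset.disjoint_left]
    intro c h1 h2
    simp only [Finset.mem_filter] at h1 h2
    exact hab (h1.2.symm.trans h2.2)

end SemistandardYoungTableau

theorem coeff_schurFunction (μ : YoungDiagram) (d : ℕ →₀ ℕ) :
    MvPowerSeries.coeff d (schurFunction μ) =
      (Nat.card {T : SemistandardYoungTableau μ // T.content = d} : ℚ) := rfl

theorem schurFunction_linearIndependent : LinearIndependent ℚ schurFunction := by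
  classical
  rw [linearIndependent_iff]
  intro c hc
  by_contra hne
  let P : YoungDiagram → ℕ → ℕ := fun μ i => (μ.cells.filter fun c => c.1 < i).card
  have hPinj : Function.Injective P := by
    intro μ ν h
    have hrow : ∀ (μ : YoungDiagram) (i : ℕ), P μ (i + 1) = P μ i + μ.rowLen i := by
      intro μ i
      rw [YoungDiagram.rowLen_eq_card, ← Finset.card_union_of_disjoint]
      · simp only [P]
        congr 1
        ext x
        simp only [YoungDiagram.row, Finset.mem_union, Finset.mem_filter, Order.lt_add_one_iff,
          le_iff_lt_or_eq]
        tauto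
      · rw [Finset.disjoint_left]
        intro x h1 h2
        simp only [YoungDiagram.row, Finset.mem_filter] at h1 h2
        omega
    ext ⟨i, j⟩
    have h1 := hrow μ i
    have h2 := hrow ν i
    rw [h] at h1
    have h3 : μ.rowLen i = ν.rowLen i := by omega
    rw [YoungDiagram.mem_cells, YoungDiagram.mem_cells, YoungDiagram.mem_iff_lt_rowLen,
      YoungDiagram.mem_iff_lt_rowLen, h3]
  obtain ⟨p, hp⟩ := Finset.exists_maximal (s := c.support.image P)
    (Finset.Nonempty.image (Finsupp.support_nonempty_iff.2 hne) P)
  obtain ⟨μ, hμ, rfl⟩ := Finset.mem_image.1 hp.1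
  let H := SemistandardYoungTableau.highestWeight μ
  have hH : ∀ i, ∑ a ∈ Finset.range i, H.content a = P μ i := by
    intro i
    rw [SemistandardYoungTableau.sum_content]
    simp only [P]
    congr 1
    apply Finset.filter_congr
    rintro ⟨a, b⟩ hx
    simp [H, (YoungDiagram.mem_cells _).1 hx]
  have hval := congrArg (MvPowerSeries.coeff H.content) hc
  rw [Finsupp.linearCombination_apply, Finsupp.sum, map_sum, map_zero,
    Finset.sum_eq_single_of_mem μ hμ] at hval
  · rw [map_smul, coeff_schurFunction, smul_eq_mul, mul_eq_zero, Nat.cast_eq_zero] at hval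
    have : Nonempty {T : SemistandardYoungTableau μ // T.content = H.content} := ⟨⟨H, rfl⟩⟩
    exact hval.elim (Finsupp.mem_support_iff.1 hμ) Nat.card_pos.ne'
  · intro ν hν hνμ
    rw [map_smul, coeff_schurFunction, smul_eq_mul, mul_eq_zero, Nat.cast_eq_zero]
    right
    have : IsEmpty {T : SemistandardYoungTableau ν // T.content = H.content} := by
      refine ⟨fun ⟨T, hT⟩ => hνμ (hPinj ?_)⟩
      have hle : P μ ≤ P ν := by
        intro i
        rw [← hH, ← hT, T.sum_content]
        apply Finset.card_le_card
        intro x hx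
        rw [Finset.mem_filter] at hx ⊢
        exact ⟨hx.1, (T.row_le_entry x.1 x.2 ((YoungDiagram.mem_cells _).1 hx.1)).trans_lt hx.2⟩
      exact le_antisymm (hp.2 (Finset.mem_image_of_mem P hν) hle) hle
    exact Nat.card_of_isEmpty

theorem IsMultiLR.unique {α : List YoungDiagram} {lam : YoungDiagram} {m m' : ℕ}
    (h : IsMultiLR α lam m) (h' : IsMultiLR α lam m') : m = m' := by
  obtain ⟨c, hc, hm⟩ := h
  obtain ⟨c', hc', hm'⟩ := h'
  have := schurFunction_linearIndependent (hc.symm.trans hc')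
  subst this
  exact_mod_cast hm.symm.trans hm'

/-! ### Algorithms and their running time

The machine model is Mathlib's multi-stack Turing machine `Turing.FinTM2` (a tape is a pair of
stacks): a finite control with finitely many stacks of symbols, whose single step performs a
bounded number of pushes, pops and changes of the internal state. -/

/-- The input alphabet: binary digits and two end markers. -/
inductive InputSymbol : Type
  | bit (b : Bool)
  | endPart
  | endPartition
  deriving DecidableEq, Fintype

/-- A partition is written as the sequence of its parts, each in binary (least significant digit
first) and followed by an end marker, with another end marker after the last part. -/
def encodePartition (μ : YoungDiagram) : List InputSymbol :=
  (μ.rowLens.flatMap fun p => p.bits.map InputSymbol.bit ++ [InputSymbol.endPart]) ++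
    [InputSymbol.endPartition]

/-- The input `(lam, α¹, …, αʳ)` is written as the concatenation of its partitions. -/
def encodeInput (lam : YoungDiagram) (α : List YoungDiagram) : List InputSymbol :=
  (lam :: α).flatMap encodePartition

/-- The machine `M`, started with the word `input` on its input stack (first symbol on top) and with
all other stacks empty, halts after at most `T` steps with exactly the word `output` on its output
stack (first symbol on top). The other stacks need not be emptied, so that a machine is not forced
to read its whole input. -/
def OutputsWithin {Γ₀ Γ₁ : Type} (M : Turing.TM2ComputableAux Γ₀ Γ₁)
    (input : List Γ₀) (output : List Γ₁) (T : ℝ) : Prop :=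
  ∃ (t : ℕ) (c : Turing.TM2.Cfg M.tm.Γ M.tm.Λ M.tm.σ),
    Nonempty (StateTransition.EvalsToInTime M.tm.step
      (Turing.initList M.tm (input.map M.inputAlphabet.symm)) (some c) t) ∧
    c.l = none ∧
    c.stk M.tm.k₁ = output.map M.outputAlphabet.symm ∧
    (t : ℝ) ≤ T

/-! ### A structured programming language for stack machines -/

/-! The coefficient is a number of combinatorial objects, each of which is coded by a word of at
most 9k² bits. The machine tries all words of a suitable length and counts the successful ones. Only
the preparation of the search depends on the size of λ.

Littlewood–Richardson rule. Semistandard tableaux of shape ν are Gelfand–Tsetlin patterns, and s_μ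
s_ν is the sum of s_{μ + wt(g)} over the μ-dominant patterns g of shape ν. To prove this, multiply
by an alternant. By symmetry of s_ν (Bender–Knuth toggles, `rename_schurPoly`), s_ν a_{μ+ρ} is the
sum of a_{μ+ρ+wt(g)} over all g (`schurPoly_mul_alternant`). If g is not dominant, take the last
column c where dominance fails and the least letter p failing there. Column c contains p + 1 but not
p, so the letters p and p + 1 can be toggled in the columns left of c alone. This exchanges two
exponents, hence changes the sign of the alternant, and leaves the first failure in place, so these
terms cancel (`sum_alternant_eq_zero`). For μ = 0 only the highest pattern is dominant, which gives
s_ν a_ρ = a_{ν+ρ} (`schurPoly_mul_alternant_rho`); cancelling a_ρ gives the rule for polynomials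
(`schurPoly_mul_schurPoly`). The dominant patterns do not depend on the number of variables once it
is large, whence `schurFunction_mul`. Read row by row, dominance says that every row of letters is
added as a horizontal strip (`isDominant_iff_rows`). By iteration the coefficient is the number of
sequences of row vectors leading from α¹ to λ (`exists_schur_expansion`).

Compression. The skew shape λ/α¹ has k boxes, so at most k rows change, and at most k vectors are
added. For a row that changes it suffices to know the number of missing boxes and the slack below
the row above, truncated at the number of missing boxes; all these numbers are at most k
(`Compression.card_eq`). The entries of the vectors are written in unary, one bit per box and one
per entry, and padded to a common length L. The coefficient is then the number of accepted words of
length L (`SearchState.card_accepts`). The choice of L is the square of the unary size of α², …, αʳ,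
which is at most 3k.

Running time. The digits of λ and α¹ are subtracted in a single pass, which stops as soon as α¹ does
not fit into λ (`subAll_runs`). A λ of ℓ rows is written with O(ℓ log(λ₁ + 1)) symbols
(`length_encParts_rowLens_le`), and the conversion of the differences to unary costs O(k + 1) per
symbol, because their values are at most k. Each of the 2^L trials is polynomial in k
(`trial_runs`). All this is at most a constant times (E + 1)(k + 1)³ 2^(9k²), where E is the length
of the code of the parts of λ. Exhaustive search is affordable because 2^(12k²) = 64^(2k²) ≤ k^(2k²)
once k ≥ 64; smaller k only affect the constant (`exists_two_pow_le`).

The machine is obtained from structured programs, whose big-step semantics counts machine steps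
exactly (`Exec.iterate_step`, `Runs.outputsWithin`). -/

/-- The memory of a stack program: a finite register, a family of stacks of input symbols, and an
output stack of bits. -/
structure Store (ι σ : Type) where
  reg : σ
  stk : ι → List InputSymbol
  out : List Bool

/-- Loop-free code, executed by a stack machine in a single step. -/
inductive Block (ι σ : Type) : Type
  | nop
  | push (k : ι) (f : σ → InputSymbol) (b : Block ι σ)
  | pop (k : ι) (f : σ → Option InputSymbol → σ) (b : Block ι σ)
  | pushOut (f : σ → Bool) (b : Block ι σ)
  | popOut (f : σ → Option Bool → σ) (b : Block ι σ)
  | load (f : σ → σ) (b : Block ι σ)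
  | branch (c : σ → Bool) (b₁ b₂ : Block ι σ)

/-- Structured stack programs. -/
inductive StackProg (ι σ : Type) : Type
  | act (b : Block ι σ)
  | seq (p q : StackProg ι σ)
  | ite (c : σ → Bool) (p q : StackProg ι σ)
  | loop (c : σ → Bool) (p : StackProg ι σ)

infixr:65 " ;; " => StackProg.seq

namespace Block

variable {ι σ : Type} [DecidableEq ι]

/-- The effect of a block on the memory. -/
def run : Block ι σ → Store ι σ → Store ι σ
  | nop, s => s
  | push k f b, s => run b { s with stk := Function.update s.stk k (f s.reg :: s.stk k) }
  | pop k f b, s => run b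
      { s with reg := f s.reg (s.stk k).head?, stk := Function.update s.stk k (s.stk k).tail }
  | pushOut f b, s => run b { s with out := f s.reg :: s.out }
  | popOut f b, s => run b { s with reg := f s.reg s.out.head?, out := s.out.tail }
  | load f b, s => run b { s with reg := f s.reg }
  | branch c b₁ b₂, s => bif c s.reg then run b₁ s else run b₂ s

/-- The stacks which a block may change. -/
def touches : Block ι σ → ι → Bool
  | nop, _ => false
  | push k _ b, j => decide (j = k) || touches b j
  | pop k _ b, j => decide (j = k) || touches b j
  | pushOut _ b, j => touches b j
  | popOut _ b, j => touches b j
  | load _ b, j => touches b j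
  | branch _ b₁ b₂, j => touches b₁ j || touches b₂ j

/-- Whether a block may change the output stack. -/
def touchesOut : Block ι σ → Bool
  | nop => false
  | push _ _ b => touchesOut b
  | pop _ _ b => touchesOut b
  | pushOut _ _ => true
  | popOut _ _ => true
  | load _ b => touchesOut b
  | branch _ b₁ b₂ => touchesOut b₁ || touchesOut b₂

/-- A bound for the number of symbols which a block pushes. -/
def pushes : Block ι σ → ℕ
  | nop => 0
  | push _ _ b => pushes b + 1
  | pop _ _ b => pushes b
  | pushOut _ b => pushes b
  | popOut _ b => pushes b
  | load _ b => pushes b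
  | branch _ b₁ b₂ => pushes b₁ + pushes b₂

theorem run_frame (b : Block ι σ) (s : Store ι σ) (j : ι) (h : b.touches j = false) :
    (b.run s).stk j = s.stk j := by
  induction b generalizing s with
  | nop => rfl
  | push k f b ih =>
    simp only [touches, Bool.or_eq_false_iff, decide_eq_false_iff_not] at h
    rw [run, ih _ h.2]
    exact Function.update_of_ne h.1 _ _
  | pop k f b ih =>
    simp only [touches, Bool.or_eq_false_iff, decide_eq_false_iff_not] at h
    rw [run, ih _ h.2]
    exact Function.update_of_ne h.1 _ _
  | pushOut f b ih => exact ih _ h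
  | popOut f b ih => exact ih _ h
  | load f b ih => exact ih _ h
  | branch c b₁ b₂ ih₁ ih₂ =>
    simp only [touches, Bool.or_eq_false_iff] at h
    rw [run]
    cases c s.reg
    · exact ih₂ _ h.2
    · exact ih₁ _ h.1

theorem run_frame_out (b : Block ι σ) (s : Store ι σ) (h : b.touchesOut = false) :
    (b.run s).out = s.out := by
  induction b generalizing s with
  | nop => rfl
  | push k f b ih => exact ih _ h
  | pop k f b ih => exact ih _ h
  | pushOut f b ih => simp [touchesOut] at h
  | popOut f b ih => simp [touchesOut] at h
  | load f b ih => exact ih _ h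
  | branch c b₁ b₂ ih₁ ih₂ =>
    simp only [touchesOut, Bool.or_eq_false_iff] at h
    rw [run]
    cases c s.reg
    · exact ih₂ _ h.2
    · exact ih₁ _ h.1

theorem length_run_le (b : Block ι σ) (s : Store ι σ) (j : ι) :
    ((b.run s).stk j).length ≤ (s.stk j).length + b.pushes := by
  induction b generalizing s with
  | nop => exact le_rfl
  | push k f b ih =>
    refine (ih _).trans ?_
    by_cases h : j = k
    · subst h; simp [pushes]; omega
    · simp [pushes, Function.update_of_ne h]
  | pop k f b ih =>
    refine (ih _).trans ?_
    by_cases h : j = k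
    · subst h; simp [pushes]
    · simp [pushes, Function.update_of_ne h]
  | pushOut f b ih => exact ih _
  | popOut f b ih => exact ih _
  | load f b ih => exact ih _
  | branch c b₁ b₂ ih₁ ih₂ =>
    rw [run, pushes]
    cases c s.reg
    · exact (ih₂ _).trans (by omega)
    · exact (ih₁ _).trans (by omega)

end Block

/-! ### Semantics of programs, with running time -/

namespace StackProg

variable {ι σ : Type} [DecidableEq ι]

/-- Big-step semantics: `Exec p s s' t` says that `p` turns the memory `s` into `s'` in exactly `t`
machine steps. -/
inductive Exec : StackProg ι σ → Store ι σ → Store ι σ → ℕ → Prop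
  | act (b : Block ι σ) (s : Store ι σ) : Exec (.act b) s (b.run s) 1
  | seq {p q : StackProg ι σ} {s s₁ s₂ : Store ι σ} {t₁ t₂ : ℕ} :
      Exec p s s₁ t₁ → Exec q s₁ s₂ t₂ → Exec (.seq p q) s s₂ (t₁ + t₂)
  | iteTrue {c : σ → Bool} {p q : StackProg ι σ} {s s' : Store ι σ} {t : ℕ} :
      c s.reg = true → Exec p s s' t → Exec (.ite c p q) s s' (t + 1)
  | iteFalse {c : σ → Bool} {p q : StackProg ι σ} {s s' : Store ι σ} {t : ℕ} :
      c s.reg = false → Exec q s s' t → Exec (.ite c p q) s s' (t + 1)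
  | loopFalse {c : σ → Bool} {p : StackProg ι σ} {s : Store ι σ} :
      c s.reg = false → Exec (.loop c p) s s 1
  | loopTrue {c : σ → Bool} {p : StackProg ι σ} {s s₁ s₂ : Store ι σ} {t₁ t₂ : ℕ} :
      c s.reg = true → Exec p s s₁ t₁ → Exec (.loop c p) s₁ s₂ t₂ →
        Exec (.loop c p) s s₂ (t₁ + t₂ + 1)

/-- The stacks which a program may change. -/
def touches : StackProg ι σ → ι → Bool
  | act b, j => b.touches j
  | seq p q, j => touches p j || touches q j
  | ite _ p q, j => touches p j || touches q j
  | loop _ p, j => touches p j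

/-- Whether a program may change the output stack. -/
def touchesOut : StackProg ι σ → Bool
  | act b => b.touchesOut
  | seq p q => touchesOut p || touchesOut q
  | ite _ p q => touchesOut p || touchesOut q
  | loop _ p => touchesOut p

/-- A bound for the number of symbols which a program pushes in a single step. -/
def pushes : StackProg ι σ → ℕ
  | act b => b.pushes
  | seq p q => pushes p + pushes q
  | ite _ p q => pushes p + pushes q
  | loop _ p => pushes p

/-- Frame rule. Since `touches` is computed from the syntax, its hypothesis is closed by `rfl` for a
concrete program and stack, so that specifications need only mention the stacks that change. -/
theorem Exec.frame {p : StackProg ι σ} {s s' : Store ι σ} {t : ℕ} (h : Exec p s s' t) (j : ι)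
    (hj : p.touches j = false) : s'.stk j = s.stk j := by
  induction h with
  | act b s => exact b.run_frame s j hj
  | seq _ _ ih₁ ih₂ =>
    simp only [touches, Bool.or_eq_false_iff] at hj
    rw [ih₂ hj.2, ih₁ hj.1]
  | iteTrue _ _ ih => simp only [touches, Bool.or_eq_false_iff] at hj; exact ih hj.1
  | iteFalse _ _ ih => simp only [touches, Bool.or_eq_false_iff] at hj; exact ih hj.2
  | loopFalse _ => rfl
  | loopTrue _ _ _ ih₁ ih₂ => rw [ih₂ hj, ih₁ hj]

theorem Exec.frame_out {p : StackProg ι σ} {s s' : Store ι σ} {t : ℕ} (h : Exec p s s' t)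
    (hj : p.touchesOut = false) : s'.out = s.out := by
  induction h with
  | act b s => exact b.run_frame_out s hj
  | seq _ _ ih₁ ih₂ =>
    simp only [touchesOut, Bool.or_eq_false_iff] at hj
    rw [ih₂ hj.2, ih₁ hj.1]
  | iteTrue _ _ ih => simp only [touchesOut, Bool.or_eq_false_iff] at hj; exact ih hj.1
  | iteFalse _ _ ih => simp only [touchesOut, Bool.or_eq_false_iff] at hj; exact ih hj.2
  | loopFalse _ => rfl
  | loopTrue _ _ _ ih₁ ih₂ => rw [ih₂ hj, ih₁ hj]

/-- Every step pushes at most `pushes` symbols. This controls the stacks after an aborted trial,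
whose final contents are not described otherwise. -/
theorem Exec.length_le {p : StackProg ι σ} {s s' : Store ι σ} {t : ℕ} (h : Exec p s s' t) (j : ι) :
    (s'.stk j).length ≤ (s.stk j).length + p.pushes * t := by
  induction h with
  | act b s => simpa [pushes] using b.length_run_le s j
  | seq _ _ ih₁ ih₂ => simp only [pushes]; nlinarith
  | iteTrue _ _ ih => simp only [pushes]; nlinarith
  | iteFalse _ _ ih => simp only [pushes]; nlinarith
  | loopFalse _ => simp
  | loopTrue _ _ _ ih₁ ih₂ => simp only [pushes] at *; nlinarith

/-- `Runs p s s' T` says that `p` turns the memory `s` into `s'` in at most `T` machine steps. -/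
def Runs (p : StackProg ι σ) (s s' : Store ι σ) (T : ℕ) : Prop :=
  ∃ t ≤ T, Exec p s s' t

namespace Runs

variable {p q : StackProg ι σ} {s s₁ s₂ s' : Store ι σ} {c : σ → Bool} {T T₁ T₂ : ℕ}

theorem mono (h : Runs p s s' T₁) (hT : T₁ ≤ T₂) : Runs p s s' T₂ := by
  obtain ⟨t, ht, h⟩ := h
  exact ⟨t, ht.trans hT, h⟩

theorem cast (h : Runs p s s₁ T₁) (hs : s₁ = s₂) (hT : T₁ ≤ T₂) : Runs p s s₂ T₂ :=
  hs ▸ h.mono hT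

theorem act {b : Block ι σ} (h : b.run s = s') : Runs (.act b) s s' 1 :=
  ⟨1, le_rfl, h ▸ .act b s⟩

theorem seq (h₁ : Runs p s s₁ T₁) (h₂ : Runs q s₁ s₂ T₂) : Runs (p ;; q) s s₂ (T₁ + T₂) := by
  obtain ⟨t₁, ht₁, h₁⟩ := h₁
  obtain ⟨t₂, ht₂, h₂⟩ := h₂
  exact ⟨_, add_le_add ht₁ ht₂, h₁.seq h₂⟩

theorem iteTrue (hc : c s.reg = true) (h : Runs p s s' T) : Runs (.ite c p q) s s' (T + 1) := by
  obtain ⟨t, ht, h⟩ := h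
  exact ⟨_, Nat.succ_le_succ ht, .iteTrue hc h⟩

theorem iteFalse (hc : c s.reg = false) (h : Runs q s s' T) : Runs (.ite c p q) s s' (T + 1) := by
  obtain ⟨t, ht, h⟩ := h
  exact ⟨_, Nat.succ_le_succ ht, .iteFalse hc h⟩

theorem loopFalse (hc : c s.reg = false) : Runs (.loop c p) s s 1 :=
  ⟨1, le_rfl, .loopFalse hc⟩

theorem loopTrue (hc : c s.reg = true) (h₁ : Runs p s s₁ T₁) (h₂ : Runs (.loop c p) s₁ s₂ T₂) :
    Runs (.loop c p) s s₂ (T₁ + T₂ + 1) := by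
  obtain ⟨t₁, ht₁, h₁⟩ := h₁
  obtain ⟨t₂, ht₂, h₂⟩ := h₂
  exact ⟨_, Nat.succ_le_succ (add_le_add ht₁ ht₂), .loopTrue hc h₁ h₂⟩

theorem frame (h : Runs p s s' T) (j : ι) (hj : p.touches j = false) : s'.stk j = s.stk j :=
  h.elim fun _ h => h.2.frame j hj

theorem frame_out (h : Runs p s s' T) (hj : p.touchesOut = false) : s'.out = s.out :=
  h.elim fun _ h => h.2.frame_out hj

theorem length_le (h : Runs p s s' T) (j : ι) :
    (s'.stk j).length ≤ (s.stk j).length + p.pushes * T := by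
  obtain ⟨t, ht, h⟩ := h
  exact (h.length_le j).trans (Nat.add_le_add_left (Nat.mul_le_mul_left _ ht) _)

end Runs

/-! #### Compilation -/

/-- The stack alphabets of the compiled machine: the output stack `none` carries bits. -/
def Alphabet : Option ι → Type
  | none => Bool
  | some _ => InputSymbol

end StackProg

/-- The stacks of the compiled machine. -/
def Store.stacks {ι σ : Type} (s : Store ι σ) : ∀ k : Option ι, List (StackProg.Alphabet k)
  | none => s.out
  | some k => s.stk k

open Turing in
/-- A block followed by a statement, as a statement of a stack machine. -/
def Block.compile {ι σ Λ : Type} (q : TM2.Stmt (StackProg.Alphabet (ι := ι)) Λ σ) :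
    Block ι σ → TM2.Stmt (StackProg.Alphabet (ι := ι)) Λ σ
  | nop => q
  | push k f b => .push (some k) f (compile q b)
  | pop k f b => .pop (some k) f (compile q b)
  | pushOut f b => .push none f (compile q b)
  | popOut f b => .pop none f (compile q b)
  | load f b => .load f (compile q b)
  | branch c b₁ b₂ => .branch c (compile q b₁) (compile q b₂)

namespace StackProg

open Turing

variable {ι σ Λ : Type}

/-- The labels (program points) of a program. -/
def Label : StackProg ι σ → Type
  | act _ => Unit
  | seq p q => Label p ⊕ Label q
  | ite _ p q => Unit ⊕ (Label p ⊕ Label q)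
  | loop _ p => Unit ⊕ Label p

/-- There are finitely many labels. -/
@[reducible]
def labelFintype : (p : StackProg ι σ) → Fintype p.Label
  | act _ => inferInstanceAs (Fintype Unit)
  | seq p q =>
    have := labelFintype p
    have := labelFintype q
    inferInstanceAs (Fintype (p.Label ⊕ q.Label))
  | ite _ p q =>
    have := labelFintype p
    have := labelFintype q
    inferInstanceAs (Fintype (Unit ⊕ (p.Label ⊕ q.Label)))
  | loop _ p =>
    have := labelFintype p
    inferInstanceAs (Fintype (Unit ⊕ p.Label))

/-- The label at which a program starts. -/
def entry : (p : StackProg ι σ) → p.Label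
  | act _ => ()
  | seq p _ => Sum.inl (entry p)
  | ite _ _ _ => Sum.inl ()
  | loop _ _ => Sum.inl ()

/-- The statement at a label of a program whose labels are embedded in `Λ`; the program continues at
the label `exit`. -/
def code : (p : StackProg ι σ) → (p.Label → Λ) → Λ → p.Label →
    TM2.Stmt (Alphabet (ι := ι)) Λ σ
  | act b, _, ex, _ => b.compile (.goto fun _ => ex)
  | seq p q, emb, _, .inl l => code p (fun l => emb (.inl l)) (emb (.inr q.entry)) l
  | seq _ q, emb, exit, .inr l => code q (fun l => emb (.inr l)) exit l
  | ite c p q, emb, _, .inl _ =>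
    .branch c (.goto fun _ => emb (.inr (.inl p.entry))) (.goto fun _ => emb (.inr (.inr q.entry)))
  | ite _ p _, emb, exit, .inr (.inl l) => code p (fun l => emb (.inr (.inl l))) exit l
  | ite _ _ q, emb, exit, .inr (.inr l) => code q (fun l => emb (.inr (.inr l))) exit l
  | loop c p, emb, ex, .inl _ =>
    .branch c (.goto fun _ => emb (.inr p.entry)) (.goto fun _ => ex)
  | loop _ p, emb, _, .inr l => code p (fun l => emb (.inr l)) (emb (.inl ())) l

variable [DecidableEq ι]

/-- A machine step executes a statement up to its `goto`, so a block and the jump after it together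
take one step. The facts `h₁` and `h₂` translate updates of the compiled stacks into updates of the
store. -/
theorem stepAux_compile (q : TM2.Stmt (Alphabet (ι := ι)) Λ σ) (b : Block ι σ) (s : Store ι σ) :
    TM2.stepAux (b.compile q) s.reg s.stacks = TM2.stepAux q (b.run s).reg (b.run s).stacks := by
  have h₁ : ∀ (s : Store ι σ) (k : ι) (l : List InputSymbol),
      Function.update s.stacks (some k) l =
        Store.stacks { s with stk := Function.update s.stk k l } := by
    intro s k l
    funext j
    rcases j with _ | j
    · exact Function.update_of_ne (Option.some_ne_none k).symm _ _
    · by_cases h : j = k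
      · subst h
        exact (Function.update_self ..).trans (Function.update_self j l s.stk).symm
      · exact (Function.update_of_ne (fun h' => h (Option.some.inj h')) _ _).trans
          (Function.update_of_ne (β := fun _ => List InputSymbol) h l s.stk).symm
  have h₂ : ∀ (s : Store ι σ) (l : List Bool),
      Function.update s.stacks none l = Store.stacks { s with out := l } := by
    intro s l
    funext j
    rcases j with _ | j
    · exact Function.update_self ..
    · exact Function.update_of_ne (Option.some_ne_none j) _ _
  induction b generalizing s with
  | nop => rfl
  | push k f b ih => exact (congrArg _ (h₁ ..)).trans (ih ⟨s.reg, Function.update s.stk k (f s.reg :: s.stk k), s.out⟩)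
  | pop k f b ih => exact (congrArg _ (h₁ ..)).trans (ih ⟨f s.reg (s.stk k).head?, Function.update s.stk k (s.stk k).tail, s.out⟩)
  | pushOut f b ih => exact (congrArg _ (h₂ ..)).trans (ih ⟨s.reg, s.stk, f s.reg :: s.out⟩)
  | popOut f b ih => exact (congrArg _ (h₂ ..)).trans (ih ⟨f s.reg s.out.head?, s.stk, s.out.tail⟩)
  | load f b ih => exact ih ⟨f s.reg, s.stk, s.out⟩
  | branch c b₁ b₂ ih₁ ih₂ =>
    simp only [Block.compile, Block.run, TM2.stepAux]
    cases c s.reg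
    · exact ih₂ _
    · exact ih₁ _

/-- The configuration of the compiled machine at a label. -/
def cfg (l : Λ) (s : Store ι σ) : TM2.Cfg (Alphabet (ι := ι)) Λ σ := ⟨some l, s.reg, s.stacks⟩

/-- Induction on the execution. The exit label has to be arbitrary: the first half of a sequence
exits to the entry of the second half, and the body of a loop exits to the head of the loop. -/
theorem Exec.iterate_step {p : StackProg ι σ} {s s' : Store ι σ} {t : ℕ} (h : Exec p s s' t)
    (M : Λ → TM2.Stmt (Alphabet (ι := ι)) Λ σ) (emb : p.Label → Λ) (exit : Λ)
    (hM : ∀ l, M (emb l) = p.code emb exit l) :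
    (flip bind (TM2.step M))^[t] (some (cfg (emb p.entry) s)) = some (cfg exit s') := by
  induction h generalizing exit with
  | act b s =>
    have := hM ()
    simp only [Function.iterate_one, flip, cfg, Option.bind_eq_bind, Option.bind_some]
    rw [TM2.step, show M (emb (entry (StackProg.act b))) = b.compile (.goto fun _ => exit) from this,
      stepAux_compile]
    rfl
  | seq _ _ ih₁ ih₂ =>
    rw [add_comm, Function.iterate_add_apply]
    exact (congrArg _ (ih₁ _ _ fun l => hM (.inl l))).trans (ih₂ _ _ fun l => hM (.inr l))
  | @iteTrue c p q s s' t hc _ ih =>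
    rw [Function.iterate_succ_apply]
    refine Eq.trans (congrArg _ ?_) (ih _ _ fun l => hM (.inr (.inl l)))
    have := hM (.inl ())
    simp only [flip, cfg, Option.bind_eq_bind, Option.bind_some]
    rw [TM2.step, show M (emb (entry (ite c p q))) = _ from this, code, TM2.stepAux, hc]
    rfl
  | @iteFalse c p q s s' t hc _ ih =>
    rw [Function.iterate_succ_apply]
    refine Eq.trans (congrArg _ ?_) (ih _ _ fun l => hM (.inr (.inr l)))
    have := hM (.inl ())
    simp only [flip, cfg, Option.bind_eq_bind, Option.bind_some]
    rw [TM2.step, show M (emb (entry (ite c p q))) = _ from this, code, TM2.stepAux, hc]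
    rfl
  | @loopFalse c p s hc =>
    have := hM (.inl ())
    simp only [Function.iterate_one, flip, cfg, Option.bind_eq_bind, Option.bind_some]
    rw [TM2.step, show M (emb (entry (loop c p))) = _ from this, code, TM2.stepAux, hc]
    rfl
  | @loopTrue c p s s₁ s₂ t₁ t₂ hc _ _ ih₁ ih₂ =>
    rw [Function.iterate_succ_apply, add_comm, Function.iterate_add_apply]
    refine Eq.trans (congrArg _ (Eq.trans (congrArg _ ?_) (ih₁ _ _ fun l => hM (.inr l))))
      (ih₂ _ _ hM)
    have := hM (.inl ())
    simp only [flip, cfg, Option.bind_eq_bind, Option.bind_some]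
    rw [TM2.step, show M (emb (entry (loop c p))) = _ from this, code, TM2.stepAux, hc]
    rfl

/-- The machine which runs a program, with input stack `inp`. -/
def machine [Fintype ι] [Fintype σ] (p : StackProg ι σ) (inp : ι) (init : σ) :
    TM2ComputableAux InputSymbol Bool where
  tm :=
    letI := p.labelFintype
    { K := Option ι
      k₀ := some inp
      k₁ := none
      Γ := Alphabet
      Λ := Option p.Label
      main := some p.entry
      σ := σ
      initialState := init
      Γk₀Fin := inferInstanceAs (Fintype InputSymbol)
      m := fun
        | none => .halt
        | some l => p.code some none l }
  inputAlphabet := Equiv.refl InputSymbol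
  outputAlphabet := Equiv.refl Bool

theorem finite_alphabet [Fintype ι] [Fintype σ] (p : StackProg ι σ) (inp : ι) (init : σ)
    (k : (p.machine inp init).tm.K) : Finite ((p.machine inp init).tm.Γ k) := by
  rcases k with _ | k
  · exact inferInstanceAs (Finite Bool)
  · exact inferInstanceAs (Finite InputSymbol)

theorem Runs.outputsWithin [Fintype ι] [Fintype σ] {p : StackProg ι σ} {inp : ι} {init : σ}
    {input : List InputSymbol} {s' : Store ι σ} {T : ℕ} {R : ℝ}
    (h : Runs p ⟨init, Function.update (fun _ => []) inp input, []⟩ s' T) (hT : (T : ℝ) + 1 ≤ R) :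
    OutputsWithin (p.machine inp init) input s'.out R := by
  obtain ⟨t, ht, h⟩ := h
  -- The additional step executes `halt` at the exit label.
  refine ⟨t + 1, ⟨none, s'.reg, s'.stacks⟩, ⟨⟨⟨t + 1, ?_⟩, le_rfl⟩⟩, rfl, (List.map_id _).symm, ?_⟩
  · have h₁ := h.iterate_step (Λ := Option p.Label) (p.machine inp init).tm.m some none
      (fun _ => rfl)
    rw [Function.iterate_succ_apply']
    have h₂ : initList (p.machine inp init).tm
        (input.map (p.machine inp init).inputAlphabet.symm) =
        cfg (some p.entry) ⟨init, Function.update (fun _ => []) inp input, []⟩ := by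
      have h₃ : input.map (p.machine inp init).inputAlphabet.symm = input := List.map_id _
      rw [h₃]
      unfold initList cfg
      congr 1
      funext k
      rcases k with _ | k
      · rfl
      · by_cases hk : k = inp
        · subst hk
          refine (dif_pos rfl).trans ?_
          exact (Function.update_self (β := fun _ => List InputSymbol) k input fun _ => []).symm
        · refine (dif_neg ?_).trans ?_
          · exact fun h => hk (Option.some.inj h)
          · exact (Function.update_of_ne (β := fun _ => List InputSymbol) hk input fun _ => []).symm
    rw [h₂]
    exact (congrArg _ h₁).trans rfl
  · have : (t : ℝ) ≤ T := by exact_mod_cast ht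
    push_cast
    linarith

end StackProg

/-! ### Gelfand–Tsetlin patterns and toggles -/

/-- Gelfand–Tsetlin patterns with `N` letters and top row `ν`: `g b i` is the number of entries `< b`
in row `i` of the corresponding semistandard tableau of shape `ν`. -/
structure IsPattern (N : ℕ) (ν : ℕ → ℕ) (g : ℕ → ℕ → ℕ) : Prop where
  zero : ∀ i, g 0 i = 0
  top : ∀ b i, N ≤ b → g b i = ν i
  mono : ∀ b i, g b i ≤ g (b + 1) i
  inter : ∀ b i, g (b + 1) (i + 1) ≤ g b i

namespace GelfandTsetlin

/-- The number of letters `a` of a pattern. -/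
def weight (N : ℕ) (g : ℕ → ℕ → ℕ) (a : ℕ) : ℕ :=
  ∑ i ∈ Finset.range N, g (a + 1) i - ∑ i ∈ Finset.range N, g a i

/-- Row `i` of the partition between `x` and `z` obtained from `y` by a Bender–Knuth toggle in the
columns `< c`. -/
def toggleRow (x y z : ℕ → ℕ) (c : ℕ) : ℕ → ℕ
  | 0 => min (z 0) c + max (min (z 1) c) (min (x 0) c) + y 0 - 2 * min (y 0) c
  | i + 1 => min (min (z (i + 1)) (x i)) c + max (min (z (i + 2)) c) (min (x (i + 1)) c) +
      y (i + 1) - 2 * min (y (i + 1)) c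

/-- The Bender–Knuth toggle of the letters `p` and `p + 1` in the columns `< c`. -/
def toggle (p c : ℕ) (g : ℕ → ℕ → ℕ) : ℕ → ℕ → ℕ :=
  Function.update g (p + 1) (toggleRow (g p) (g (p + 1)) (g (p + 2)) c)

/-- The columns `< c` of a pair of interlacing pairs can be toggled separately: `r` is the first row
which ends before column `c`, and the rows before it have neither of the two letters left of `c`. -/
def IsCutRow (x y : ℕ → ℕ) (c r : ℕ) : Prop := (∀ i < r, c < x i) ∧ y r ≤ c

/-! ### The toggle of the middle partition of an interlacing triple -/

section toggleRow

variable {x y z : ℕ → ℕ} {c r : ℕ}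

/-- The interlacing conditions for `x ≤ y ≤ z`. -/
structure Interlace (x y z : ℕ → ℕ) : Prop where
  le₁ : ∀ i, x i ≤ y i
  le₂ : ∀ i, y i ≤ z i
  le₃ : ∀ i, y (i + 1) ≤ x i
  le₄ : ∀ i, z (i + 1) ≤ y i

theorem Interlace.anti₁ (h : Interlace x y z) : Antitone y :=
  antitone_nat_of_succ_le fun i => (h.le₃ i).trans (h.le₁ i)

/-- Above the cut row `x`, `y` and `z` all exceed `c`. After clipping at `c` the interval of
reflection is the single point `c`, and nothing moves. -/
theorem toggleRow_of_lt (h : Interlace x y z) (hr : IsCutRow x y c r) {i : ℕ} (hi : i < r) :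
    toggleRow x y z c i = y i := by
  have h₁ := hr.1 i hi
  have h₂ := h.le₁ i
  have h₃ := h.le₂ i
  cases i with
  | zero => simp only [toggleRow]; omega
  | succ i =>
    have h₄ := hr.1 i (by omega)
    simp only [toggleRow]; omega

/-- In the cut row the row of `x` above reaches beyond `c`, so the upper end of the interval is only
bounded by `z r` and `c`; the lower end is at most `y r ≤ c` and is not clipped. -/
theorem toggleRow_self (h : Interlace x y z) (hr : IsCutRow x y c r) :
    toggleRow x y z c r = min (z r) c + max (z (r + 1)) (x r) - y r := by
  have h₁ := hr.2
  have h₂ := h.le₁ r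
  have h₃ := h.le₂ r
  have h₄ := h.le₄ r
  cases r with
  | zero => simp only [toggleRow, zero_add] at *; omega
  | succ i =>
    have h₄ := hr.1 i (by omega)
    simp only [toggleRow, add_assoc, Nat.reduceAdd] at *; omega

/-- Below the cut row nothing reaches beyond `c`, and the formula is the usual Bender–Knuth
reflection. -/
theorem toggleRow_of_gt (h : Interlace x y z) (hr : IsCutRow x y c r) {i : ℕ} (hi : r ≤ i) :
    toggleRow x y z c (i + 1) =
      min (z (i + 1)) (x i) + max (z (i + 2)) (x (i + 1)) - y (i + 1) := by
  have h₁ : z (i + 1) ≤ c := (h.le₄ i).trans ((h.anti₁ hi).trans hr.2)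
  have h₂ := h.le₁ (i + 1)
  have h₃ := h.le₂ (i + 1)
  have h₄ := h.le₄ (i + 1)
  simp only [toggleRow, add_assoc, Nat.reduceAdd] at *; omega

theorem toggleRow_le (h : Interlace x y z) (hr : IsCutRow x y c r) {i : ℕ} (hi : r ≤ i) :
    toggleRow x y z c i ≤ c := by
  rcases hi.eq_or_lt with rfl | hi
  · rw [toggleRow_self h hr]
    have h₂ := h.le₁ r
    have h₄ := h.le₄ r
    omega
  · obtain ⟨i, rfl⟩ : ∃ j, i = j + 1 := ⟨i - 1, by omega⟩
    rw [toggleRow_of_gt h hr (by omega)]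
    have h₁ : z (i + 1) ≤ c :=
      (h.le₄ i).trans ((h.anti₁ (show r ≤ i by omega)).trans hr.2)
    have h₂ := h.le₁ (i + 1)
    have h₄ := h.le₄ (i + 1)
    simp only [add_assoc, Nat.reduceAdd] at *
    omega

/-- Interlacing confines row `i` of the middle partition to an interval whose ends depend on `x` and
`z` only. The reflection preserves that interval, so the rows can be reflected independently of each
other. -/
theorem Interlace.toggleRow (h : Interlace x y z) (hr : IsCutRow x y c r) :
    Interlace x (toggleRow x y z c) z := by
  have key : ∀ i, x i ≤ GelfandTsetlin.toggleRow x y z c i ∧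
      GelfandTsetlin.toggleRow x y z c i ≤ z i ∧ z (i + 1) ≤ GelfandTsetlin.toggleRow x y z c i ∧
      ∀ j, i = j + 1 → GelfandTsetlin.toggleRow x y z c i ≤ x j := by
    intro i
    have h₁ := h.le₁ i
    have h₂ := h.le₂ i
    have h₃ := h.le₃ i
    have h₄ := h.le₄ i
    rcases lt_trichotomy i r with hi | rfl | hi
    · rw [toggleRow_of_lt h hr hi]
      exact ⟨h₁, h₂, h₄, fun j hj => hj ▸ h.le₃ j⟩
    · rw [toggleRow_self h hr]
      have h₅ := hr.2
      refine ⟨by omega, by omega, by omega, fun j hj => ?_⟩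
      have := hr.1 j (by omega)
      omega
    · obtain ⟨i, rfl⟩ : ∃ j, i = j + 1 := ⟨i - 1, by omega⟩
      rw [toggleRow_of_gt h hr (by omega)]
      have h₅ := h.le₃ i
      have h₆ := h.le₁ i
      have h₇ := h.le₄ i
      simp only [add_assoc, Nat.reduceAdd] at *
      refine ⟨by omega, by omega, by omega, fun j hj => ?_⟩
      obtain rfl : i = j := by omega
      omega
  exact ⟨fun i => (key i).1, fun i => (key i).2.1, fun i => (key (i + 1)).2.2.2 i rfl,
    fun i => (key i).2.2.1⟩

theorem IsCutRow.toggleRow (h : Interlace x y z) (hr : IsCutRow x y c r) :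
    IsCutRow x (toggleRow x y z c) c r :=
  ⟨hr.1, toggleRow_le h hr le_rfl⟩

theorem toggleRow_toggleRow (h : Interlace x y z) (hr : IsCutRow x y c r) :
    toggleRow x (toggleRow x y z c) z c = y := by
  have h' := h.toggleRow hr
  have hr' := hr.toggleRow h
  funext i
  have h₁ := h.le₁ i
  have h₂ := h.le₂ i
  have h₃ := h.le₃ i
  have h₄ := h.le₄ i
  rcases lt_trichotomy i r with hi | rfl | hi
  · rw [toggleRow_of_lt h' hr' hi, toggleRow_of_lt h hr hi]
  · rw [toggleRow_self h' hr', toggleRow_self h hr]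
    have h₅ := hr.2
    omega
  · obtain ⟨i, rfl⟩ : ∃ j, i = j + 1 := ⟨i - 1, by omega⟩
    rw [toggleRow_of_gt h' hr' (by omega), toggleRow_of_gt h hr (by omega)]
    have h₅ := h.le₃ i
    have h₆ := h.le₁ i
    have h₇ := h.le₄ i
    simp only [add_assoc, Nat.reduceAdd] at *
    omega

/-- The rows which move end at or before column `c`, both before and after the toggle. Hence nothing
to the right changes, which is what keeps the first failure in place. -/
theorem max_toggleRow (h : Interlace x y z) (hr : IsCutRow x y c r) {c' : ℕ} (hc : c ≤ c') (i : ℕ) :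
    max (toggleRow x y z c i) c' = max (y i) c' := by
  rcases lt_or_ge i r with hi | hi
  · rw [toggleRow_of_lt h hr hi]
  · have h₁ := toggleRow_le h hr hi
    have h₂ := (h.anti₁ hi).trans hr.2
    omega

theorem sum_min_toggleRow (h : Interlace x y z) (hr : IsCutRow x y c r) {N : ℕ} (hN : z N = 0) :
    ∑ i ∈ Finset.range N, min (toggleRow x y z c i) c + ∑ i ∈ Finset.range N, min (y i) c =
      ∑ i ∈ Finset.range N, min (x i) c + ∑ i ∈ Finset.range N, min (z i) c := by
  -- The upper end of row `i + 1` and the lower end of row `i` are the minimum and the maximum of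
  -- the same two numbers, so their sum telescopes. Stopping at row `M` leaves one unmatched
  -- minimum, which vanishes when `z (M + 1) = 0`.
  have key : ∀ M, ∑ i ∈ Finset.range (M + 1), min (toggleRow x y z c i) c +
      ∑ i ∈ Finset.range (M + 1), min (y i) c + min (min (z (M + 1)) (x M)) c =
      ∑ i ∈ Finset.range (M + 1), min (x i) c + ∑ i ∈ Finset.range (M + 1), min (z i) c +
        min (z (M + 1)) c := by
    have row : ∀ i, min (toggleRow x y z c i) c + min (y i) c =
        (match i with | 0 => min (z 0) c | i + 1 => min (min (z (i + 1)) (x i)) c) +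
          max (min (z (i + 1)) c) (min (x i) c) := by
      intro i
      have h₁ := h.le₁ i
      have h₂ := h.le₂ i
      have h₃ := h.le₄ i
      rcases lt_trichotomy i r with hi | rfl | hi
      · rw [toggleRow_of_lt h hr hi]
        have := hr.1 i hi
        cases i with
        | zero => simp only; omega
        | succ i =>
          have := hr.1 i (by omega)
          simp only; omega
      · have h₄ := toggleRow_le h hr le_rfl
        rw [min_eq_left h₄, toggleRow_self h hr]
        have := hr.2
        cases i with
        | zero => simp only; omega
        | succ i =>
          have := hr.1 i (by omega)
          simp only; omega
      · have h₄ := toggleRow_le h hr hi.le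
        obtain ⟨i, rfl⟩ : ∃ j, i = j + 1 := ⟨i - 1, by omega⟩
        rw [min_eq_left h₄, toggleRow_of_gt h hr (by omega)]
        have h₁ : z (i + 1) ≤ c :=
          (h.le₄ i).trans ((h.anti₁ (show r ≤ i by omega)).trans hr.2)
        have h₅ := h.le₃ i
        simp only [add_assoc, Nat.reduceAdd] at *
        omega
    intro M
    induction M with
    | zero =>
      have := row 0
      simp only [zero_add, Finset.sum_range_one] at *
      omega
    | succ M ih =>
      have := row (M + 1)
      rw [Finset.sum_range_succ, Finset.sum_range_succ _ (M + 1),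
        Finset.sum_range_succ (fun i => min (x i) c) (M + 1),
        Finset.sum_range_succ (fun i => min (z i) c) (M + 1)]
      simp only [add_assoc, Nat.reduceAdd] at *
      omega
  cases N with
  | zero => simp
  | succ M =>
    have := key M
    rw [hN] at this
    simpa using this

end toggleRow

end GelfandTsetlin

/-! ### The toggle on patterns -/

namespace IsPattern

open GelfandTsetlin

variable {N : ℕ} {ν : ℕ → ℕ} {g : ℕ → ℕ → ℕ}

theorem interlace (h : IsPattern N ν g) (p : ℕ) : Interlace (g p) (g (p + 1)) (g (p + 2)) :=
  ⟨h.mono p, h.mono (p + 1), h.inter p, h.inter (p + 1)⟩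

theorem anti (h : IsPattern N ν g) (b : ℕ) : Antitone (g b) :=
  antitone_nat_of_succ_le fun i => (h.mono b (i + 1)).trans (h.inter b i)

theorem eq_zero (h : IsPattern N ν g) {b i : ℕ} (hi : b ≤ i) : g b i = 0 := by
  induction b generalizing i with
  | zero => exact h.zero i
  | succ b ih =>
    obtain ⟨i, rfl⟩ : ∃ j, i = j + 1 := ⟨i - 1, by omega⟩
    exact Nat.le_zero.1 ((h.inter b i).trans (ih (by omega)).le)

theorem shape_eq_zero (h : IsPattern N ν g) {i : ℕ} (hi : N ≤ i) : ν i = 0 := by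
  rw [← h.top N i le_rfl, h.eq_zero hi]

theorem eq_zero_of_ge (h : IsPattern N ν g) (b : ℕ) {i : ℕ} (hi : N ≤ i) : g b i = 0 := by
  rcases le_total b N with hb | hb
  · exact h.eq_zero (hb.trans hi)
  · rw [h.top b i hb, h.shape_eq_zero hi]

theorem le_shape (h : IsPattern N ν g) (b i : ℕ) : g b i ≤ ν i := by
  have h₁ : Monotone fun b => g b i := monotone_nat_of_le_succ fun b => h.mono b i
  rw [← h.top (max b N) i (le_max_right _ _)]
  exact h₁ (le_max_left _ _)

theorem toggle (h : IsPattern N ν g) {p c r : ℕ} (hp : p + 1 < N)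
    (hr : IsCutRow (g p) (g (p + 1)) c r) : IsPattern N ν (toggle p c g) := by
  have h' := (h.interlace p).toggleRow hr
  have e₁ : GelfandTsetlin.toggle p c g (p + 1) =
    toggleRow (g p) (g (p + 1)) (g (p + 2)) c := Function.update_self ..
  have e₂ : ∀ b, b ≠ p + 1 → GelfandTsetlin.toggle p c g b = g b :=
    fun b hb => Function.update_of_ne hb ..
  refine ⟨fun i => ?_, fun b i hb => ?_, fun b i => ?_, fun b i => ?_⟩
  · rw [e₂ 0 (by omega), h.zero]
  · rw [e₂ b (by omega), h.top b i hb]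
  · by_cases h₁ : b = p + 1
    · subst h₁
      rw [e₁, e₂ _ (by omega)]
      exact h'.le₂ i
    · by_cases h₂ : b = p
      · subst h₂
        rw [e₁, e₂ _ (by omega)]
        exact h'.le₁ i
      · rw [e₂ _ h₁, e₂ _ (by omega)]
        exact h.mono b i
  · by_cases h₁ : b = p + 1
    · subst h₁
      rw [e₁, e₂ _ (by omega)]
      exact h'.le₄ i
    · by_cases h₂ : b = p
      · subst h₂
        rw [e₁, e₂ _ (by omega)]
        exact h'.le₃ i
      · rw [e₂ _ h₁, e₂ _ (by omega)]
        exact h.inter b i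

theorem toggle_toggle (h : IsPattern N ν g) {p c r : ℕ}
    (hr : IsCutRow (g p) (g (p + 1)) c r) :
    GelfandTsetlin.toggle p c (GelfandTsetlin.toggle p c g) = g := by
  unfold GelfandTsetlin.toggle
  rw [Function.update_idem, Function.update_self, Function.update_of_ne (by omega),
    Function.update_of_ne (by omega), toggleRow_toggleRow (h.interlace p) hr]
  exact Function.update_eq_self _ _

/-- The total length of the parts of the rows of `g b` outside the columns `< c`, plus a constant. -/
theorem sum_max_toggle (h : IsPattern N ν g) {p c r : ℕ}
    (hr : IsCutRow (g p) (g (p + 1)) c r) {c' : ℕ} (hc : c ≤ c') (b : ℕ) :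
    ∑ i ∈ Finset.range N, max (GelfandTsetlin.toggle p c g b i) c' =
      ∑ i ∈ Finset.range N, max (g b i) c' := by
  by_cases hb : b = p + 1
  · subst hb
    simp only [GelfandTsetlin.toggle, Function.update_self]
    exact Finset.sum_congr rfl fun i _ => max_toggleRow (h.interlace p) hr hc i
  · simp only [GelfandTsetlin.toggle, Function.update_of_ne hb]

theorem sum_mono (h : IsPattern N ν g) (b : ℕ) :
    ∑ i ∈ Finset.range N, g b i ≤ ∑ i ∈ Finset.range N, g (b + 1) i :=
  Finset.sum_le_sum fun i _ => h.mono b i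

theorem weight_toggle_of_ne {p c a : ℕ} (h₁ : a ≠ p) (h₂ : a ≠ p + 1) :
    weight N (GelfandTsetlin.toggle p c g) a = weight N g a := by
  unfold weight GelfandTsetlin.toggle
  rw [Function.update_of_ne (by omega), Function.update_of_ne (by omega)]

/-- A toggle exchanges the numbers of the letters `p` and `p + 1` in the columns `< c`. -/
theorem weight_toggle (h : IsPattern N ν g) {p c r : ℕ} (hp : p + 1 < N)
    (hr : IsCutRow (g p) (g (p + 1)) c r) :
    weight N (GelfandTsetlin.toggle p c g) p + ∑ i ∈ Finset.range N, max (g (p + 2) i) c +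
        ∑ i ∈ Finset.range N, max (g p i) c =
      weight N g (p + 1) + 2 * ∑ i ∈ Finset.range N, max (g (p + 1) i) c ∧
    weight N (GelfandTsetlin.toggle p c g) (p + 1) + 2 * ∑ i ∈ Finset.range N, max (g (p + 1) i) c =
      weight N g p + ∑ i ∈ Finset.range N, max (g (p + 2) i) c +
        ∑ i ∈ Finset.range N, max (g p i) c := by
  have h' := h.toggle hp hr
  have e₀ : GelfandTsetlin.toggle p c g p = g p := Function.update_of_ne (by omega) ..
  have e₂ : GelfandTsetlin.toggle p c g (p + 2) = g (p + 2) :=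
    Function.update_of_ne (by omega) ..
  have e₁ : GelfandTsetlin.toggle p c g (p + 1) = toggleRow (g p) (g (p + 1)) (g (p + 2)) c :=
    Function.update_self ..
  have m₁ := h'.sum_mono p
  have m₂ := h'.sum_mono (p + 1)
  have m₃ := h.sum_mono p
  have m₄ := h.sum_mono (p + 1)
  have mm : ∀ f : ℕ → ℕ, ∑ i ∈ Finset.range N, min (f i) c + ∑ i ∈ Finset.range N, max (f i) c =
      ∑ i ∈ Finset.range N, f i + N * c := by
    intro f
    rw [← Finset.sum_add_distrib, ← Finset.card_range N, ← smul_eq_mul, ← Finset.sum_const,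
      Finset.card_range, ← Finset.sum_add_distrib]
    exact Finset.sum_congr rfl fun i _ => min_add_max _ _
  have s₀ := mm (g p)
  have s₁ := mm (g (p + 1))
  have s₂ := mm (g (p + 2))
  have s₃ := mm (GelfandTsetlin.toggle p c g (p + 1))
  have s₄ := h.sum_max_toggle hr le_rfl (p + 1)
  have s₅ := sum_min_toggleRow (h.interlace p) hr (h.eq_zero_of_ge (p + 2) le_rfl)
  simp only [add_assoc, Nat.reduceAdd] at *
  unfold weight
  rw [← e₁] at s₅
  rw [e₀] at *
  simp only [add_assoc, Nat.reduceAdd] at *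
  rw [e₂] at *
  omega

end IsPattern

/-! ### The Littlewood–Richardson rule in finitely many variables -/

namespace GelfandTsetlin

open Finset MvPolynomial

/-- The rows of `g b` outside the columns `< c`, up to the constant `N * c`. -/
def tail (N : ℕ) (g : ℕ → ℕ → ℕ) (b c : ℕ) : ℕ := ∑ i ∈ range N, max (g b i) c

/-- `g` is `μ`-dominant: adding to `μ` the numbers of letters in the columns `≥ c` gives a partition,
for every `c`. -/
def IsDominant (N : ℕ) (μ : ℕ → ℕ) (g : ℕ → ℕ → ℕ) : Prop :=
  ∀ p c, p + 1 < N → μ (p + 1) + tail N g (p + 2) c + tail N g p c ≤ μ p + 2 * tail N g (p + 1) c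

/-- `(p, c)` is the place where dominance first fails. -/
structure IsFirstFailure (N : ℕ) (μ : ℕ → ℕ) (g : ℕ → ℕ → ℕ) (p c : ℕ) : Prop where
  lt : p + 1 < N
  fails : μ p + 2 * tail N g (p + 1) c < μ (p + 1) + tail N g (p + 2) c + tail N g p c
  left : ∀ p' < p,
    μ (p' + 1) + tail N g (p' + 2) c + tail N g p' c ≤ μ p' + 2 * tail N g (p' + 1) c
  right : ∀ c' > c, ∀ p', p' + 1 < N →
    μ (p' + 1) + tail N g (p' + 2) c' + tail N g p' c' ≤ μ p' + 2 * tail N g (p' + 1) c'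

theorem exists_last_of_bounded {P : ℕ → Prop} {B c : ℕ} (hc : P c) (hB : ∀ c, P c → c < B) :
    ∃ c, P c ∧ ∀ c' > c, ¬ P c' := by
  classical
  refine ⟨Nat.findGreatest P B, Nat.findGreatest_spec (hB c hc).le hc, fun c' hc' h => ?_⟩
  exact Nat.findGreatest_is_greatest hc' (hB c' h).le h

theorem IsFirstFailure.unique {N : ℕ} {μ : ℕ → ℕ} {g : ℕ → ℕ → ℕ} {p c p' c' : ℕ}
    (h : IsFirstFailure N μ g p c) (h' : IsFirstFailure N μ g p' c') : p = p' ∧ c = c' := by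
  have hc : c = c' := by
    rcases lt_trichotomy c c' with hlt | rfl | hlt
    · exact absurd (h.right c' hlt p' h'.lt) h'.fails.not_ge
    · rfl
    · exact absurd (h'.right c hlt p h.lt) h.fails.not_ge
  subst hc
  refine ⟨?_, rfl⟩
  rcases lt_trichotomy p p' with hlt | rfl | hlt
  · exact absurd (h'.left p hlt) h.fails.not_ge
  · rfl
  · exact absurd (h.left p' hlt) h'.fails.not_ge

theorem tail_of_le {N : ℕ} {ν : ℕ → ℕ} {g : ℕ → ℕ → ℕ} (h : IsPattern N ν g) (b : ℕ) {c : ℕ}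
    (hc : ν 0 ≤ c) : tail N g b c = N * c := by
  rw [tail, ← smul_eq_mul, ← card_range N, ← sum_const, card_range]
  refine sum_congr rfl fun i _ => max_eq_right ?_
  exact (h.anti b (Nat.zero_le i)).trans ((h.le_shape b 0).trans hc)

/-- From column `ν 0` on the tails are constant in the letter and dominance reduces to `μ` being
antitone. So there is a last column with a failure, and in it a least failing letter. -/
theorem exists_isFirstFailure {N : ℕ} {μ ν : ℕ → ℕ} {g : ℕ → ℕ → ℕ} (h : IsPattern N ν g)
    (hμ : Antitone μ) (hg : ¬ IsDominant N μ g) : ∃ p c, IsFirstFailure N μ g p c := by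
  classical
  let P : ℕ → Prop := fun c => ∃ p, p + 1 < N ∧
    μ p + 2 * tail N g (p + 1) c < μ (p + 1) + tail N g (p + 2) c + tail N g p c
  obtain ⟨p₀, c₀, hp₀, h₀⟩ : ∃ p c, p + 1 < N ∧
      μ p + 2 * tail N g (p + 1) c < μ (p + 1) + tail N g (p + 2) c + tail N g p c := by
    simpa [IsDominant] using hg
  have hP : ∀ c, P c → c < ν 0 := by
    rintro c ⟨p, -, hf⟩
    by_contra! hc
    rw [tail_of_le h _ hc, tail_of_le h _ hc, tail_of_le h _ hc] at hf
    have := hμ (Nat.le_add_right p 1)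
    omega
  obtain ⟨c, hc, hmax⟩ := exists_last_of_bounded (P := P) ⟨p₀, hp₀, h₀⟩ hP
  refine ⟨Nat.find hc, c, (Nat.find_spec hc).1, (Nat.find_spec hc).2, fun p' hp' => ?_,
    fun c' hc' p' hp' => ?_⟩
  · have h₁ := Nat.find_min hc hp'
    have h₂ := (Nat.find_spec hc).1
    by_contra! h₃
    exact h₁ ⟨by omega, h₃⟩
  · by_contra! h₃
    exact hmax c' hc' ⟨p', hp', h₃⟩

/-- A condition inherited by smaller indices holds on an initial segment, whose length is the number
of solutions. This is how row lengths, column heights and entries are converted into each other. -/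
theorem lt_card_filter_range {P : ℕ → Prop} [DecidablePred P] {M : ℕ}
    (hP : ∀ i j, i ≤ j → j < M → P j → P i) {i : ℕ} (hi : i < M) :
    i < #{i ∈ range M | P i} ↔ P i := by
  induction M with
  | zero => omega
  | succ M ih =>
    have hle : #{i ∈ range M | P i} ≤ M := by simpa using card_filter_le (range M) P
    rw [range_add_one, filter_insert]
    split_ifs with hM
    · have hall : #{i ∈ range M | P i} = M := by
        rw [filter_true_of_mem fun j hj => hP j M (mem_range.1 hj).le (Nat.lt_succ_self M) hM,
          card_range]
      rw [card_insert_of_notMem (by simp), hall]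
      exact ⟨fun _ => hP i M (by omega) (Nat.lt_succ_self M) hM, fun _ => hi⟩
    · rcases Nat.lt_succ_iff_lt_or_eq.1 hi with hi | rfl
      · exact ih (fun i j hij hj => hP i j hij (hj.trans (Nat.lt_succ_self M))) hi
      · simp only [hM, iff_false]
        omega

/-- A summand `max (g b i) c` grows with `c` exactly when row `i` does not reach beyond column `c`.
The cardinality is the height of column `c`, restricted to entries `< b`. -/
theorem tail_succ {N : ℕ} (g : ℕ → ℕ → ℕ) (b c : ℕ) :
    tail N g b (c + 1) + #{i ∈ range N | c < g b i} = tail N g b c + N := by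
  have hN : N = ∑ i ∈ range N, 1 := by simp
  rw [tail, tail, card_filter, ← sum_add_distrib]
  conv_rhs => rhs; rw [hN]
  rw [← sum_add_distrib]
  refine sum_congr rfl fun i _ => ?_
  split_ifs <;> omega

/-- At the first failure, the letter `p + 1` occurs in column `c`, and the letter `p` does not. -/
theorem IsFirstFailure.isCutRow {N : ℕ} {μ ν : ℕ → ℕ} {g : ℕ → ℕ → ℕ} (h : IsPattern N ν g)
    {p c : ℕ} (hf : IsFirstFailure N μ g p c) :
    (∃ r, IsCutRow (g p) (g (p + 1)) c r) ∧
      μ p + 2 * tail N g (p + 1) c + 1 = μ (p + 1) + tail N g (p + 2) c + tail N g p c := by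
  have hlen : ∀ b, ∀ i < N, i < #{i ∈ range N | c < g b i} ↔ c < g b i := fun b i hi =>
    lt_card_filter_range (fun i j hij _ hj => hj.trans_le (h.anti b hij)) hi
  have hle : ∀ b, #{i ∈ range N | c < g b i} ≤ N := fun b => by
    simpa using card_filter_le (range N) fun i => c < g b i
  -- Column strictness: a letter occurs at most once in column `c`.
  have hstep : ∀ b, #{i ∈ range N | c < g b i} ≤ #{i ∈ range N | c < g (b + 1) i} ∧
      #{i ∈ range N | c < g (b + 1) i} ≤ #{i ∈ range N | c < g b i} + 1 := by
    intro b
    refine ⟨card_le_card fun i hi => ?_, ?_⟩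
    · rw [mem_filter] at hi ⊢
      exact ⟨hi.1, hi.2.trans_le (h.mono b i)⟩
    · by_contra! hlt
      set l := #{i ∈ range N | c < g b i}
      have h₁ := (hlen (b + 1) (l + 1) (by have := hle (b + 1); omega)).1 hlt
      have h₂ := (hlen b l (by have := hle (b + 1); omega)).not.1 (lt_irrefl l)
      have := h.inter b l
      omega
  have h₀ := hf.fails
  have h₁ := hf.right (c + 1) (Nat.lt_succ_self c) p hf.lt
  have t₀ := tail_succ (N := N) g p c
  have t₁ := tail_succ (N := N) g (p + 1) c
  have t₂ := tail_succ (N := N) g (p + 2) c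
  have s₀ := hstep p
  have s₁ := hstep (p + 1)
  have l₀ := hle p
  have l₁ := hle (p + 1)
  have l₂ := hle (p + 2)
  simp only [add_assoc, Nat.reduceAdd] at *
  -- Dominance holds at `c + 1` and fails at `c`. As each of the two letters contributes at most one
  -- to column `c`, the letter `p + 1` contributes one, the letter `p` contributes nothing, and the
  -- deficit is exactly one.
  have heq : #{i ∈ range N | c < g (p + 1) i} = #{i ∈ range N | c < g p i} := by omega
  refine ⟨⟨#{i ∈ range N | c < g p i}, fun i hi => ?_, ?_⟩, by omega⟩
  · exact (hlen p i (hi.trans_le l₀)).1 hi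
  · by_contra! hlt
    by_cases hN : #{i ∈ range N | c < g p i} < N
    · have := (hlen (p + 1) _ hN).2 hlt
      omega
    · rw [h.eq_zero_of_ge (p + 1) (not_lt.1 hN)] at hlt
      omega

theorem tail_toggle {N : ℕ} {ν : ℕ → ℕ} {g : ℕ → ℕ → ℕ} (h : IsPattern N ν g) {p c r : ℕ}
    (hr : IsCutRow (g p) (g (p + 1)) c r) {c' : ℕ} (hc : c ≤ c') (b : ℕ) :
    tail N (toggle p c g) b c' = tail N g b c' :=
  h.sum_max_toggle hr hc b

/-- A first failure in column `c` is a statement about tails in the columns `≥ c`, which the toggle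
left of `c` preserves. -/
theorem IsFirstFailure.toggle {N : ℕ} {μ ν : ℕ → ℕ} {g : ℕ → ℕ → ℕ} (h : IsPattern N ν g)
    {p c : ℕ} (hf : IsFirstFailure N μ g p c) :
    IsFirstFailure N μ (GelfandTsetlin.toggle p c g) p c := by
  obtain ⟨⟨r, hr⟩, -⟩ := hf.isCutRow h
  have e := fun b c' (hc : c ≤ c') => tail_toggle h hr hc b
  refine ⟨hf.lt, ?_, fun p' hp' => ?_, fun c' hc' p' hp' => ?_⟩
  · simpa only [e _ _ le_rfl] using hf.fails
  · simpa only [e _ _ le_rfl] using hf.left p' hp'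
  · simpa only [e _ _ (le_of_lt hc')] using hf.right c' hc' p' hp'

theorem finite_patterns (N : ℕ) (ν : ℕ → ℕ) : {g | IsPattern N ν g}.Finite := by
  let F : {g | IsPattern N ν g} → (Fin N → Fin N → Fin (ν 0 + 1)) := fun g b i =>
    ⟨g.1 b i, Nat.lt_succ_of_le
      ((g.2.anti b (Nat.zero_le i)).trans (g.2.le_shape b 0))⟩
  refine Set.finite_coe_iff.1 (Finite.of_injective F ?_)
  rintro ⟨g, hg⟩ ⟨g', hg'⟩ hF
  apply Subtype.ext
  funext b i
  by_cases hb : b < N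
  · by_cases hi : i < N
    · simpa [F] using congrFun (congrFun hF ⟨b, hb⟩) ⟨i, hi⟩
    · exact (hg.eq_zero_of_ge b (not_lt.1 hi)).trans (hg'.eq_zero_of_ge b (not_lt.1 hi)).symm
  · exact (hg.top b i (not_lt.1 hb)).trans (hg'.top b i (not_lt.1 hb)).symm

/-- The finite set of patterns. -/
noncomputable def patterns (N : ℕ) (ν : ℕ → ℕ) : Finset (ℕ → ℕ → ℕ) :=
  (finite_patterns N ν).toFinset

@[simp]
theorem mem_patterns {N : ℕ} {ν : ℕ → ℕ} {g : ℕ → ℕ → ℕ} :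
    g ∈ patterns N ν ↔ IsPattern N ν g := by
  simp [patterns]

/-! ### Symmetry of Schur polynomials and products with alternants -/

/-- The Schur polynomial in `N` variables. -/
noncomputable def schurPoly (N : ℕ) (ν : ℕ → ℕ) : MvPolynomial (Fin N) ℚ :=
  ∑ g ∈ patterns N ν, ∏ a : Fin N, X a ^ weight N g a

/-- The alternant with the given exponents. -/
noncomputable def alternant (N : ℕ) (γ : ℕ → ℕ) : MvPolynomial (Fin N) ℚ :=
  Matrix.det (Matrix.of fun i j : Fin N => (X i : MvPolynomial (Fin N) ℚ) ^ γ j)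

/-- With the cut at column `ν 0` and row `0` the toggle acts on the whole tableau: it is the
classical Bender–Knuth involution. -/
theorem weight_toggle_shape {N : ℕ} {ν : ℕ → ℕ} {g : ℕ → ℕ → ℕ} (h : IsPattern N ν g) {p : ℕ}
    (hp : p + 1 < N) (a : ℕ) :
    weight N (toggle p (ν 0) g) a = weight N g (Equiv.swap p (p + 1) a) := by
  have hr : IsCutRow (g p) (g (p + 1)) (ν 0) 0 := ⟨by simp, h.le_shape _ _⟩
  have h₁ := h.weight_toggle hp hr
  have t := fun b => tail_of_le h b (le_refl (ν 0))
  simp only [tail] at t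
  rw [t, t, t] at h₁
  by_cases ha : a = p
  · subst ha; rw [Equiv.swap_apply_left]; omega
  by_cases ha' : a = p + 1
  · subst ha'; rw [Equiv.swap_apply_right]; omega
  rw [Equiv.swap_apply_of_ne_of_ne ha ha', IsPattern.weight_toggle_of_ne ha ha']

theorem rename_swap_schurPoly {n : ℕ} (ν : ℕ → ℕ) (p : Fin n) :
    rename (Equiv.swap p.castSucc p.succ) (schurPoly (n + 1) ν) = schurPoly (n + 1) ν := by
  rw [schurPoly, map_sum]
  have hr : ∀ g, IsPattern (n + 1) ν g → IsCutRow (g p) (g (p + 1)) (ν 0) 0 :=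
    fun g hg => ⟨by simp, hg.le_shape _ _⟩
  refine sum_nbij' (toggle p (ν 0)) (toggle p (ν 0)) ?_ ?_ ?_ ?_ ?_
  · intro g hg
    rw [mem_patterns] at hg ⊢
    exact hg.toggle (by simp) (hr g hg)
  · intro g hg
    rw [mem_patterns] at hg ⊢
    exact hg.toggle (by simp) (hr g hg)
  · intro g hg
    rw [mem_patterns] at hg
    exact hg.toggle_toggle (hr g hg)
  · intro g hg
    rw [mem_patterns] at hg
    exact hg.toggle_toggle (hr g hg)
  · intro g hg
    rw [mem_patterns] at hg
    rw [map_prod]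
    refine Fintype.prod_equiv (Equiv.swap p.castSucc p.succ) _ _ fun a => ?_
    rw [map_pow, rename_X, weight_toggle_shape hg (by simp)]
    congr 2
    by_cases ha : a = p.castSucc
    · subst ha; simp
    by_cases ha' : a = p.succ
    · subst ha'; simp
    rw [Equiv.swap_apply_of_ne_of_ne ha ha', Equiv.swap_apply_of_ne_of_ne]
    · exact fun h => ha (Fin.ext h)
    · exact fun h => ha' (Fin.ext (by simpa using h))

theorem rename_schurPoly {N : ℕ} (ν : ℕ → ℕ) (σ : Equiv.Perm (Fin N)) :
    rename σ (schurPoly N ν) = schurPoly N ν := by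
  rcases N with _ | n
  · rw [Subsingleton.elim σ 1, Equiv.Perm.coe_one, rename_id_apply]
  have hσ : σ ∈ Submonoid.closure (Set.range fun i : Fin n => Equiv.swap i.castSucc i.succ) := by
    rw [Equiv.Perm.mclosure_swap_castSucc_succ]
    trivial
  induction hσ using Submonoid.closure_induction with
  | mem τ hτ =>
    obtain ⟨p, rfl⟩ := hτ
    exact rename_swap_schurPoly ν p
  | one => rw [Equiv.Perm.coe_one, rename_id_apply]
  | mul σ τ _ _ h₁ h₂ => rw [Equiv.Perm.coe_mul, ← rename_rename, h₂, h₁]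

/-- In the term of the permutation `σ` of the determinant, symmetry allows `schurPoly` to be
replaced by its image under `σ`. Its monomials then shift the exponents in the same way in every
term, and the terms regroup to alternants. -/
theorem schurPoly_mul_alternant {N : ℕ} (ν γ : ℕ → ℕ) :
    schurPoly N ν * alternant N γ = ∑ g ∈ patterns N ν, alternant N fun a => γ a + weight N g a := by
  simp only [alternant, Matrix.det_apply, Matrix.of_apply]
  rw [sum_comm, mul_sum]
  refine sum_congr rfl fun σ _ => ?_
  rw [← smul_sum, mul_smul_comm]
  congr 1
  conv_lhs => rw [← rename_schurPoly ν σ]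
  rw [schurPoly, map_sum, sum_mul]
  refine sum_congr rfl fun g _ => ?_
  rw [map_prod, ← prod_mul_distrib]
  refine prod_congr rfl fun a _ => ?_
  rw [map_pow, rename_X, pow_add, mul_comm]

theorem alternant_swap {N : ℕ} {γ γ' : ℕ → ℕ} {p : ℕ} (hp : p + 1 < N) (h₁ : γ' p = γ (p + 1))
    (h₂ : γ' (p + 1) = γ p) (h₃ : ∀ a, a ≠ p → a ≠ p + 1 → γ' a = γ a) :
    alternant N γ' = - alternant N γ := by
  have h := Matrix.det_permute' (Equiv.swap (⟨p, by omega⟩ : Fin N) ⟨p + 1, hp⟩)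
    (Matrix.of fun i j : Fin N => (X i : MvPolynomial (Fin N) ℚ) ^ γ j)
  rw [Equiv.Perm.sign_swap (by simp)] at h
  rw [alternant, alternant]
  refine Eq.trans (congrArg Matrix.det ?_) (h.trans (by simp))
  ext1 i j
  simp only [Matrix.of_apply, Matrix.submatrix_apply, id]
  congr 1
  by_cases hj : j = ⟨p, by omega⟩
  · subst hj; rw [Equiv.swap_apply_left]; exact h₁
  by_cases hj' : j = ⟨p + 1, hp⟩
  · subst hj'; rw [Equiv.swap_apply_right]; exact h₂
  rw [Equiv.swap_apply_of_ne_of_ne hj hj']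
  exact h₃ _ (fun h => hj (Fin.ext h)) (fun h => hj' (Fin.ext h))

-- Toggling left of the first failure is an involution on the non-dominant patterns which reverses
-- the sign of the alternant.
open Classical in
theorem sum_alternant_eq_zero {N : ℕ} {μ ν : ℕ → ℕ} (hμ : Antitone μ) :
    ∑ g ∈ patterns N ν with ¬ IsDominant N μ g,
      alternant N (fun a => μ a + (N - 1 - a) + weight N g a) = 0 := by
  have hex : ∀ g ∈ {g ∈ patterns N ν | ¬ IsDominant N μ g},
      ∃ q : ℕ × ℕ, IsFirstFailure N μ g q.1 q.2 := by
    intro g hg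
    rw [mem_filter, mem_patterns] at hg
    obtain ⟨p, c, h⟩ := exists_isFirstFailure hg.1 hμ hg.2
    exact ⟨(p, c), h⟩
  choose q hq using hex
  have hpat : ∀ g ∈ {g ∈ patterns N ν | ¬ IsDominant N μ g}, IsPattern N ν g := by
    intro g hg
    rw [mem_filter, mem_patterns] at hg
    exact hg.1
  have hmem : ∀ g hg, toggle (q g hg).1 (q g hg).2 g ∈
      {g ∈ patterns N ν | ¬ IsDominant N μ g} := by
    intro g hg
    have hf := (hq g hg).toggle (hpat g hg)
    obtain ⟨⟨r, hr⟩, -⟩ := (hq g hg).isCutRow (hpat g hg)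
    rw [mem_filter, mem_patterns]
    exact ⟨(hpat g hg).toggle hf.lt hr, fun hd => hf.fails.not_ge (hd _ _ hf.lt)⟩
  have hneg : ∀ g hg, alternant N
      (fun a => μ a + (N - 1 - a) + weight N (toggle (q g hg).1 (q g hg).2 g) a) =
      - alternant N (fun a => μ a + (N - 1 - a) + weight N g a) := by
    intro g hg
    obtain ⟨⟨r, hr⟩, he⟩ := (hq g hg).isCutRow (hpat g hg)
    have hlt := (hq g hg).lt
    obtain ⟨h₁, h₂⟩ := (hpat g hg).weight_toggle hlt hr
    simp only [tail] at he
    -- The deficit of one in `he` is compensated by the difference of one between consecutive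
    -- entries of `N - 1 - a`, so the exponents of `p` and `p + 1` are exchanged exactly.
    refine alternant_swap hlt ?_ ?_ fun a ha ha' => ?_
    · omega
    · omega
    · simp only [IsPattern.weight_toggle_of_ne ha ha']
  refine sum_involution (fun g hg => toggle (q g hg).1 (q g hg).2 g) ?_ ?_ hmem ?_
  · intro g hg
    rw [hneg, add_neg_cancel]
  -- At a fixed point the alternant equals its own negative, hence vanishes.
  · intro g hg hne heq
    have := hneg g hg
    rw [heq] at this
    exact hne (self_eq_neg.1 this)
  · intro g hg
    have hu := (hq _ (hmem g hg)).unique ((hq g hg).toggle (hpat g hg))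
    obtain ⟨⟨r, hr⟩, -⟩ := (hq g hg).isCutRow (hpat g hg)
    simp only [hu.1, hu.2]
    exact (hpat g hg).toggle_toggle hr

open Classical in
theorem schurPoly_mul_alternant_of_antitone {N : ℕ} {μ ν : ℕ → ℕ} (hμ : Antitone μ) :
    schurPoly N ν * alternant N (fun a => μ a + (N - 1 - a)) =
      ∑ g ∈ patterns N ν with IsDominant N μ g,
        alternant N (fun a => μ a + weight N g a + (N - 1 - a)) := by
  rw [schurPoly_mul_alternant, ← sum_filter_add_sum_filter_not _ (IsDominant N μ),
    sum_alternant_eq_zero hμ, add_zero]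
  refine sum_congr rfl fun g _ => ?_
  congr 1
  funext a
  omega

/-! ### The quotient formula for Schur polynomials -/

/-- The pattern of the tableau of shape `ν` with all entries in row `i` equal to `i`. -/
def highest (ν : ℕ → ℕ) (b i : ℕ) : ℕ := if i < b then ν i else 0

theorem isPattern_highest {N : ℕ} {ν : ℕ → ℕ} (hν : Antitone ν) (h₀ : ∀ i, N ≤ i → ν i = 0) :
    IsPattern N ν (highest ν) := by
  refine ⟨fun i => by simp [highest], fun b i hb => ?_, fun b i => ?_, fun b i => ?_⟩
  · unfold highest
    split_ifs with h
    · rfl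
    · exact (h₀ i (by omega)).symm
  · unfold highest
    split_ifs <;> omega
  · have := hν (Nat.le_add_right i 1)
    unfold highest
    split_ifs <;> omega

theorem sum_highest_succ {N : ℕ} (ν : ℕ → ℕ) {b : ℕ} (hb : b < N) (c : ℕ) :
    tail N (highest ν) (b + 1) c + c = tail N (highest ν) b c + max (ν b) c := by
  have h : ∀ i, max (highest ν (b + 1) i) c =
      max (highest ν b i) c + if i = b then max (ν b) c - c else 0 := by
    intro i
    unfold highest
    split_ifs with h₁ h₂ h₃ h₃ <;> first | omega | (subst h₃; omega)
  rw [tail, tail, sum_congr rfl fun i _ => h i, sum_add_distrib, sum_ite_eq' (range N) b]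
  rw [if_pos (mem_range.2 hb)]
  omega

theorem tail_zero (N : ℕ) (g : ℕ → ℕ → ℕ) (b : ℕ) : tail N g b 0 = ∑ i ∈ range N, g b i := by
  simp [tail]

theorem weight_highest {N : ℕ} (ν : ℕ → ℕ) {a : ℕ} (ha : a < N) :
    weight N (highest ν) a = ν a := by
  have := sum_highest_succ ν ha 0
  rw [tail_zero, tail_zero] at this
  unfold weight
  omega

theorem isDominant_highest {N : ℕ} {ν : ℕ → ℕ} (hν : Antitone ν) :
    IsDominant N (fun _ => 0) (highest ν) := by
  intro p c hp
  have h₁ := sum_highest_succ (N := N) ν (show p < N by omega) c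
  have h₂ := sum_highest_succ (N := N) ν hp c
  have h₃ := hν (Nat.le_add_right p 1)
  simp only [add_assoc, Nat.reduceAdd] at *
  omega

/-- Otherwise take the last column, and in it the topmost cell, whose entry is not its row number.
If this entry is `p + 1`, then in the columns from there on `p + 1` occurs once more often than `p`,
contradicting dominance for the empty partition. -/
theorem eq_highest {N : ℕ} {ν : ℕ → ℕ} {g : ℕ → ℕ → ℕ} (h : IsPattern N ν g)
    (hd : IsDominant N (fun _ => 0) g) : g = highest ν := by
  classical
  suffices H : ∀ c i b, i < b → c < ν i → c < g b i by
    funext b i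
    unfold highest
    split_ifs with hi
    · refine le_antisymm (h.le_shape b i) ?_
      by_contra! hlt
      exact lt_irrefl _ (H (g b i) i b hi hlt)
    · exact h.eq_zero (not_lt.1 hi)
  by_contra! hne
  have hν : Antitone ν := fun i j hij => by
    rw [← h.top N i le_rfl, ← h.top N j le_rfl]; exact h.anti N hij
  obtain ⟨c₀, hc₀⟩ := hne
  obtain ⟨c, hc, hmax⟩ := exists_last_of_bounded
    (P := fun c => ∃ i b, i < b ∧ c < ν i ∧ g b i ≤ c) (B := ν 0) hc₀
    (fun c ⟨i, b, _, h₁, _⟩ => h₁.trans_le (hν (Nat.zero_le i)))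
  have hmax' : ∀ c' > c, ∀ i b, i < b → c' < ν i → c' < g b i := by
    intro c' hc' i b hi h₁
    by_contra! h₂
    exact hmax c' hc' ⟨i, b, hi, h₁, h₂⟩
  -- The topmost wrong row in column `c`. Rows above it are right from column `c` on and hence, by
  -- weak monotonicity along rows, everywhere; this is `hmin`.
  set i := Nat.find hc with hi
  obtain ⟨b, hib, hcν, hgc⟩ := Nat.find_spec hc
  rw [← hi] at hib hcν hgc
  have hmin : ∀ j < i, ∀ b, j < b → g b j = ν j := by
    intro j hj b hjb
    have h₁ := Nat.find_min hc hj
    push Not at h₁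
    have h₂ : c < ν j := hcν.trans_le (hν hj.le)
    have h₃ := h₁ b hjb h₂
    refine le_antisymm (h.le_shape b j) ?_
    by_contra! h₄
    exact lt_irrefl _ (hmax' (g b j) h₃ j b hjb h₄)
  -- A right entry in column `c + 1` of row `i` would force a right one in column `c`, so row `i`
  -- ends with the wrong cell.
  have hνi : ν i = c + 1 := by
    refine le_antisymm ?_ hcν
    by_contra! h₁
    have h₂ := hmax' (c + 1) (Nat.lt_succ_self c) i b hib h₁
    omega
  have hex : ∃ b', c < g b' i := ⟨N, by rw [h.top N i le_rfl]; exact hcν⟩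
  -- The entry of the cell is one less than the first `b` with `c < g b i`; it is named `p + 1`,
  -- which is possible because it exceeds `i`.
  obtain ⟨p, hp⟩ : ∃ p, Nat.find hex = p + 2 := by
    have hmono : Monotone fun b => g b i := monotone_nat_of_le_succ fun b => h.mono b i
    refine ⟨Nat.find hex - 2, ?_⟩
    have : b < Nat.find hex := by
      by_contra! hle
      have h₁ := (Nat.find_spec hex).trans_le (hmono hle)
      simp only at h₁
      omega
    omega
  have hpi : i ≤ p := by
    have hmono : Monotone fun b => g b i := monotone_nat_of_le_succ fun b => h.mono b i
    by_contra! hlt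
    have h₁ := (Nat.find_spec hex).trans_le (hmono (show Nat.find hex ≤ b by omega))
    simp only at h₁
    omega
  have hpN : p + 1 < N := by
    have : Nat.find hex ≤ N := Nat.find_min' hex (by rw [h.top N i le_rfl]; exact hcν)
    omega
  have hz : c < g (p + 2) i := hp ▸ Nat.find_spec hex
  have hy : g (p + 1) i ≤ c := not_lt.1 (Nat.find_min hex (by omega))
  have hiN : i < N := by omega
  -- Rows above `i` have no letters `p` or `p + 1`, rows below do not reach beyond column `c` with
  -- entries `≤ p + 1`, and row `i` contributes the single wrong cell.
  have hrow : ∀ j, max (g (p + 2) j) c + max (g p j) c =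
      2 * max (g (p + 1) j) c + if j = i then 1 else 0 := by
    intro j
    rcases lt_trichotomy j i with hj | rfl | hj
    · rw [hmin j hj _ (by omega), hmin j hj _ (by omega), hmin j hj _ (by omega),
        if_neg (by omega)]
      omega
    · have h₁ := h.le_shape (p + 2) i
      have h₂ := h.mono p i
      rw [if_pos rfl]
      omega
    · obtain ⟨j, rfl⟩ : ∃ k, j = k + 1 := ⟨j - 1, by omega⟩
      have h₁ := h.inter (p + 1) j
      have h₂ := h.anti (p + 1) (show i ≤ j by omega)
      have h₃ := h.mono p (j + 1)
      have h₄ := h.mono (p + 1) (j + 1)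
      simp only [add_assoc, Nat.reduceAdd] at *
      rw [if_neg (by omega)]
      omega
  have hsum : tail N g (p + 2) c + tail N g p c = 2 * tail N g (p + 1) c + 1 := by
    rw [tail, tail, tail, ← sum_add_distrib, sum_congr rfl fun j _ => hrow j, sum_add_distrib,
      sum_ite_eq' (range N) i, if_pos (mem_range.2 hiN), mul_sum]
  have := hd p c hpN
  simp only [zero_add] at this
  omega

/-- The product formula for `μ = 0`, where the sum has the highest pattern as its only term. -/
theorem schurPoly_mul_alternant_rho {N : ℕ} {ν : ℕ → ℕ} (hν : Antitone ν)
    (h₀ : ∀ i, N ≤ i → ν i = 0) :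
    schurPoly N ν * alternant N (fun a => N - 1 - a) =
      alternant N (fun a => ν a + (N - 1 - a)) := by
  classical
  have h := schurPoly_mul_alternant_of_antitone (N := N) (μ := fun _ => 0) (ν := ν)
    (fun _ _ _ => le_rfl)
  simp only [zero_add] at h
  rw [h, sum_eq_single_of_mem (highest ν)]
  · unfold alternant
    congr 1
    ext1 i j
    simp only [Matrix.of_apply, weight_highest ν j.2]
  · rw [mem_filter, mem_patterns]
    exact ⟨isPattern_highest hν h₀, isDominant_highest hν⟩
  · intro g hg hne
    rw [mem_filter, mem_patterns] at hg
    exact absurd (eq_highest hg.1 hg.2) hne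

/-- A Vandermonde determinant with its columns in reversed order. -/
theorem alternant_rho_ne_zero (N : ℕ) : alternant N (fun a => N - 1 - a) ≠ 0 := by
  have h := Matrix.det_permute' Fin.revPerm
    (Matrix.vandermonde fun i : Fin N => (X i : MvPolynomial (Fin N) ℚ))
  have hv := Matrix.det_vandermonde_ne_zero_iff.2 (X_injective (σ := Fin N) (R := ℚ))
  have he : alternant N (fun a => N - 1 - a) = ((Matrix.vandermonde fun i : Fin N =>
      (X i : MvPolynomial (Fin N) ℚ)).submatrix id Fin.revPerm).det := by
    unfold alternant
    congr 1
    ext1 i j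
    simp only [Matrix.of_apply, Matrix.submatrix_apply, id, Matrix.vandermonde_apply,
      Fin.revPerm_apply, Fin.val_rev]
    congr 1
    omega
  rw [he, h]
  refine mul_ne_zero ?_ hv
  rcases Int.units_eq_one_or (Equiv.Perm.sign (Fin.revPerm (n := N))) with h | h <;> simp [h]

theorem weight_of_ge {N : ℕ} {ν : ℕ → ℕ} {g : ℕ → ℕ → ℕ} (h : IsPattern N ν g) {a : ℕ}
    (ha : N ≤ a) : weight N g a = 0 := by
  rw [weight, sum_congr rfl fun i _ => (h.top (a + 1) i (by omega)).trans (h.top a i ha).symm,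
    Nat.sub_self]

/-- This is dominance at `c = 0`, where all columns are counted. -/
theorem antitone_add_weight {N : ℕ} {μ ν : ℕ → ℕ} {g : ℕ → ℕ → ℕ} (h : IsPattern N ν g)
    (hμ : Antitone μ) (hd : IsDominant N μ g) : Antitone fun a => μ a + weight N g a := by
  refine antitone_nat_of_succ_le fun a => ?_
  by_cases ha : a + 1 < N
  · have h₁ := hd a 0 ha
    rw [tail_zero, tail_zero, tail_zero] at h₁
    have h₂ := h.sum_mono a
    have h₃ := h.sum_mono (a + 1)
    unfold weight
    simp only [add_assoc, Nat.reduceAdd] at *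
    omega
  · rw [weight_of_ge h (not_lt.1 ha)]
    have := hμ (Nat.le_add_right a 1)
    omega

open Classical in
/-- The Littlewood–Richardson rule in `N` variables. -/
theorem schurPoly_mul_schurPoly {N : ℕ} {μ ν : ℕ → ℕ} (hμ : Antitone μ)
    (h₀ : ∀ i, N ≤ i → μ i = 0) :
    schurPoly N μ * schurPoly N ν =
      ∑ g ∈ patterns N ν with IsDominant N μ g, schurPoly N fun a => μ a + weight N g a := by
  apply mul_right_cancel₀ (alternant_rho_ne_zero N)
  rw [mul_right_comm, schurPoly_mul_alternant_rho hμ h₀, mul_comm,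
    schurPoly_mul_alternant_of_antitone hμ, sum_mul]
  refine sum_congr rfl fun g hg => ?_
  rw [mem_filter, mem_patterns] at hg
  rw [schurPoly_mul_alternant_rho (antitone_add_weight hg.1 hμ hg.2)]
  intro i hi
  rw [h₀ i hi, weight_of_ge hg.1 hi]

end GelfandTsetlin

/-! ### Schur functions and Schur polynomials -/

namespace YoungDiagram

open Finset

theorem ext_rowLen {μ ν : YoungDiagram} (h : ∀ i, μ.rowLen i = ν.rowLen i) : μ = ν := by
  ext ⟨i, j⟩
  rw [mem_cells, mem_cells, mem_iff_lt_rowLen, mem_iff_lt_rowLen, h]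

theorem rowLen_antitone (μ : YoungDiagram) : Antitone μ.rowLen := fun i j h => μ.rowLen_anti i j h

theorem sum_rowLen (μ : YoungDiagram) {N : ℕ} (hN : ∀ i, N ≤ i → μ.rowLen i = 0) :
    ∑ i ∈ range N, μ.rowLen i = μ.card := by
  rw [YoungDiagram.card, card_eq_sum_card_fiberwise (f := Prod.fst) (t := range N)]
  · refine sum_congr rfl fun i _ => ?_
    rw [rowLen_eq_card]
    rfl
  · intro c hc
    rw [mem_coe, mem_cells, mem_iff_lt_rowLen] at hc
    rw [mem_coe, mem_range]
    by_contra! h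
    rw [hN _ h] at hc
    omega

theorem rowLen_eq_zero (μ : YoungDiagram) {i : ℕ} (hi : μ.card ≤ i) : μ.rowLen i = 0 := by
  by_contra! h
  have h₁ : (range (i + 1)).image (fun k => (k, 0)) ⊆ μ.cells := by
    intro c hc
    obtain ⟨k, hk, rfl⟩ := mem_image.1 hc
    rw [mem_cells, mem_iff_lt_rowLen]
    exact (Nat.pos_of_ne_zero h).trans_le
      (μ.rowLen_anti _ _ (Nat.lt_succ_iff.1 (mem_range.1 hk)))
  have h₂ := card_le_card h₁
  rw [card_image_of_injective _ fun a b h => congrArg Prod.fst h, card_range] at h₂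
  exact absurd (h₂.trans hi) (by omega)

/-- The Young diagram with given row lengths. -/
def ofRowLen (N : ℕ) (f : ℕ → ℕ) (hf : Antitone f) : YoungDiagram where
  cells := (range N ×ˢ range (f 0)).filter fun c => c.2 < f c.1
  isLowerSet := by
    rintro ⟨i, j⟩ ⟨i', j'⟩ h hc
    obtain ⟨hi, hj⟩ := Prod.mk_le_mk.1 h
    simp only [coe_filter, mem_product, mem_range, Set.mem_ofPred_eq] at hc ⊢
    have := hf hi
    omega

theorem rowLen_ofRowLen {N : ℕ} {f : ℕ → ℕ} (hf : Antitone f) (h₀ : ∀ i, N ≤ i → f i = 0) :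
    (ofRowLen N f hf).rowLen = f := by
  funext i
  have h : ∀ j, j < (ofRowLen N f hf).rowLen i ↔ j < f i := by
    intro j
    rw [← mem_iff_lt_rowLen, ← mem_cells, ofRowLen]
    simp only [mem_filter, mem_product, mem_range]
    have := hf (Nat.zero_le i)
    refine ⟨fun h => h.2, fun h => ⟨⟨?_, by omega⟩, h⟩⟩
    by_contra! hi
    rw [h₀ i hi] at h
    omega
  have h₁ := h (f i)
  have h₂ := h ((ofRowLen N f hf).rowLen i)
  omega

end YoungDiagram

namespace GelfandTsetlin

open Finset

/-- The pattern of a tableau. -/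
def ofTableau {μ : YoungDiagram} (T : SemistandardYoungTableau μ) (b i : ℕ) : ℕ :=
  #{j ∈ range (μ.rowLen i) | T i j < b}

theorem lt_ofTableau {μ : YoungDiagram} (T : SemistandardYoungTableau μ) (b : ℕ) {i j : ℕ}
    (h : j < μ.rowLen i) : j < ofTableau T b i ↔ T i j < b :=
  lt_card_filter_range (fun _ _ hj hj' h' => (T.row_weak_of_le hj
    (YoungDiagram.mem_iff_lt_rowLen.2 hj')).trans_lt h') h

theorem ofTableau_le {μ : YoungDiagram} (T : SemistandardYoungTableau μ) (b i : ℕ) :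
    ofTableau T b i ≤ μ.rowLen i := by
  simpa only [ofTableau, card_range] using card_filter_le (range (μ.rowLen i)) fun j => T i j < b

/-- All entries of the tableau are less than `N`. -/
def EntriesLT {μ : YoungDiagram} (N : ℕ) (T : SemistandardYoungTableau μ) : Prop :=
  ∀ i j, (i, j) ∈ μ → T i j < N

/-- The interlacing inequality is column strictness: an entry `< b + 1` in row `i + 1` has an entry
`< b` above it. -/
theorem isPattern_ofTableau {μ : YoungDiagram} {N : ℕ} {T : SemistandardYoungTableau μ}
    (hT : EntriesLT N T) : IsPattern N μ.rowLen (ofTableau T) := by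
  refine ⟨fun i => by simp [ofTableau], fun b i hb => ?_, fun b i => ?_, fun b i => ?_⟩
  · rw [ofTableau, filter_true_of_mem, card_range]
    intro j hj
    exact (hT i j (YoungDiagram.mem_iff_lt_rowLen.2 (mem_range.1 hj))).trans_le hb
  · refine card_le_card fun j hj => ?_
    rw [mem_filter] at hj ⊢
    exact ⟨hj.1, by omega⟩
  · by_contra! hlt
    have h₁ := hlt.trans_le (ofTableau_le T (b + 1) (i + 1))
    have h₂ := (lt_ofTableau T (b + 1) h₁).1 hlt
    have h₃ := T.col_strict (Nat.lt_add_one i) (YoungDiagram.mem_iff_lt_rowLen.2 h₁)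
    have h₄ := (lt_ofTableau T b (h₁.trans_le (μ.rowLen_anti _ _ (Nat.le_succ i)))).2
      (show T i (ofTableau T b i) < b by omega)
    exact lt_irrefl _ h₄

theorem ofTableau_injective {μ : YoungDiagram} :
    Function.Injective (ofTableau : SemistandardYoungTableau μ → ℕ → ℕ → ℕ) := by
  intro T T' h
  ext i j
  by_cases hij : (i, j) ∈ μ
  · have hj := YoungDiagram.mem_iff_lt_rowLen.1 hij
    have h₁ := fun b => (lt_ofTableau T b hj).symm.trans (h ▸ lt_ofTableau T' b hj)
    have h₂ := h₁ (T i j)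
    have h₃ := h₁ (T' i j)
    omega
  · rw [T.zeros hij, T'.zeros hij]

/-- The tableau of a pattern. -/
def toTableau {μ : YoungDiagram} {N : ℕ} {g : ℕ → ℕ → ℕ} (h : IsPattern N μ.rowLen g) :
    SemistandardYoungTableau μ where
  -- The entry is the least letter `b` such that the cell lies among the first `g (b + 1) i` cells
  -- of its row, expressed as the number of smaller letters.
  entry i j := if j < μ.rowLen i then #{b ∈ range N | g (b + 1) i ≤ j} else 0
  row_weak' {i j j'} hj hc := by
    have h₁ := YoungDiagram.mem_iff_lt_rowLen.1 hc
    rw [if_pos h₁, if_pos (hj.trans h₁)]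
    refine card_le_card fun b hb => ?_
    rw [mem_filter] at hb ⊢
    exact ⟨hb.1, hb.2.trans hj.le⟩
  col_strict' {i i' j} hi hc := by
    have h₁ := YoungDiagram.mem_iff_lt_rowLen.1 hc
    have h₂ := h₁.trans_le (μ.rowLen_anti _ _ hi.le)
    rw [if_pos h₁, if_pos h₂]
    have hmono : ∀ i, Monotone fun b => g b i := fun i => monotone_nat_of_le_succ fun b => h.mono b i
    have hN : ∀ i, j < μ.rowLen i → #{b ∈ range N | g (b + 1) i ≤ j} < N := by
      intro i hj
      rcases Nat.eq_zero_or_pos N with rfl | hN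
      · rw [h.shape_eq_zero (Nat.zero_le i)] at hj
        omega
      · refine (card_lt_card (t := range N) ?_).trans_eq (card_range N)
        refine filter_ssubset.2 ⟨N - 1, by simpa using hN, ?_⟩
        rw [Nat.sub_add_cancel hN, h.top N i le_rfl]
        omega
    set t := #{b ∈ range N | g (b + 1) i ≤ j}
    have key : ∀ i, ∀ a < N, a < #{b ∈ range N | g (b + 1) i ≤ j} ↔ g (a + 1) i ≤ j := by
      intro i a ha
      refine lt_card_filter_range (fun a b hab _ hb => ?_) ha
      exact (hmono i (Nat.succ_le_succ hab)).trans hb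
    by_contra! hlt
    set t' := #{b ∈ range N | g (b + 1) i' ≤ j}
    have h₃ := (key i' t' (hN i' h₁)).not.1 (lt_irrefl _)
    obtain ⟨k, rfl⟩ : ∃ k, i' = k + 1 := ⟨i' - 1, by omega⟩
    have h₄ := h.inter t' k
    have h₅ := h.anti t' (show i ≤ k by omega)
    rcases Nat.eq_zero_or_pos t' with h₆ | h₆
    · rw [h₆, h.zero] at h₄
      rw [h₆] at h₃
      omega
    · have h₇ := (key i (t' - 1) (by have := hN i h₂; omega)).1 (by omega)
      rw [Nat.sub_add_cancel h₆] at h₇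
      omega
  zeros' {i j} hc := if_neg fun h => hc (YoungDiagram.mem_iff_lt_rowLen.2 h)

theorem toTableau_lt_iff {μ : YoungDiagram} {N : ℕ} {g : ℕ → ℕ → ℕ} (h : IsPattern N μ.rowLen g)
    {i j : ℕ} (hj : j < μ.rowLen i) (b : ℕ) : toTableau h i j < b ↔ j < g b i := by
  have hmono : Monotone fun b => g b i := monotone_nat_of_le_succ fun b => h.mono b i
  have h₁ : toTableau h i j = #{b ∈ range N | g (b + 1) i ≤ j} := if_pos hj
  have hle : #{b ∈ range N | g (b + 1) i ≤ j} ≤ N := by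
    simpa using card_filter_le (range N) fun b => g (b + 1) i ≤ j
  have key : ∀ a < N, a < #{b ∈ range N | g (b + 1) i ≤ j} ↔ g (a + 1) i ≤ j := by
    intro a ha
    refine lt_card_filter_range (fun a b hab _ hb => ?_) ha
    exact (hmono (Nat.succ_le_succ hab)).trans hb
  rw [h₁]
  rcases b with _ | b
  · rw [h.zero]; omega
  by_cases hb : b < N
  · have := key b hb
    omega
  · rw [h.top (b + 1) i (by omega)]
    omega

theorem ofTableau_toTableau {μ : YoungDiagram} {N : ℕ} {g : ℕ → ℕ → ℕ}
    (h : IsPattern N μ.rowLen g) : ofTableau (toTableau h) = g := by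
  funext b i
  rw [ofTableau, filter_congr fun j hj => toTableau_lt_iff h (mem_range.1 hj) b]
  rw [show {j ∈ range (μ.rowLen i) | j < g b i} = range (g b i) from ?_, card_range]
  ext j
  have := h.le_shape b i
  simp only [mem_filter, mem_range]
  omega

theorem entriesLT_toTableau {μ : YoungDiagram} {N : ℕ} {g : ℕ → ℕ → ℕ}
    (h : IsPattern N μ.rowLen g) : EntriesLT N (toTableau h) := by
  intro i j hij
  have hj := YoungDiagram.mem_iff_lt_rowLen.1 hij
  rw [toTableau_lt_iff h hj, h.top N i le_rfl]
  exact hj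

theorem content_eq_weight {μ : YoungDiagram} {N : ℕ} {T : SemistandardYoungTableau μ}
    (hT : EntriesLT N T) (a : ℕ) : T.content a = weight N (ofTableau T) a := by
  have hrow : ∀ i, N ≤ i → μ.rowLen i = 0 := fun i hi => (isPattern_ofTableau hT).shape_eq_zero hi
  have key : ∀ b, ∑ a ∈ range b, T.content a = ∑ i ∈ range N, ofTableau T b i := by
    intro b
    rw [T.sum_content, card_eq_sum_card_fiberwise (f := Prod.fst) (t := range N)]
    · refine sum_congr rfl fun i _ => ?_
      refine card_nbij' Prod.snd (fun j => (i, j)) ?_ ?_ ?_ ?_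
      · rintro ⟨i', j⟩ hc
        simp only [coe_filter, mem_filter, YoungDiagram.mem_cells, YoungDiagram.mem_iff_lt_rowLen,
          Set.mem_ofPred_eq, mem_range] at hc ⊢
        obtain ⟨h, rfl⟩ := hc
        exact h
      · intro j hc
        simp only [coe_filter, mem_filter, YoungDiagram.mem_cells, YoungDiagram.mem_iff_lt_rowLen,
          Set.mem_ofPred_eq, mem_range] at hc ⊢
        exact ⟨hc, trivial⟩
      · rintro ⟨i', j⟩ hc
        simp only [coe_filter, mem_filter, Set.mem_ofPred_eq] at hc
        rw [hc.2]
      · intro j _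
        rfl
    · intro c hc
      rw [mem_coe, mem_filter, YoungDiagram.mem_cells, YoungDiagram.mem_iff_lt_rowLen] at hc
      rw [mem_coe, mem_range]
      by_contra! h
      rw [hrow _ h] at hc
      omega
  have h₁ := key a
  have h₂ := key (a + 1)
  rw [sum_range_succ] at h₂
  unfold weight
  omega

-- A tableau whose content is supported below `N` has all its entries below `N`, so it is seen by
-- the patterns with `N` letters.
open Classical in
theorem coeff_schurFunction_eq_card {μ : YoungDiagram} {N : ℕ} {d : ℕ →₀ ℕ}
    (hd : ∀ a, N ≤ a → d a = 0) :
    MvPowerSeries.coeff d (schurFunction μ) =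
      (#{g ∈ patterns N μ.rowLen | ∀ a < N, weight N g a = d a} : ℚ) := by
  rw [coeff_schurFunction]
  congr 1
  have hlt : ∀ T : SemistandardYoungTableau μ, T.content = d → EntriesLT N T := by
    rintro T rfl i j hij
    by_contra! h
    have h₁ := hd _ h
    rw [T.content_apply, card_eq_zero] at h₁
    have : ((i, j) : ℕ × ℕ) ∈ μ.cells.filter fun c => T c.1 c.2 = T i j :=
      mem_filter.2 ⟨hij, rfl⟩
    rw [h₁] at this
    simp at this
  rw [← Fintype.card_coe, ← Nat.card_eq_fintype_card]
  refine Nat.card_eq_of_bijective (fun T => ⟨ofTableau T.1, ?_⟩) ⟨?_, ?_⟩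
  · rw [mem_filter, mem_patterns]
    refine ⟨isPattern_ofTableau (hlt T.1 T.2), fun a _ => ?_⟩
    rw [← content_eq_weight (hlt T.1 T.2), T.2]
  · rintro ⟨T, hT⟩ ⟨T', hT'⟩ h
    exact Subtype.ext (ofTableau_injective (congrArg Subtype.val h))
  · rintro ⟨g, hg⟩
    rw [mem_filter, mem_patterns] at hg
    refine ⟨⟨toTableau hg.1, ?_⟩, Subtype.ext (ofTableau_toTableau hg.1)⟩
    ext a
    rw [content_eq_weight (entriesLT_toTableau hg.1), ofTableau_toTableau]
    by_cases ha : a < N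
    · exact hg.2 a ha
    · rw [weight_of_ge hg.1 (not_lt.1 ha), hd a (not_lt.1 ha)]

/-- Two power series with the same coefficients at the monomials in the first `N` variables. -/
def Agree (N : ℕ) (f f' : MvPowerSeries ℕ ℚ) : Prop :=
  ∀ d : ℕ →₀ ℕ, (∀ a, N ≤ a → d a = 0) → MvPowerSeries.coeff d f = MvPowerSeries.coeff d f'

/-- Every factor of a monomial in the first `N` variables is again such a monomial. -/
theorem Agree.mul {N : ℕ} {f f' h h' : MvPowerSeries ℕ ℚ} (hf : Agree N f f') (hh : Agree N h h') :
    Agree N (f * h) (f' * h') := by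
  intro d hd
  rw [MvPowerSeries.coeff_mul, MvPowerSeries.coeff_mul]
  refine sum_congr rfl fun q hq => ?_
  have hq' : ∀ a, q.1 a + q.2 a = d a := fun a => by
    rw [← Finset.HasAntidiagonal.mem_antidiagonal.1 hq]
    rfl
  rw [hf q.1 fun a ha => by have := hq' a; rw [hd a ha] at this; omega,
    hh q.2 fun a ha => by have := hq' a; rw [hd a ha] at this; omega]

/-- A polynomial in `N` variables as a power series. -/
noncomputable def toSeries (N : ℕ) : MvPolynomial (Fin N) ℚ →+* MvPowerSeries ℕ ℚ :=
  (MvPolynomial.coeToMvPowerSeries.ringHom (σ := ℕ) (R := ℚ)).comp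
    (MvPolynomial.rename (Fin.val : Fin N → ℕ)).toRingHom

theorem agree_schurFunction (N : ℕ) (μ : YoungDiagram) :
    Agree N (schurFunction μ) (toSeries N (schurPoly N μ.rowLen)) := by
  classical
  intro d hd
  rw [coeff_schurFunction_eq_card hd, schurPoly]
  change _ = MvPowerSeries.coeff d
    ((MvPolynomial.rename (Fin.val : Fin N → ℕ) _ : MvPolynomial ℕ ℚ) : MvPowerSeries ℕ ℚ)
  rw [MvPolynomial.coeff_coe, map_sum, MvPolynomial.coeff_sum, card_filter, Nat.cast_sum]
  refine sum_congr rfl fun g _ => ?_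
  rw [map_prod]
  have h : ∏ a : Fin N, MvPolynomial.rename (R := ℚ) Fin.val (MvPolynomial.X a ^ weight N g a) =
      MvPolynomial.monomial (∑ a : Fin N, Finsupp.single (a : ℕ) (weight N g a)) 1 := by
    rw [MvPolynomial.monomial_sum_one]
    refine prod_congr rfl fun a _ => ?_
    rw [map_pow, MvPolynomial.rename_X, MvPolynomial.X_pow_eq_monomial]
  rw [h, MvPolynomial.coeff_monomial, Nat.cast_ite, Nat.cast_one, Nat.cast_zero]
  have h' : ∀ k, (∑ a : Fin N, Finsupp.single (a : ℕ) (weight N g a)) k =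
      if k < N then weight N g k else 0 := by
    intro k
    rw [Finsupp.finsetSum_apply]
    simp only [Finsupp.single_apply]
    split_ifs with hk
    · rw [sum_eq_single_of_mem ⟨k, hk⟩ (mem_univ _)]
      · simp
      · intro b _ hb
        rw [if_neg fun h => hb (Fin.ext h)]
    · exact sum_eq_zero fun a _ => if_neg fun (h : (a : ℕ) = k) => hk (h ▸ a.2)
  refine if_congr ⟨fun H => ?_, fun H a ha => ?_⟩ rfl rfl
  · ext k
    rw [h']
    split_ifs with hk
    · exact H k hk
    · exact (hd k (not_lt.1 hk)).symm
  · rw [← H, h', if_pos ha]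

end GelfandTsetlin

/-! ### The Littlewood–Richardson rule in terms of rows -/

namespace GelfandTsetlin

open Finset

/-! ### Independence of the number of variables -/

section stable

variable {N N' : ℕ} {μ ν : ℕ → ℕ} {g : ℕ → ℕ → ℕ}

theorem sum_range_of_ge {f : ℕ → ℕ} (hN : N ≤ N') (h : ∀ i, N ≤ i → f i = 0) :
    ∑ i ∈ range N', f i = ∑ i ∈ range N, f i :=
  (sum_subset (range_subset_range.2 hN) fun i _ hi => h i (not_lt.1 fun h' => hi (mem_range.2 h'))).symm

theorem weight_of_le (hN : N ≤ N') (h : IsPattern N ν g) (a : ℕ) : weight N' g a = weight N g a := by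
  rw [weight, weight, sum_range_of_ge hN fun i hi => h.eq_zero_of_ge _ hi,
    sum_range_of_ge hN fun i hi => h.eq_zero_of_ge _ hi]

theorem tail_of_pattern_le (hN : N ≤ N') (h : IsPattern N ν g) (b c : ℕ) :
    tail N' g b c = tail N g b c + (N' - N) * c := by
  obtain ⟨k, rfl⟩ := Nat.exists_eq_add_of_le hN
  rw [tail, sum_range_add, tail, Nat.add_sub_cancel_left]
  congr 1
  rw [sum_congr rfl fun i _ => show max (g b (N + i)) c = c by
    rw [h.eq_zero_of_ge b (Nat.le_add_right N i), Nat.zero_max]]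
  simp

theorem _root_.IsPattern.of_le (hN : N ≤ N') (h : IsPattern N ν g) : IsPattern N' ν g :=
  ⟨h.zero, fun b i hb => h.top b i (hN.trans hb), h.mono, h.inter⟩

theorem sum_weight (h : IsPattern N ν g) (b : ℕ) :
    ∑ a ∈ range b, weight N g a = ∑ i ∈ range N, g b i := by
  induction b with
  | zero => simp [h.zero]
  | succ b ih =>
    have := h.sum_mono b
    rw [sum_range_succ, ih, weight]
    omega

/-- The additional rows are empty and add the same constant to all tails, which cancels. The
additional inequalities concern letters `p + 1 ≥ N`, which do not occur, and follow from `μ` being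
antitone. -/
theorem isDominant_iff_of_le (hN : N ≤ N') (h : IsPattern N ν g) (hμ : Antitone μ) :
    IsDominant N' μ g ↔ IsDominant N μ g := by
  have ht := tail_of_pattern_le hN h
  refine ⟨fun H p c hp => ?_, fun H p c hp => ?_⟩
  · have h₁ := H p c (by omega)
    rw [ht, ht, ht] at h₁
    omega
  · rw [ht, ht, ht]
    by_cases hp' : p + 1 < N
    · have h₁ := H p c hp'
      omega
    · have h₁ : tail N g (p + 2) c = tail N g (p + 1) c :=
        sum_congr rfl fun i _ => by rw [h.top _ _ (by omega), h.top _ _ (by omega)]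
      have h₂ : tail N g p c ≤ tail N g (p + 1) c :=
        sum_le_sum fun i _ => max_le_max_right _ (h.mono p i)
      have h₃ := hμ (Nat.le_add_right p 1)
      omega

/-- Letters of dominant patterns are smaller than the total size of the partitions. -/
theorem isPattern_of_isDominant (hN : N ≤ N') (h : IsPattern N' ν g) (hμ : Antitone μ)
    (hd : IsDominant N' μ g) (hsize : ∑ i ∈ range N', μ i + ∑ i ∈ range N', ν i ≤ N) :
    IsPattern N ν g := by
  have hanti := antitone_add_weight h hμ hd
  -- If the letter `a` occurs, the partition `μ + weight` has at least `a + 1 > N` nonzero rows,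
  -- hence more boxes than `hsize` permits.
  have hzero : ∀ a, N ≤ a → weight N' g a = 0 := by
    intro a ha
    by_cases ha' : a < N'
    swap
    · exact weight_of_ge h (not_lt.1 ha')
    by_contra! hne
    have h₁ : ∑ i ∈ range (a + 1), 1 ≤ ∑ i ∈ range (a + 1), (μ i + weight N' g i) := by
      refine sum_le_sum fun i hi => ?_
      have := hanti (Nat.lt_succ_iff.1 (mem_range.1 hi))
      simp only at this
      omega
    have h₂ : ∑ i ∈ range (a + 1), (μ i + weight N' g i) ≤
        ∑ i ∈ range N', (μ i + weight N' g i) :=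
      sum_le_sum_of_subset (range_subset_range.2 ha')
    replace h₁ := h₁.trans h₂
    have htop : ∑ i ∈ range N', g N' i = ∑ i ∈ range N', ν i :=
      sum_congr rfl fun i _ => h.top N' i le_rfl
    rw [sum_add_distrib, sum_weight h, htop] at h₁
    simp only [sum_const, card_range, smul_eq_mul, mul_one] at h₁
    omega
  have htop : ∀ k i, g (N + k) i = g N i := by
    intro k i
    induction k with
    | zero => rfl
    | succ k ih =>
      rw [← ih, ← add_assoc]
      have h₁ := hzero (N + k) (by omega)
      unfold weight at h₁
      by_cases hi : i < N'
      · by_contra! hne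
        have h₂ : ∑ i ∈ range N', g (N + k) i < ∑ i ∈ range N', g (N + k + 1) i :=
          sum_lt_sum (fun i _ => h.mono _ i)
            ⟨i, mem_range.2 hi, lt_of_le_of_ne (h.mono _ i) (Ne.symm hne)⟩
        omega
      · rw [h.eq_zero_of_ge _ (not_lt.1 hi), h.eq_zero_of_ge _ (not_lt.1 hi)]
  refine ⟨h.zero, fun b i hb => ?_, h.mono, h.inter⟩
  obtain ⟨k, rfl⟩ := Nat.exists_eq_add_of_le hb
  obtain ⟨k', rfl⟩ := Nat.exists_eq_add_of_le hN
  rw [htop, ← htop k', h.top _ i le_rfl]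

end stable

open Classical in
/-- The `μ`-dominant patterns. -/
noncomputable def dominantPatterns (N : ℕ) (μ ν : ℕ → ℕ) : Finset (ℕ → ℕ → ℕ) :=
  {g ∈ patterns N ν | IsDominant N μ g}

theorem mem_dominantPatterns {N : ℕ} {μ ν : ℕ → ℕ} {g : ℕ → ℕ → ℕ} :
    g ∈ dominantPatterns N μ ν ↔ IsPattern N ν g ∧ IsDominant N μ g := by
  simp [dominantPatterns]

theorem dominantPatterns_eq {N N' : ℕ} {μ ν : ℕ → ℕ} (hN : N ≤ N') (hμ : Antitone μ)
    (hsize : ∑ i ∈ range N', μ i + ∑ i ∈ range N', ν i ≤ N) :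
    dominantPatterns N' μ ν = dominantPatterns N μ ν := by
  ext g
  rw [mem_dominantPatterns, mem_dominantPatterns]
  refine ⟨fun h => ?_, fun h => ?_⟩
  · have := isPattern_of_isDominant hN h.1 hμ h.2 hsize
    exact ⟨this, (isDominant_iff_of_le hN this hμ).1 h.2⟩
  · exact ⟨h.1.of_le hN, (isDominant_iff_of_le hN h.1 hμ).2 h.2⟩

/-- The diagram of `μ` plus the weight of a dominant pattern. -/
noncomputable def addWeight {N : ℕ} {μ : YoungDiagram} {ν : ℕ → ℕ}
    (g : {g // g ∈ dominantPatterns N μ.rowLen ν}) : YoungDiagram :=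
  .ofRowLen N (fun a => μ.rowLen a + weight N g.1 a)
    (antitone_add_weight (mem_dominantPatterns.1 g.2).1 μ.rowLen_antitone
      (mem_dominantPatterns.1 g.2).2)

theorem rowLen_addWeight {N : ℕ} {μ : YoungDiagram} {ν : ℕ → ℕ} (hμ : μ.card ≤ N)
    (g : {g // g ∈ dominantPatterns N μ.rowLen ν}) :
    (addWeight g).rowLen = fun a => μ.rowLen a + weight N g.1 a := by
  refine YoungDiagram.rowLen_ofRowLen _ fun i hi => ?_
  rw [μ.rowLen_eq_zero (hμ.trans hi), weight_of_ge (mem_dominantPatterns.1 g.2).1 hi]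

theorem card_addWeight {N : ℕ} {μ ν : YoungDiagram} (hμ : μ.card ≤ N) 
    (g : {g // g ∈ dominantPatterns N μ.rowLen ν.rowLen}) :
    (addWeight g).card = μ.card + ν.card := by
  have hg := (mem_dominantPatterns.1 g.2).1
  rw [← YoungDiagram.sum_rowLen (addWeight g) (N := N), rowLen_addWeight hμ, sum_add_distrib,
    sum_weight hg, YoungDiagram.sum_rowLen μ fun i hi => μ.rowLen_eq_zero (hμ.trans hi),
    sum_congr rfl fun i _ => hg.top N i le_rfl, YoungDiagram.sum_rowLen]
  · exact fun i hi => hg.shape_eq_zero hi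
  · intro i hi
    rw [rowLen_addWeight hμ]
    simp only
    rw [μ.rowLen_eq_zero (hμ.trans hi), weight_of_ge hg hi]

/-- The Littlewood–Richardson rule for Schur functions. -/
theorem schurFunction_mul {N : ℕ} {μ ν : YoungDiagram} (h : μ.card + ν.card ≤ N) :
    schurFunction μ * schurFunction ν =
      ∑ g : {g // g ∈ dominantPatterns N μ.rowLen ν.rowLen}, schurFunction (addWeight g) := by
  classical
  ext d
  -- Enough variables for the monomial at hand; the dominant patterns are those with `N` letters all
  -- the same.
  obtain ⟨N', hN, hd⟩ : ∃ N' ≥ N, ∀ a, N' ≤ a → d a = 0 := by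
    refine ⟨max N (d.support.sup id + 1), le_max_left _ _, fun a ha => ?_⟩
    by_contra! hne
    have h₁ := Finset.le_sup (f := id) (Finsupp.mem_support_iff.2 hne)
    simp only [id] at h₁
    omega
  have hμ : ∀ i, N' ≤ i → μ.rowLen i = 0 := fun i hi => μ.rowLen_eq_zero (by omega)
  have hν : ∀ i, N' ≤ i → ν.rowLen i = 0 := fun i hi => ν.rowLen_eq_zero (by omega)
  rw [((agree_schurFunction N' μ).mul (agree_schurFunction N' ν)) d hd, ← map_mul,
    schurPoly_mul_schurPoly μ.rowLen_antitone hμ, map_sum, map_sum, map_sum]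
  have hset : (patterns N' ν.rowLen).filter (IsDominant N' μ.rowLen) =
      dominantPatterns N μ.rowLen ν.rowLen := by
    rw [← dominantPatterns_eq hN μ.rowLen_antitone, dominantPatterns]
    rw [YoungDiagram.sum_rowLen μ hμ, YoungDiagram.sum_rowLen ν hν]
    exact h
  rw [hset, ← sum_coe_sort]
  refine sum_congr rfl fun g _ => ?_
  rw [agree_schurFunction N' (addWeight g) d hd, rowLen_addWeight (by omega)]
  congr 3
  funext a
  rw [weight_of_le hN (mem_dominantPatterns.1 g.2).1]

/-! #### Dominance in terms of rows -/

section rows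

variable {N : ℕ} {μ ν : ℕ → ℕ} {g : ℕ → ℕ → ℕ}

theorem tail_eq_of_cut {b c k : ℕ} (hk : k ≤ N) (h₁ : ∀ i < k, c ≤ g b i)
    (h₂ : ∀ i, k ≤ i → g b i ≤ c) : tail N g b c = ∑ i ∈ range k, g b i + (N - k) * c := by
  obtain ⟨m, rfl⟩ := Nat.exists_eq_add_of_le hk
  rw [tail, sum_range_add, Nat.add_sub_cancel_left]
  congr 1
  · exact sum_congr rfl fun i hi => max_eq_left (h₁ i (mem_range.1 hi))
  · rw [sum_congr rfl fun i _ => max_eq_right (h₂ (k + i) (Nat.le_add_right k i))]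
    simp

/-- Dominance can be checked at the ends of the rows. -/
theorem isDominant_iff_rows (h : IsPattern N ν g) (hμ : Antitone μ) :
    IsDominant N μ g ↔ ∀ p i, p + 1 < N → i < N →
      μ (p + 1) + ∑ j ∈ range (i + 1), g (p + 2) j + ∑ j ∈ range i, g p j ≤
        μ p + ∑ j ∈ range (i + 1), g (p + 1) j + ∑ j ∈ range i, g (p + 1) j := by
  refine ⟨fun H p i hp hi => ?_, fun H p c hp => ?_⟩
  -- The column where the letters `p + 1` of row `i` begin: all of these are counted, and the
  -- letters `p` of the rows before row `i` only.
  · have h₀ := H p (g (p + 1) i) hp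
    rw [tail_eq_of_cut (b := p + 2) (k := i + 1) hi
        (fun j hj => (h.anti (p + 1) (Nat.lt_succ_iff.1 hj)).trans (h.mono (p + 1) j))
        (fun j hj => (h.anti (p + 2) hj).trans (h.inter (p + 1) i)),
      tail_eq_of_cut (b := p + 1) (k := i) hi.le (fun j hj => h.anti (p + 1) hj.le)
        (fun j hj => h.anti (p + 1) hj),
      tail_eq_of_cut (b := p) (k := i) hi.le
        (fun j hj => (h.anti (p + 1) hj).trans (h.inter p j))
        (fun j hj => (h.mono p j).trans (h.anti (p + 1) hj))] at h₀
    rw [sum_range_succ (fun j => g (p + 1) j)]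
    obtain ⟨m, rfl⟩ := Nat.exists_eq_add_of_lt hi
    rw [show i + m + 1 - (i + 1) = m by omega, show i + m + 1 - i = m + 1 by omega,
      add_one_mul] at h₀
    omega
  · by_cases hz : c < g (p + 2) 0
    swap
    · have h₁ : ∀ b ≤ p + 2, tail N g b c = 0 + (N - 0) * c := by
        intro b hb
        refine (tail_eq_of_cut (Nat.zero_le N) (fun j hj => absurd hj (Nat.not_lt_zero j))
          fun i _ => ?_)
        have hmono : Monotone fun b => g b i := monotone_nat_of_le_succ fun b => h.mono b i
        exact ((hmono hb).trans (h.anti (p + 2) (Nat.zero_le i))).trans (not_lt.1 hz)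
      have := hμ (Nat.le_add_right p 1)
      rw [h₁ _ (by omega), h₁ _ (by omega), h₁ _ (by omega)]
      omega
    -- The last row with letters `≤ p + 1` beyond column `c`. Each of the rows below it contributes
    -- the constant `c` to all three tails.
    · obtain ⟨i, hi, hmax⟩ := exists_last_of_bounded (P := fun i => c < g (p + 2) i) (B := N) hz
        (fun i hi => by
          by_contra! h'
          rw [h.eq_zero_of_ge _ h'] at hi
          omega)
      have hiN : i < N := by
        by_contra! h'
        rw [h.eq_zero_of_ge _ h'] at hi
        omega
      have h₀ := H p i hp hiN
      have hafter : ∀ j, i < j → g (p + 2) j ≤ c := fun j hj => not_lt.1 (hmax j hj)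
      have hz := tail_eq_of_cut (N := N) (g := g) (b := p + 2) (c := c) (k := i + 1) hiN
        (fun j hj => hi.le.trans (h.anti (p + 2) (Nat.lt_succ_iff.1 hj))) (fun j hj => hafter j hj)
      have split : ∀ f : ℕ → ℕ, (∀ j, i < j → f j ≤ c) → ∑ j ∈ range N, max (f j) c =
          ∑ j ∈ range i, max (f j) c + max (f i) c + (N - (i + 1)) * c := by
        intro f hf
        obtain ⟨m, rfl⟩ := Nat.exists_eq_add_of_lt hiN
        rw [show i + m + 1 = i + 1 + m by omega, sum_range_add, sum_range_succ,
          Nat.add_sub_cancel_left, sum_congr rfl fun j _ => max_eq_right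
            (hf (i + 1 + j) (by omega))]
        simp
      have hy : tail N g (p + 1) c =
          ∑ j ∈ range i, g (p + 1) j + max (g (p + 1) i) c + (N - (i + 1)) * c := by
        rw [tail, split _ fun j hj => (h.mono (p + 1) j).trans (hafter j hj)]
        congr 2
        refine sum_congr rfl fun j hj => max_eq_left ?_
        exact (hi.le.trans (h.anti (p + 2) (mem_range.1 hj))).trans (h.inter (p + 1) j)
      have hx : tail N g p c =
          ∑ j ∈ range i, max (g p j) c + max (g p i) c + (N - (i + 1)) * c := by
        rw [tail, split _ fun j hj =>
          (h.mono p j).trans ((h.mono (p + 1) j).trans (hafter j hj))]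
      have m₀ := h.mono p i
      have m₁ := h.mono (p + 1) i
      rw [sum_range_succ (fun j => g (p + 1) j)] at h₀
      rcases i with _ | i
      · simp only [range_zero, sum_empty, zero_add] at *
        omega
      · have hx' : ∑ j ∈ range i, max (g p j) c = ∑ j ∈ range i, g p j := by
          refine sum_congr rfl fun j hj => max_eq_left ?_
          have h₁ := h.anti (p + 2) (show j + 2 ≤ i + 1 by have := mem_range.1 hj; omega)
          exact hi.le.trans (h₁.trans ((h.inter (p + 1) (j + 1)).trans (h.inter p j)))
        rw [sum_range_succ (fun j => max (g p j) c), hx'] at hx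
        rw [sum_range_succ (fun j => g p j)] at h₀
        have m₂ := h.inter p i
        omega

end rows

end GelfandTsetlin

/-! ### Littlewood–Richardson coefficients as numbers of sequences of row vectors -/

namespace GelfandTsetlin

open Finset

/-- `v` is an admissible row of length `p` below the row `prev`, with letters `< N`: column strictness,
and adding the row to the partition `cur`, letters in decreasing order, passes through partitions. -/
structure RowStep (N : ℕ) (cur : ℕ → ℕ) (prev : Option (ℕ → ℕ)) (p : ℕ) (v : ℕ → ℕ) : Prop where
  supp : ∀ a, N ≤ a → v a = 0
  sum : ∑ a ∈ range N, v a = p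
  strip : ∀ a, cur (a + 1) + v (a + 1) ≤ cur a
  col : ∀ u ∈ prev, ∀ a, ∑ b ∈ range (a + 1), v b ≤ ∑ b ∈ range a, u b

/-- Sequences of admissible rows of given lengths. -/
def Rows (N : ℕ) : (ℕ → ℕ) → Option (ℕ → ℕ) → List ℕ → List (ℕ → ℕ) → Prop
  | _, _, [], vs => vs = []
  | _, _, _ :: _, [] => False
  | cur, prev, p :: ps, v :: vs => RowStep N cur prev p v ∧ Rows N (cur + v) (some v) ps vs

/-- Sequences of admissible rows, where `none` separates the partitions, which lead to `lam`. -/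
def RowSeq (N : ℕ) (lam : ℕ → ℕ) :
    (ℕ → ℕ) → Option (ℕ → ℕ) → List (Option ℕ) → List (ℕ → ℕ) → Prop
  | cur, _, [], vs => vs = [] ∧ cur = lam
  | cur, _, none :: ts, vs => RowSeq N lam cur none ts vs
  | _, _, some _ :: _, [] => False
  | cur, prev, some p :: ts, v :: vs =>
    RowStep N cur prev p v ∧ RowSeq N lam (cur + v) (some v) ts vs

/-- The row lengths of a sequence of partitions. -/
def rowTokens (αs : List YoungDiagram) : List (Option ℕ) :=
  αs.flatMap fun α => α.rowLens.map some ++ [none]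

theorem rowSeq_append {N : ℕ} {lam cur : ℕ → ℕ} {prev : Option (ℕ → ℕ)} {ps : List ℕ}
    {ts : List (Option ℕ)} {vs : List (ℕ → ℕ)} :
    RowSeq N lam cur prev (ps.map some ++ none :: ts) vs ↔ ∃ vs₁ vs₂, vs = vs₁ ++ vs₂ ∧
      Rows N cur prev ps vs₁ ∧ RowSeq N lam (cur + vs₁.sum) none ts vs₂ := by
  induction ps generalizing cur prev vs with
  | nil =>
    refine ⟨fun h => ⟨[], vs, rfl, rfl, by simpa [RowSeq] using h⟩, ?_⟩
    rintro ⟨vs₁, vs₂, rfl, rfl, h⟩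
    simpa [RowSeq] using h
  | cons p ps ih =>
    rcases vs with _ | ⟨v, vs⟩
    · refine ⟨fun h => h.elim, ?_⟩
      rintro ⟨vs₁, vs₂, h, h', -⟩
      obtain ⟨rfl, rfl⟩ := List.append_eq_nil_iff.1 h.symm
      exact h'
    · simp only [List.map_cons, List.cons_append, RowSeq, ih]
      constructor
      · rintro ⟨h, vs₁, vs₂, rfl, h₁, h₂⟩
        exact ⟨v :: vs₁, vs₂, rfl, ⟨h, h₁⟩, by rwa [List.sum_cons, ← add_assoc]⟩
      · rintro ⟨vs₁, vs₂, h, h₁, h₂⟩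
        rcases vs₁ with _ | ⟨v', vs₁⟩
        · exact h₁.elim
        · obtain ⟨rfl, rfl⟩ := List.cons.inj h
          exact ⟨h₁.1, vs₁, vs₂, rfl, h₁.2, by rwa [List.sum_cons, ← add_assoc] at h₂⟩

theorem Rows.length_eq {N : ℕ} {cur : ℕ → ℕ} {prev : Option (ℕ → ℕ)} {ps : List ℕ}
    {vs : List (ℕ → ℕ)} (h : Rows N cur prev ps vs) : vs.length = ps.length := by
  induction ps generalizing cur prev vs with
  | nil => rw [show vs = [] from h]; rfl
  | cons p ps ih =>
    rcases vs with _ | ⟨v, vs⟩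
    · exact h.elim
    · simpa using ih h.2

theorem Rows.rowStep {N : ℕ} {cur : ℕ → ℕ} {prev : Option (ℕ → ℕ)} {ps : List ℕ}
    {vs : List (ℕ → ℕ)} (h : Rows N cur prev ps vs) {i : ℕ} (hi : i < ps.length) :
    RowStep N (cur + ∑ j ∈ range i, vs.getD j 0) (if i = 0 then prev else some (vs.getD (i - 1) 0))
      (ps.getD i 0) (vs.getD i 0) := by
  induction ps generalizing cur prev vs i with
  | nil => exact absurd hi (Nat.not_lt_zero i)
  | cons p ps ih =>
    rcases vs with _ | ⟨v, vs⟩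
    · exact h.elim
    rcases i with _ | i
    · simpa using h.1
    · have := ih h.2 (i := i) (by simpa using hi)
      rw [sum_range_succ', if_neg (Nat.succ_ne_zero i)]
      simp only [List.getD_cons_succ, List.getD_cons_zero, Nat.add_sub_cancel]
      rw [add_assoc, add_comm v] at this
      convert this using 1
      rcases i with _ | i
      · simp
      · simp

/-- The number of letters `a` in row `i` of a pattern. -/
def rowVec (g : ℕ → ℕ → ℕ) (i a : ℕ) : ℕ := g (a + 1) i - g a i

/-! ### Patterns and their rows -/

section

variable {N : ℕ} {μ ν : ℕ → ℕ} {g : ℕ → ℕ → ℕ}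

theorem sum_rowVec (h : IsPattern N ν g) (i b : ℕ) : ∑ a ∈ range b, rowVec g i a = g b i := by
  induction b with
  | zero => simp [h.zero]
  | succ b ih =>
    have := h.mono b i
    rw [sum_range_succ, ih, rowVec]
    omega

theorem rowVec_of_ge (h : IsPattern N ν g) (i : ℕ) {a : ℕ} (ha : N ≤ a) : rowVec g i a = 0 := by
  rw [rowVec, h.top _ i ha, h.top _ i (by omega), Nat.sub_self]

theorem sum_rowVec_add (h : IsPattern N ν g) (k a : ℕ) :
    ∑ i ∈ range k, rowVec g i a + ∑ i ∈ range k, g a i = ∑ i ∈ range k, g (a + 1) i := by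
  rw [← sum_add_distrib]
  exact sum_congr rfl fun i _ => Nat.sub_add_cancel (h.mono a i)

/-- The strip condition is the row form of dominance, and the column condition is the interlacing
inequality expressed through partial sums of the rows. -/
theorem rowStep_rowVec (h : IsPattern N ν g) (hμ : Antitone μ) (h₀ : ∀ i, N ≤ i → μ i = 0)
    (hd : IsDominant N μ g) {i : ℕ} (hi : i < N) :
    RowStep N (μ + ∑ j ∈ range i, rowVec g j) (if i = 0 then none else some (rowVec g (i - 1)))
      (ν i) (rowVec g i) := by
  refine ⟨fun a ha => rowVec_of_ge h i ha, by rw [sum_rowVec h, h.top N i le_rfl], fun a => ?_,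
    fun u hu a => ?_⟩
  · simp only [Pi.add_apply, Finset.sum_apply]
    by_cases ha : a + 1 < N
    · have h₁ := (isDominant_iff_rows h hμ).1 hd a i ha hi
      have h₂ := sum_rowVec_add h (i + 1) (a + 1)
      have h₃ := sum_rowVec_add h i a
      rw [sum_range_succ] at h₂
      simp only [add_assoc, Nat.reduceAdd] at *
      omega
    · rw [h₀ (a + 1) (by omega), rowVec_of_ge h i (by omega),
        sum_eq_zero fun j _ => rowVec_of_ge h j (by omega)]
      exact Nat.zero_le _
  · rcases i with _ | i
    · simp at hu
    · simp only [Nat.succ_ne_zero, if_false, Nat.add_sub_cancel, Option.mem_some_iff] at hu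
      subst hu
      rw [sum_rowVec h, sum_rowVec h]
      exact h.inter a i

theorem rows_rowVec (h : IsPattern N ν g) (hμ : Antitone μ) (h₀ : ∀ i, N ≤ i → μ i = 0)
    (hd : IsDominant N μ g) {k m : ℕ} (hm : k + m ≤ N) :
    Rows N (μ + ∑ j ∈ range k, rowVec g j) (if k = 0 then none else some (rowVec g (k - 1)))
      ((List.range' k m).map ν) ((List.range' k m).map (rowVec g)) := by
  induction m generalizing k with
  | zero => rfl
  | succ m ih =>
    rw [List.range'_succ, List.map_cons, List.map_cons]
    refine ⟨rowStep_rowVec h hμ h₀ hd (by omega), ?_⟩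
    have := ih (k := k + 1) (by omega)
    rwa [sum_range_succ, ← add_assoc, if_neg (Nat.succ_ne_zero k), Nat.add_sub_cancel] at this

/-- The pattern of a sequence of rows. -/
def ofRows (vs : List (ℕ → ℕ)) (b i : ℕ) : ℕ := ∑ a ∈ range b, vs.getD i 0 a

theorem rowVec_ofRows (vs : List (ℕ → ℕ)) (i : ℕ) : rowVec (ofRows vs) i = vs.getD i 0 := by
  funext a
  rw [rowVec, ofRows, ofRows, sum_range_succ, Nat.add_sub_cancel_left]

theorem isPattern_ofRows {α : YoungDiagram} {vs : List (ℕ → ℕ)}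
    (h : Rows N μ none α.rowLens vs) : IsPattern N α.rowLen (ofRows vs) := by
  have hlen := h.length_eq
  have hget : ∀ i < α.rowLens.length, α.rowLens.getD i 0 = α.rowLen i := by
    intro i hi
    rw [List.getD_eq_getElem _ _ hi, YoungDiagram.get_rowLens]
  have hout : ∀ i, α.rowLens.length ≤ i → vs.getD i 0 = 0 := fun i hi =>
    List.getD_eq_default _ _ (hlen ▸ hi)
  have hout' : ∀ i, α.rowLens.length ≤ i → α.rowLen i = 0 := by
    intro i hi
    rw [YoungDiagram.length_rowLens] at hi
    by_contra! hne
    have := YoungDiagram.mem_iff_lt_colLen.1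
      (YoungDiagram.mem_iff_lt_rowLen.2 (Nat.pos_of_ne_zero hne))
    omega
  refine ⟨fun i => by simp [ofRows], fun b i hb => ?_, fun b i => ?_, fun b i => ?_⟩
  · rw [ofRows]
    by_cases hi : i < α.rowLens.length
    · have hs := h.rowStep hi
      rw [sum_range_of_ge hb hs.supp, hs.sum, hget i hi]
    · rw [hout i (not_lt.1 hi), hout' i (not_lt.1 hi)]
      simp
  · exact sum_le_sum_of_subset (range_subset_range.2 (Nat.le_succ b))
  · by_cases hi : i + 1 < α.rowLens.length
    · exact (h.rowStep hi).col _ (by simp) b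
    · rw [ofRows, hout (i + 1) (not_lt.1 hi)]
      simp

theorem isDominant_ofRows {α : YoungDiagram} {vs : List (ℕ → ℕ)} (hμ : Antitone μ)
    (h : Rows N μ none α.rowLens vs) : IsDominant N μ (ofRows vs) := by
  have hp := isPattern_ofRows h
  rw [isDominant_iff_rows hp hμ]
  intro p i hpN _
  have h₂ := sum_rowVec_add hp (i + 1) (p + 1)
  have h₃ := sum_rowVec_add hp i p
  simp only [rowVec_ofRows, add_assoc, Nat.reduceAdd] at h₂ h₃
  rw [sum_range_succ] at h₂
  by_cases hi : i < α.rowLens.length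
  · have h₁ := (h.rowStep hi).strip p
    simp only [Pi.add_apply, Finset.sum_apply] at h₁
    omega
  · have hout : ∀ i, α.rowLens.length ≤ i → ∀ b, ofRows vs b i = 0 := fun i hi b => by
      rw [ofRows, List.getD_eq_default _ _ (h.length_eq ▸ hi)]
      simp
    -- Past the last row no letters are added. The inequality is inherited from the last row, or
    -- from `μ` being antitone if there are no rows.
    clear h₂ h₃
    induction i with
    | zero =>
      have := hμ (Nat.le_add_right p 1)
      simp only [zero_add, range_one, sum_singleton, range_zero, sum_empty, add_zero]
      rw [hout 0 (not_lt.1 hi)]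
      omega
    | succ i ih =>
      rw [sum_range_succ, sum_range_succ (fun j => ofRows vs (p + 1) j) (i + 1),
        hout _ (not_lt.1 hi), hout _ (not_lt.1 hi), add_zero, add_zero]
      by_cases hi' : i < α.rowLens.length
      · have h₁ := (h.rowStep hi').strip p
        have h₂ := sum_rowVec_add hp (i + 1) (p + 1)
        have h₃ := sum_rowVec_add hp i p
        have h₄ := hp.mono p i
        simp only [rowVec_ofRows, add_assoc, Nat.reduceAdd] at h₂ h₃
        rw [sum_range_succ] at h₂
        simp only [Pi.add_apply, Finset.sum_apply] at h₁
        rw [sum_range_succ (fun j => ofRows vs p j), sum_range_succ (fun j => ofRows vs (p + 1) j)]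
        rw [sum_range_succ (fun j => ofRows vs (p + 1) j)] at h₂
        omega
      · have h₁ := ih (by omega) hi'
        have h₄ := hp.mono p i
        rw [sum_range_succ (fun j => ofRows vs p j)]
        rw [sum_range_succ (fun j => ofRows vs (p + 1) j)] at h₁ ⊢
        omega

end

theorem length_rowLens_le {α : YoungDiagram} {N : ℕ} (h : ∀ i, N ≤ i → α.rowLen i = 0) :
    α.rowLens.length ≤ N := by
  rw [YoungDiagram.length_rowLens]
  by_contra! hlt
  have := YoungDiagram.mem_iff_lt_rowLen.1 (YoungDiagram.mem_iff_lt_colLen.2 hlt)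
  rw [h N le_rfl] at this
  omega

/-- The rows of a pattern. -/
def toRows (α : YoungDiagram) (g : ℕ → ℕ → ℕ) : List (ℕ → ℕ) :=
  (List.range α.rowLens.length).map (rowVec g)

theorem rowLen_eq_zero_of_length_le {α : YoungDiagram} {i : ℕ} (hi : α.rowLens.length ≤ i) :
    α.rowLen i = 0 := by
  rw [YoungDiagram.length_rowLens] at hi
  by_contra! hne
  have := YoungDiagram.mem_iff_lt_colLen.1
    (YoungDiagram.mem_iff_lt_rowLen.2 (Nat.pos_of_ne_zero hne))
  omega

theorem rows_toRows {N : ℕ} {μ α : YoungDiagram} {g : ℕ → ℕ → ℕ} (hμ : μ.card ≤ N)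
    (hg : g ∈ dominantPatterns N μ.rowLen α.rowLen) :
    Rows N μ.rowLen none α.rowLens (toRows α g) := by
  obtain ⟨h₁, h₂⟩ := mem_dominantPatterns.1 hg
  have hl := length_rowLens_le fun i hi => h₁.shape_eq_zero hi
  have := rows_rowVec (k := 0) (m := α.rowLens.length) h₁ μ.rowLen_antitone
    (fun i hi => μ.rowLen_eq_zero (hμ.trans hi)) h₂ (by omega)
  rw [toRows, List.range_eq_range']
  simpa [YoungDiagram.rowLens, List.range_eq_range'] using this

theorem toRows_injOn {N : ℕ} {μ : ℕ → ℕ} {α : YoungDiagram} :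
    Set.InjOn (toRows α) (dominantPatterns N μ α.rowLen) := by
  intro g hg g' hg' h
  have hg := (mem_dominantPatterns.1 (mem_coe.1 hg)).1
  have hg' := (mem_dominantPatterns.1 (mem_coe.1 hg')).1
  funext b i
  by_cases hi : i < α.rowLens.length
  · have : rowVec g i = rowVec g' i := List.map_inj_left.1 h i (List.mem_range.2 hi)
    rw [← sum_rowVec hg, this, sum_rowVec hg']
  · have h₀ := rowLen_eq_zero_of_length_le (not_lt.1 hi)
    have h₁ := hg.le_shape b i
    have h₂ := hg'.le_shape b i
    omega

theorem exists_toRows {N : ℕ} {μ α : YoungDiagram} {vs : List (ℕ → ℕ)}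
    (h : Rows N μ.rowLen none α.rowLens vs) :
    ∃ g ∈ dominantPatterns N μ.rowLen α.rowLen, toRows α g = vs := by
  refine ⟨ofRows vs, mem_dominantPatterns.2
    ⟨isPattern_ofRows h, isDominant_ofRows μ.rowLen_antitone h⟩, ?_⟩
  refine List.ext_getElem (by simp [toRows, h.length_eq]) fun i h₁ h₂ => ?_
  simp only [toRows, List.getElem_map, List.getElem_range, rowVec_ofRows]
  exact List.getD_eq_getElem _ _ h₂

theorem sum_toRows {N : ℕ} {α : YoungDiagram} {g : ℕ → ℕ → ℕ} (h : IsPattern N α.rowLen g) :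
    (toRows α g).sum = weight N g := by
  have hl := length_rowLens_le fun i hi => h.shape_eq_zero hi
  funext a
  have hs : ∀ m, ((List.range m).map (rowVec g)).sum = ∑ i ∈ range m, rowVec g i := by
    intro m
    induction m with
    | zero => rfl
    | succ m ih => rw [List.range_succ, List.map_append, List.sum_append, ih, sum_range_succ]; simp
  have h₀ : ∀ b i, α.rowLens.length ≤ i → g b i = 0 := fun b i hi =>
    Nat.le_zero.1 ((h.le_shape b i).trans (rowLen_eq_zero_of_length_le hi).le)
  have := sum_rowVec_add h α.rowLens.length a
  rw [toRows, hs, Finset.sum_apply, weight, sum_range_of_ge hl (h₀ _), sum_range_of_ge hl (h₀ _)]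
  omega

/-- Products of Schur functions are linear combinations of Schur functions, and the coefficients
are numbers of sequences of rows. -/
theorem exists_schur_expansion (N : ℕ) (αs : List YoungDiagram) (μ : YoungDiagram)
    (h : μ.card + (αs.map YoungDiagram.card).sum ≤ N) :
    ∃ c : YoungDiagram →₀ ℚ, schurFunction μ * (αs.map schurFunction).prod =
      Finsupp.linearCombination ℚ schurFunction c ∧ ∀ lam : YoungDiagram,
        Finite {vs // RowSeq N lam.rowLen μ.rowLen none (rowTokens αs) vs} ∧
        c lam = Nat.card {vs // RowSeq N lam.rowLen μ.rowLen none (rowTokens αs) vs} := by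
  classical
  induction αs generalizing μ with
  | nil =>
    refine ⟨Finsupp.single μ 1, by simp, fun lam => ?_⟩
    have hsub : Subsingleton
        {vs // RowSeq N lam.rowLen μ.rowLen none (rowTokens []) vs} :=
      ⟨fun a b => Subtype.ext (a.2.1.trans b.2.1.symm)⟩
    refine ⟨inferInstance, ?_⟩
    rw [Finsupp.single_apply]
    split_ifs with hml
    · subst hml
      have : Nonempty {vs // RowSeq N μ.rowLen μ.rowLen none (rowTokens []) vs} :=
        ⟨⟨[], rfl, rfl⟩⟩
      rw [Nat.card_unique, Nat.cast_one]
    · have : IsEmpty {vs // RowSeq N lam.rowLen μ.rowLen none (rowTokens []) vs} :=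
        ⟨fun a => hml (YoungDiagram.ext_rowLen fun i => congrFun a.2.2 i)⟩
      rw [Nat.card_of_isEmpty, Nat.cast_zero]
  | cons α αs ih =>
    simp only [List.map_cons, List.sum_cons, List.prod_cons] at h ⊢
    have hcard : ∀ g : {g // g ∈ dominantPatterns N μ.rowLen α.rowLen},
        (addWeight g).card + (αs.map YoungDiagram.card).sum ≤ N := fun g => by
      rw [card_addWeight (by omega)]
      omega
    choose c hc hcount using fun g => ih (addWeight g) (hcard g)
    refine ⟨∑ g, c g, ?_, fun lam => ?_⟩
    · rw [← mul_assoc, schurFunction_mul (N := N) (by omega), sum_mul, map_sum]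
      exact sum_congr rfl fun g _ => hc g
    · have hrow : ∀ g : {g // g ∈ dominantPatterns N μ.rowLen α.rowLen},
          μ.rowLen + (toRows α g.1).sum = (addWeight g).rowLen := fun g => by
        rw [sum_toRows (mem_dominantPatterns.1 g.2).1, rowLen_addWeight (by omega)]
        rfl
      have htok : rowTokens (α :: αs) = α.rowLens.map some ++ none :: rowTokens αs := by
        simp [rowTokens]
      -- A sequence for `α :: αs` is split at the first separator: the rows before it form a
      -- dominant pattern of shape `α`, and the remainder starts from the partition reached by then.
      let F : (Σ g : {g // g ∈ dominantPatterns N μ.rowLen α.rowLen},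
          {vs // RowSeq N lam.rowLen (addWeight g).rowLen none (rowTokens αs) vs}) →
          {vs // RowSeq N lam.rowLen μ.rowLen none (rowTokens (α :: αs)) vs} := fun x =>
        ⟨toRows α x.1.1 ++ x.2.1, by
          rw [htok, rowSeq_append]
          exact ⟨_, _, rfl, rows_toRows (by omega) x.1.2, by rw [hrow]; exact x.2.2⟩⟩
      have hF : Function.Bijective F := by
        constructor
        · rintro ⟨g, vs⟩ ⟨g', vs'⟩ heq
          have h₁ := congrArg Subtype.val heq
          have h₂ := List.append_inj h₁ (by simp [toRows])
          have h₃ : g = g' := Subtype.ext (toRows_injOn g.2 g'.2 h₂.1)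
          subst h₃
          have h₄ : vs = vs' := Subtype.ext h₂.2
          rw [h₄]
        · rintro ⟨vs, hvs⟩
          rw [htok, rowSeq_append] at hvs
          obtain ⟨vs₁, vs₂, rfl, h₁, h₂⟩ := hvs
          obtain ⟨g, hg, rfl⟩ := exists_toRows h₁
          exact ⟨⟨⟨g, hg⟩, ⟨vs₂, by rw [← hrow ⟨g, hg⟩]; exact h₂⟩⟩, rfl⟩
      have hfin := fun g => (hcount g lam).1
      refine ⟨Finite.of_surjective F hF.2, ?_⟩
      rw [← Nat.card_eq_of_bijective F hF, Nat.card_sigma, Finsupp.finsetSum_apply, Nat.cast_sum]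
      exact sum_congr rfl fun g _ => (hcount g lam).2

theorem isMultiLR_card {α : YoungDiagram} {αs : List YoungDiagram} {lam : YoungDiagram} {N : ℕ}
    (h : α.card + (αs.map YoungDiagram.card).sum ≤ N) :
    IsMultiLR (α :: αs) lam
      (Nat.card {vs // RowSeq N lam.rowLen α.rowLen none (rowTokens αs) vs}) := by
  obtain ⟨c, hc, hcount⟩ := exists_schur_expansion N αs α h
  exact ⟨c, by simpa using hc, (hcount lam).2⟩

end GelfandTsetlin

/-! ### Compression to the rows in which two partitions differ -/

namespace GelfandTsetlin

open Finset

/-- `x` is an admissible row of length `p`: `sl` and `td` are upper bounds for its entries, and, unless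
`first` holds, its partial sums are bounded by those of the row `pv`. -/
def ValidRow : List ℕ → List ℕ → List ℕ → ℕ → Bool → ℕ → List ℕ → Prop
  | [], [], [], _, _, p, [] => p = 0
  | s :: sl, t :: td, q :: pv, e, first, p, x :: xs =>
    x ≤ s ∧ x ≤ t ∧ x ≤ p ∧ (first = true ∨ x ≤ e) ∧
      ValidRow sl td pv (if first then e + q else e - x + q) first (p - x) xs
  | _, _, _, _, _, _, _ => False

/-- The slacks after adding the row `x`. -/
def shiftSlack : ℕ → List ℕ → List ℕ → List ℕ
  | mem, s :: sl, x :: xs => (s - x + mem) :: shiftSlack x sl xs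
  | _, _, _ => []

/-- Sequences of admissible rows, in terms of slacks `sl` and numbers `td` of missing boxes. -/
def ListSeq : List ℕ → List ℕ → List ℕ → Bool → List (Option ℕ) → List (List ℕ) → Prop
  | _, _, _, _, [], xs => xs = []
  | sl, td, pv, _, none :: ts, xs => ListSeq sl td pv true ts xs
  | _, _, _, _, some _ :: _, [] => False
  | sl, td, pv, first, some p :: ts, x :: xs =>
    ValidRow sl td pv 0 first p x ∧
      ListSeq (shiftSlack 0 sl x) (List.zipWith (· - ·) td x) x false ts xs

theorem ValidRow.length_eq {sl td pv x : List ℕ} {e p : ℕ} {first : Bool}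
    (h : ValidRow sl td pv e first p x) : x.length = sl.length := by
  induction sl generalizing td pv x e p with
  | nil =>
    rcases td with _ | ⟨t, td⟩ <;> rcases pv with _ | ⟨q, pv⟩ <;> rcases x with _ | ⟨x, xs⟩ <;>
      first | rfl | exact h.elim
  | cons s sl ih =>
    rcases td with _ | ⟨t, td⟩ <;> rcases pv with _ | ⟨q, pv⟩ <;> rcases x with _ | ⟨x, xs⟩ <;>
      first | exact congrArg (· + 1) (ih h.2.2.2.2) | exact h.elim

variable {act : ℕ → Bool}

/-- The number `e` is the surplus of the partial sum of the previous row over that of the current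
one, before the next entry; the subtraction `e - x` is not truncated because `x ≤ e` has been
tested. Rows outside `act` contribute zero to both sums and can be skipped, which is why the start
`a`, `e` and `p` vary in the induction. -/
theorem validRow_map_iff {S T Q V : ℕ → ℕ} (hV : ∀ a, act a = false → V a = 0)
    (hQ : ∀ a, act a = false → Q a = 0) (first : Bool) (m : ℕ) : ∀ (a e p : ℕ),
    ValidRow (((List.range' a m).filter act).map S) (((List.range' a m).filter act).map T)
      (((List.range' a m).filter act).map Q) e first p (((List.range' a m).filter act).map V) ↔
    (∀ j < m, act (a + j) = true → V (a + j) ≤ S (a + j) ∧ V (a + j) ≤ T (a + j)) ∧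
      ∑ j ∈ range m, V (a + j) = p ∧ (first = true ∨ ∀ j < m,
        ∑ i ∈ range (j + 1), V (a + i) ≤ e + ∑ i ∈ range j, Q (a + i)) := by
  induction m with
  | zero =>
    intro a e p
    exact ⟨fun h => ⟨by simp, (show p = 0 from h).symm, by simp⟩, fun h => h.2.1.symm⟩
  | succ m ih =>
    intro a e p
    have hsh : ∀ j, a + 1 + j = a + (j + 1) := fun j => by omega
    have hall : ∀ P : ℕ → Prop, (∀ j < m + 1, P j) ↔ P 0 ∧ ∀ j < m, P (j + 1) := by
      intro P
      refine ⟨fun h => ⟨h 0 (by omega), fun j hj => h (j + 1) (by omega)⟩, fun h j hj => ?_⟩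
      rcases j with _ | j
      · exact h.1
      · exact h.2 j (by omega)
    rw [List.range'_succ, hall, hall, sum_range_succ']
    by_cases ha : act a = true
    · rw [List.filter_cons_of_pos (by simpa using ha)]
      simp only [List.map_cons, ValidRow, ih, hsh, add_zero, zero_add, sum_range_one, ha,
        range_zero, sum_empty, forall_true_left]
      simp only [sum_range_succ' _ (_ + 1), sum_range_succ' (fun i => Q (a + i)), add_zero]
      constructor
      · rintro ⟨h₁, h₂, h₃, h₄, h₅, h₆, h₇⟩
        refine ⟨⟨⟨h₁, h₂⟩, h₅⟩, by omega, ?_⟩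
        rcases h₄ with h₄ | h₄
        · exact Or.inl h₄
        · rcases h₇ with h₇ | h₇
          · exact Or.inl h₇
          · by_cases hf : first = true
            · exact Or.inl hf
            · refine Or.inr ⟨h₄, fun j hj => ?_⟩
              have := h₇ j hj
              rw [if_neg hf] at this
              omega
      · rintro ⟨⟨⟨h₁, h₂⟩, h₅⟩, h₆, h₇⟩
        refine ⟨h₁, h₂, by omega, h₇.imp_right And.left, h₅, by omega, ?_⟩
        rcases h₇ with h₇ | ⟨h₇, h₈⟩
        · exact Or.inl h₇
        · by_cases hf : first = true
          · exact Or.inl hf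
          · refine Or.inr fun j hj => ?_
            have := h₈ j hj
            rw [if_neg hf]
            omega
    · rw [List.filter_cons_of_neg (by simpa using ha)]
      have hVa := hV a (by simpa using ha)
      have hQa := hQ a (by simpa using ha)
      simp only [ih, hsh, add_zero, zero_add, sum_range_one, ha, range_zero, sum_empty, hVa,
        sum_range_succ' _ (_ + 1), sum_range_succ' (fun i => Q (a + i)), hQa, Nat.zero_le, true_and,
        Bool.false_eq_true, false_imp_iff]

/-- `W a` is the entry of the last active row above `a`, which `shiftSlack` carries along in its
first argument. -/
theorem shiftSlack_map {S V W : ℕ → ℕ} (hW : ∀ a, W (a + 1) = if act a then V a else W a) (m : ℕ) :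
    ∀ a : ℕ, shiftSlack (W a) (((List.range' a m).filter act).map S)
      (((List.range' a m).filter act).map V) =
      ((List.range' a m).filter act).map fun a => S a - V a + W a := by
  induction m with
  | zero => intro a; rfl
  | succ m ih =>
    intro a
    have := ih (a + 1)
    rw [hW] at this
    rw [List.range'_succ]
    by_cases ha : act a = true
    · rw [List.filter_cons_of_pos (by simpa using ha)]
      rw [if_pos ha] at this
      simp only [List.map_cons, shiftSlack, this]
    · rw [List.filter_cons_of_neg (by simpa using ha)]
      rwa [if_neg ha] at this

theorem exists_map_eq {l : List ℕ} (hl : l.Nodup) {x : List ℕ} (hx : x.length = l.length) :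
    ∃ V : ℕ → ℕ, (∀ a, a ∉ l → V a = 0) ∧ l.map V = x := by
  induction l generalizing x with
  | nil => exact ⟨0, fun _ _ => rfl, (List.length_eq_zero_iff.1 hx).symm⟩
  | cons a l ih =>
    rcases x with _ | ⟨y, x⟩
    · simp at hx
    obtain ⟨V, hV, rfl⟩ := ih (List.nodup_cons.1 hl).2 (by simpa using hx)
    refine ⟨Function.update V a y, fun b hb => ?_, ?_⟩
    · rw [List.mem_cons, not_or] at hb
      rw [Function.update_of_ne hb.1, hV b hb.2]
    · rw [List.map_cons, Function.update_self]
      congr 1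
      refine List.map_congr_left fun b hb => Function.update_of_ne ?_ _ _
      rintro rfl
      exact (List.nodup_cons.1 hl).1 hb

/-! ### Slacks and missing boxes -/

/-- The rows of `lam / cur`, compressed to the rows in `act`. -/
structure Compression (M : ℕ) (act : ℕ → Bool) (lam cur S : ℕ → ℕ) : Prop where
  anti : Antitone cur
  anti_lam : Antitone lam
  le : ∀ a, cur a ≤ lam a
  out : ∀ a, act a = false → cur a = lam a
  lt : ∀ a, act a = true → a < M
  zero : ∀ a, M ≤ a → lam a = 0
  slack : ∀ a, act a = true → min (S a) (lam a - cur a) =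
    min (lam a - cur a) (if a = 0 then lam a - cur a else cur (a - 1) - cur a)

/-- The rows in `act`. -/
def activeRows (M : ℕ) (act : ℕ → Bool) : List ℕ := (List.range M).filter act

variable {M N : ℕ} {lam cur S : ℕ → ℕ}

theorem RowSeq.le {prev : Option (ℕ → ℕ)} {ts : List (Option ℕ)} {vs : List (ℕ → ℕ)}
    (h : RowSeq N lam cur prev ts vs) : ∀ a, cur a ≤ lam a := by
  induction ts generalizing cur prev vs with
  | nil => intro a; rw [h.2]
  | cons t ts ih =>
    rcases t with _ | p
    · exact ih (prev := none) (by simpa [RowSeq] using h)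
    · rcases vs with _ | ⟨v, vs⟩
      · exact h.elim
      · exact fun a => (Nat.le_add_right _ _).trans (ih h.2 a)

/-- An entry is bounded by the gap below the row above and, to stay inside `lam`, by the number of
missing boxes. Only the smaller bound matters, and this is all that the field `slack` records; that
is why small numbers suffice although the gaps may be large. -/
theorem Compression.rowStep_iff (h : Compression M act lam cur S) (hM : M ≤ N)
    {prev : Option (ℕ → ℕ)} {first : Bool} {pv : List ℕ} {Q : ℕ → ℕ}
    (hQ : ∀ a, act a = false → Q a = 0) (hpv : pv = (activeRows M act).map Q)
    (hprev : prev = if first then none else some Q) {p : ℕ} {v : ℕ → ℕ}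
    (hv : ∀ a, act a = false → v a = 0) :
    (RowStep N cur prev p v ∧ ∀ a, cur a + v a ≤ lam a) ↔
      ValidRow ((activeRows M act).map S) ((activeRows M act).map fun a => lam a - cur a) pv 0 first p
        ((activeRows M act).map v) := by
  subst hpv
  rw [activeRows, List.range_eq_range', validRow_map_iff hv hQ]
  simp only [zero_add]
  constructor
  · rintro ⟨⟨h₁, h₂, h₃, h₄⟩, h₅⟩
    have hvM : ∀ a, M ≤ a → v a = 0 := fun a ha => by
      have h₆ := h₅ a
      rw [h.zero a ha] at h₆
      omega
    refine ⟨fun a ha hact => ?_, ?_, ?_⟩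
    · have h₆ := h₅ a
      have h₇ := h.slack a hact
      rcases a with _ | a
      · rw [if_pos rfl] at h₇; omega
      · have h₈ := h₃ a
        rw [if_neg (Nat.succ_ne_zero a), Nat.add_sub_cancel] at h₇
        omega
    · rw [← sum_range_of_ge hM hvM, h₂]
    · by_cases hf : first = true
      · exact Or.inl hf
      · rw [hprev, if_neg hf] at h₄
        exact Or.inr fun j _ => h₄ Q rfl j
  · rintro ⟨h₁, h₂, h₃⟩
    have hle : ∀ a, v a ≤ lam a - cur a := by
      intro a
      by_cases ha : act a = true
      · exact (h₁ a (h.lt a ha) ha).2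
      · rw [hv a (by simpa using ha)]
        exact Nat.zero_le _
    have hvM : ∀ a, M ≤ a → v a = 0 := fun a ha => by
      have := hle a
      rw [h.zero a ha] at this
      omega
    refine ⟨⟨fun a ha => hvM a (hM.trans ha), by rw [sum_range_of_ge hM hvM, h₂], fun a => ?_,
      fun u hu a => ?_⟩, fun a => by have := hle a; have := h.le a; omega⟩
    · have h₄ := h.anti (Nat.le_succ a)
      by_cases ha : act (a + 1) = true
      · have h₅ := h₁ _ (h.lt _ ha) ha
        have h₆ := h.slack _ ha
        rw [if_neg (Nat.succ_ne_zero a), Nat.add_sub_cancel] at h₆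
        simp only [Nat.succ_eq_add_one] at h₄
        omega
      · rw [hv _ (by simpa using ha)]
        exact h₄
    · rw [hprev] at hu
      split_ifs at hu with hf
      · simp at hu
      obtain rfl : Q = u := by simpa using hu
      have h₄ := h₃.resolve_left hf
      by_cases ha : a < M
      · exact h₄ a ha
      · rw [sum_range_of_ge (show M ≤ a + 1 by omega) hvM]
        rcases M with _ | M
        · exact Nat.zero_le _
        · exact (h₄ M (Nat.lt_succ_self M)).trans
            (sum_le_sum_of_subset (range_subset_range.2 (by omega)))

/-- The amount by which the slack of row `a` grows when the row `v` is added. -/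
def slackGain (act : ℕ → Bool) (v : ℕ → ℕ) : ℕ → ℕ
  | 0 => 0
  | a + 1 => if act a then v a else slackGain act v a

/-- Adding `v` consumes `v a` of the slack of row `a` and frees as much as the row above grows. If
the row directly above is inactive it is already full, so the slack of row `a` is not binding before
or after, and the excess gain from a higher row is harmless. -/
theorem Compression.add (h : Compression M act lam cur S) {prev : Option (ℕ → ℕ)} {p : ℕ}
    {v : ℕ → ℕ} (hv : RowStep N cur prev p v) (hle : ∀ a, cur a + v a ≤ lam a) (hS : ∀ a,
    act a = true → v a ≤ S a) :
    Compression M act lam (cur + v) fun a => S a - v a + slackGain act v a where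
  anti := antitone_nat_of_succ_le fun a => (hv.strip a).trans (Nat.le_add_right _ _)
  anti_lam := h.anti_lam
  le := hle
  out a ha := by
    have h₁ := hle a
    have h₂ := h.out a ha
    simp only [Pi.add_apply]
    omega
  lt := h.lt
  zero := h.zero
  slack a ha := by
    have h₁ := hle a
    have h₂ := h.slack a ha
    have h₃ := hS a ha
    simp only [Pi.add_apply]
    rcases a with _ | a
    · simp only [slackGain, if_true] at *
      omega
    · have h₄ := hv.strip a
      have h₅ := hle a
      simp only [slackGain, Nat.succ_ne_zero, if_false, Nat.add_sub_cancel] at *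
      by_cases hb : act a = true
      · rw [if_pos hb]
        omega
      · have h₆ := h.out a (by simpa using hb)
        have h₇ := h.anti_lam (Nat.le_succ a)
        simp only [Nat.succ_eq_add_one] at h₇
        rw [if_neg hb]
        omega

/-- The number of boxes in the rows `ts`. -/
def tokenSum (ts : List (Option ℕ)) : ℕ := (ts.map (Option.getD · 0)).sum

/-- Induction on the tokens, with `Compression.add` as the step. `ListSeq` does not test whether
`lam` has been reached: by `hts` the tokens contain exactly as many boxes as are missing. -/
theorem Compression.rowSeq_iff (h : Compression M act lam cur S) (hM : M ≤ N)
    {ts : List (Option ℕ)} (hts : ∑ a ∈ range N, (lam a - cur a) = tokenSum ts) {first : Bool}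
    {pv : List ℕ} {Q : ℕ → ℕ} (hQ : ∀ a, act a = false → Q a = 0)
    (hpv : pv = (activeRows M act).map Q) {vs : List (ℕ → ℕ)}
    (hvs : ∀ v ∈ vs, ∀ a, act a = false → v a = 0) :
    RowSeq N lam cur (if first then none else some Q) ts vs ↔
      ListSeq ((activeRows M act).map S) ((activeRows M act).map fun a => lam a - cur a) pv first ts
        (vs.map fun v => (activeRows M act).map v) := by
  induction ts generalizing cur S first pv Q vs with
  | nil =>
    simp only [RowSeq, ListSeq, List.map_eq_nil_iff, and_iff_left_iff_imp]
    rintro -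
    funext a
    by_cases ha : a < N
    · have h₁ : ∑ a ∈ range N, (lam a - cur a) = 0 := hts
      have h₂ := sum_eq_zero_iff.1 h₁ a (mem_range.2 ha)
      have := h.le a
      omega
    · have h₁ := h.zero a (by omega)
      have := h.le a
      omega
  | cons t ts ih =>
    rcases t with _ | p
    · exact ih h (by simpa [tokenSum] using hts) (first := true) hQ hpv hvs
    · rcases vs with _ | ⟨v, vs⟩
      · exact Iff.rfl
      have hv := hvs v List.mem_cons_self
      have hstep := h.rowStep_iff hM hQ hpv (first := first) rfl (p := p) hv
      have key : RowStep N cur (if first then none else some Q) p v → (∀ a, cur a + v a ≤ lam a) →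
          (RowSeq N lam (cur + v) (some v) ts vs ↔
            ListSeq (shiftSlack 0 ((activeRows M act).map S) ((activeRows M act).map v))
              (List.zipWith (· - ·) ((activeRows M act).map fun a => lam a - cur a)
                ((activeRows M act).map v)) ((activeRows M act).map v) false ts
              (vs.map fun v => (activeRows M act).map v)) := by
        intro h₁ h₂
        have hS : ∀ a, act a = true → v a ≤ S a := by
          intro a ha
          have h₃ := hstep.1 ⟨h₁, h₂⟩
          rw [hpv, activeRows, List.range_eq_range', validRow_map_iff hv hQ] at h₃
          simpa using (h₃.1 a (h.lt a ha) (by simpa using ha)).1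
        have h₃ := h.add h₁ h₂ hS
        have h₄ : ∑ a ∈ range N, (lam a - (cur + v) a) = tokenSum ts := by
          have h₅ : ∑ a ∈ range N, (lam a - (cur + v) a) + ∑ a ∈ range N, v a =
              ∑ a ∈ range N, (lam a - cur a) := by
            rw [← sum_add_distrib]
            refine sum_congr rfl fun a _ => ?_
            have := h₂ a
            simp only [Pi.add_apply]
            omega
          rw [h₁.sum, hts] at h₅
          simp only [tokenSum, List.map_cons, Option.getD_some, List.sum_cons] at h₅ ⊢
          omega
        have h₆ := ih h₃ h₄ (first := false) hv rfl (vs := vs) fun w hw =>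
          hvs w (List.mem_cons_of_mem _ hw)
        have h₇ := shiftSlack_map (S := S) (V := v) (W := slackGain act v) (act := act)
          (fun a => rfl) M 0
        rw [← List.range_eq_range'] at h₇
        rw [if_neg Bool.false_ne_true] at h₆
        rw [h₆]
        simp only [slackGain] at h₇
        unfold activeRows
        rw [h₇, List.zipWith_map, List.zipWith_self]
        simp only [Pi.add_apply, Nat.sub_sub]
      constructor
      · rintro ⟨h₁, h₂⟩
        have h₃ := h₂.le
        exact ⟨hstep.1 ⟨h₁, h₃⟩, (key h₁ h₃).1 h₂⟩
      · rintro ⟨h₁, h₂⟩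
        have h₃ := hstep.2 h₁
        exact ⟨h₃.1, (key h₃.1 h₃.2).2 h₂⟩

/-- The partitions only grow and must stay inside `lam`, so a full row receives nothing. -/
theorem RowSeq.eq_zero {prev : Option (ℕ → ℕ)} {ts : List (Option ℕ)} {vs : List (ℕ → ℕ)}
    (h : RowSeq N lam cur prev ts vs) {a : ℕ} (ha : cur a = lam a) : ∀ v ∈ vs, v a = 0 := by
  induction ts generalizing cur prev vs with
  | nil => simp [h.1]
  | cons t ts ih =>
    rcases t with _ | p
    · exact ih (prev := none) (by simpa [RowSeq] using h) ha
    · rcases vs with _ | ⟨v, vs⟩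
      · simp
      · have h₁ := h.2.le a
        simp only [Pi.add_apply] at h₁
        have h₂ : v a = 0 := by omega
        rintro w (_ | ⟨_, hw⟩)
        · exact h₂
        · exact ih h.2 (by simp [ha, h₂]) w hw

theorem length_shiftSlack (mem : ℕ) (sl x : List ℕ) (h : x.length = sl.length) :
    (shiftSlack mem sl x).length = sl.length := by
  induction sl generalizing mem x with
  | nil => rcases x with _ | ⟨y, x⟩ <;> rfl
  | cons s sl ih =>
    rcases x with _ | ⟨y, x⟩
    · simp at h
    · simpa [shiftSlack] using ih y x (by simpa using h)

theorem ListSeq.length_eq {sl td pv : List ℕ} {first : Bool} {ts : List (Option ℕ)}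
    {xs : List (List ℕ)} (h : ListSeq sl td pv first ts xs) : ∀ x ∈ xs, x.length = sl.length := by
  induction ts generalizing sl td pv first xs with
  | nil => rw [show xs = [] from h]; simp
  | cons t ts ih =>
    rcases t with _ | p
    · exact ih (first := true) (by simpa [ListSeq] using h)
    · rcases xs with _ | ⟨x, xs⟩
      · simp
      · have h₁ := h.1.length_eq
        rintro w (_ | ⟨_, hw⟩)
        · exact h₁
        · rw [ih h.2 w hw, length_shiftSlack _ _ _ h₁]

theorem nodup_activeRows : (activeRows M act).Nodup := List.nodup_range.filter _

/-- Restriction to the active rows is a bijection because all vectors vanish elsewhere. The list `Q`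
is a placeholder: at the first row of a partition the previous row is not consulted. -/
theorem Compression.card_eq (h : Compression M act lam cur S) (hM : M ≤ N)
    {ts : List (Option ℕ)} (hts : ∑ a ∈ range N, (lam a - cur a) = tokenSum ts) {Q : ℕ → ℕ}
    (hQ : ∀ a, act a = false → Q a = 0) :
    Nat.card {vs // RowSeq N lam cur none ts vs} =
      Nat.card {xs // ListSeq ((activeRows M act).map S)
        ((activeRows M act).map fun a => lam a - cur a) ((activeRows M act).map Q) true ts xs} := by
  have h₁ : ∀ vs, RowSeq N lam cur none ts vs → ∀ v ∈ vs, ∀ a, act a = false → v a = 0 :=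
    fun vs hvs v hv a ha => hvs.eq_zero (h.out a ha) v hv
  have h₂ : ∀ vs : List (ℕ → ℕ), (∀ v ∈ vs, ∀ a, act a = false → v a = 0) → _ :=
    fun vs => h.rowSeq_iff hM hts (first := true) hQ rfl (vs := vs)
  simp only [if_true] at h₂
  refine Nat.card_congr (Equiv.ofBijective
    (fun vs => ⟨vs.1.map fun v => (activeRows M act).map v, (h₂ _ (h₁ _ vs.2)).1 vs.2⟩) ⟨?_, ?_⟩)
  · rintro ⟨vs, hvs⟩ ⟨ws, hws⟩ heq
    have heq' : (vs.map fun v => (activeRows M act).map v) =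
      ws.map fun v => (activeRows M act).map v := congrArg Subtype.val heq
    have h₃ := h₁ _ hvs
    have h₄ := h₁ _ hws
    apply Subtype.ext
    change vs = ws
    clear heq hvs hws
    induction vs generalizing ws with
    | nil => simpa using heq'
    | cons v vs ih =>
      rcases ws with _ | ⟨w, ws⟩
      · simp at heq'
      · simp only [List.map_cons, List.cons.injEq] at heq'
        congr 1
        · funext a
          by_cases ha : act a = true
          · exact List.map_inj_left.1 heq'.1 a (by
              simpa [activeRows, ha] using h.lt a ha)
          · rw [h₃ v List.mem_cons_self a (by simpa using ha),
              h₄ w List.mem_cons_self a (by simpa using ha)]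
        · exact ih _ heq'.2 (fun v hv => h₃ v (List.mem_cons_of_mem _ hv))
            fun v hv => h₄ v (List.mem_cons_of_mem _ hv)
  · rintro ⟨xs, hxs⟩
    have h₃ : ∃ vs : List (ℕ → ℕ), (∀ v ∈ vs, ∀ a, act a = false → v a = 0) ∧
        (vs.map fun v => (activeRows M act).map v) = xs := by
      have h₄ := hxs.length_eq
      clear hxs
      induction xs with
      | nil => exact ⟨[], by simp, rfl⟩
      | cons x xs ih =>
        obtain ⟨vs, h₅, rfl⟩ := ih fun y hy => h₄ y (List.mem_cons_of_mem _ hy)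
        obtain ⟨v, h₆, rfl⟩ := exists_map_eq nodup_activeRows
          ((h₄ x List.mem_cons_self).trans (List.length_map _))
        refine ⟨v :: vs, ?_, rfl⟩
        rintro w (_ | ⟨_, hw⟩) a ha
        · exact h₆ a (by simp [activeRows, ha])
        · exact h₅ w hw a ha
    obtain ⟨vs, h₄, rfl⟩ := h₃
    exact ⟨⟨vs, (h₂ vs h₄).2 hxs⟩, rfl⟩

end GelfandTsetlin

/-! ### Search for sequences of rows, box by box -/

namespace GelfandTsetlin

/-- The state of the search. Entries of the current row have been chosen for the rows listed in `slD`,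
`tdD`, `pvD` (last one first), `v` boxes have been placed in the head row of `td`. The list `sl` has an
extra last entry. -/
structure SearchState where
  sl : List ℕ
  td : List ℕ
  pv : List ℕ
  slD : List ℕ
  tdD : List ℕ
  pvD : List ℕ
  v : ℕ
  e : ℕ
  pt : List (Option ℕ)
  first : Bool

/-- Add `v` to the head of a list. -/
def addHead (v : ℕ) : List ℕ → List ℕ
  | [] => []
  | a :: l => (v + a) :: l

/-- Put the slacks `slD` back, adding to each of them the entry of `pvD` for the row above. -/
def restoreSlack : List ℕ → List ℕ → List ℕ → List ℕ
  | s :: slD, v :: pvD, sl => restoreSlack slD pvD (s :: addHead v sl)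
  | _, _, sl => sl

namespace SearchState

/-- Place a box in the current row. -/
def place (x : SearchState) : Option SearchState :=
  match x.sl, x.td, x.pt with
  | (s + 1) :: sl, (t + 1) :: td, some (p + 1) :: pt =>
    if x.first = true ∨ 0 < x.e then
      some { x with
        sl := s :: sl, td := t :: td, pt := some p :: pt, v := x.v + 1
        e := if x.first then x.e else x.e - 1 }
    else none
  | _, _, _ => none

/-- Begin a new row of boxes. -/
def restart (x : SearchState) (pt : List (Option ℕ)) (first : Bool) : SearchState where
  sl := restoreSlack x.slD x.pvD x.sl
  td := x.tdD.reverse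
  pv := x.pvD.reverse
  slD := []
  tdD := []
  pvD := []
  v := 0
  e := 0
  pt := pt
  first := first

/-- Begin a new row of boxes if the current one is complete. -/
def endRow (x : SearchState) : Option SearchState :=
  match x.pt with
  | some 0 :: none :: pt => some (x.restart pt true)
  | some 0 :: some p :: pt => some (x.restart (some p :: pt) false)
  | _ => none

/-- Proceed to the next row. -/
def next (x : SearchState) : SearchState :=
  { x with
    sl := x.sl.tail, td := x.td.tail, pv := x.pv.tail
    slD := x.sl.headI :: x.slD, tdD := x.td.headI :: x.tdD, pvD := x.v :: x.pvD
    e := x.e + x.pv.headI, v := 0 }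

/-- Proceed to the next row, or to the next row of boxes. -/
def advance (x : SearchState) : Option SearchState :=
  if x.pt = [] then some x
  else if x.td.tail = [] then x.next.endRow
  else some x.next

/-- One step of the search. -/
def step (x : SearchState) (b : Bool) : Option SearchState := if b then x.place else x.advance

/-- The search succeeds with the given decisions. -/
def Accepts : SearchState → List Bool → Prop
  | x, [] => x.pt = []
  | x, b :: w => ∃ y, x.step b = some y ∧ y.Accepts w

end SearchState

/-- Tokens without empty blocks, each block being followed by `none`. -/
def GoodTokens : List (Option ℕ) → Prop
  | [] => True
  | none :: _ => False
  | [some _] => False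
  | some _ :: none :: ts => GoodTokens ts
  | some _ :: some q :: ts => GoodTokens (some q :: ts)

theorem goodTokens_congr {p q : ℕ} {ts : List (Option ℕ)} (h : GoodTokens (some p :: ts)) :
    GoodTokens (some q :: ts) := by
  rcases ts with _ | ⟨_ | r, ts⟩
  · exact h.elim
  · exact h
  · exact h

/-- The decisions which lead to the given entries. -/
def decisions (ys : List ℕ) : List Bool := ys.flatMap fun n => List.replicate n true ++ [false]

theorem decisions_cons (y : ℕ) (ys : List ℕ) :
    decisions (y :: ys) = List.replicate y true ++ false :: decisions ys := by
  simp [decisions]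

/-- Each entry is coded by marks `true` and a closing `false`. This is a prefix code, so a known
number of entries can be recovered from the beginning of a word. -/
theorem decisions_append_inj {ys ys' : List ℕ} {u u' : List Bool} (hl : ys.length = ys'.length)
    (h : decisions ys ++ u = decisions ys' ++ u') : ys = ys' := by
  induction ys generalizing ys' with
  | nil => rw [List.length_eq_zero_iff.1 hl.symm]
  | cons y ys ih =>
    rcases ys' with _ | ⟨y', ys'⟩
    · simp at hl
    simp only [decisions_cons, List.append_assoc, List.cons_append] at h
    have key : ∀ (m n : ℕ) (a b : List Bool),
        List.replicate m true ++ false :: a = List.replicate n true ++ false :: b →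
        m = n ∧ a = b := by
      intro m
      induction m with
      | zero =>
        intro n a b h
        rcases n with _ | n
        · simpa using h
        · simp [List.replicate_succ] at h
      | succ m ih =>
        intro n a b h
        rcases n with _ | n
        · simp [List.replicate_succ] at h
        · simpa using ih n a b (by simpa [List.replicate_succ] using h)
    obtain ⟨rfl, h⟩ := key _ _ _ _ h
    rw [ih (by simpa using hl) (by simpa using h)]

theorem length_decisions (ys : List ℕ) : (decisions ys).length = ys.sum + ys.length := by
  induction ys with
  | nil => rfl
  | cons y ys ih =>
    simp only [decisions_cons, List.length_append, List.length_replicate, List.length_cons, ih,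
      List.sum_cons]
    omega

theorem ValidRow.sum_eq {sl td pv x : List ℕ} {e p : ℕ} {first : Bool}
    (h : ValidRow sl td pv e first p x) : x.sum = p := by
  induction sl generalizing td pv x e p with
  | nil =>
    rcases td with _ | ⟨t, td⟩ <;> rcases pv with _ | ⟨q, pv⟩ <;> rcases x with _ | ⟨x, xs⟩ <;>
      first | exact h.symm | exact h.elim
  | cons s sl ih =>
    rcases td with _ | ⟨t, td⟩ <;> rcases pv with _ | ⟨q, pv⟩ <;> rcases x with _ | ⟨x, xs⟩
    case cons.cons.cons =>
      have h₁ := ih h.2.2.2.2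
      have h₂ := h.2.2.1
      rw [List.sum_cons]
      omega
    all_goals exact h.elim

theorem ListSeq.sum_eq {sl td pv : List ℕ} {first : Bool} {ts : List (Option ℕ)}
    {xs : List (List ℕ)} (h : ListSeq sl td pv first ts xs) : xs.flatten.sum = tokenSum ts := by
  induction ts generalizing sl td pv first xs with
  | nil => rw [show xs = [] from h]; rfl
  | cons t ts ih =>
    rcases t with _ | p
    · rw [ih (first := true) (by simpa [ListSeq] using h)]
      simp [tokenSum]
    · rcases xs with _ | ⟨x, xs⟩
      · exact h.elim
      · simp only [List.flatten_cons, List.sum_append, h.1.sum_eq, ih h.2]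
        simp [tokenSum]

theorem ListSeq.length_eq_count {sl td pv : List ℕ} {first : Bool} {ts : List (Option ℕ)}
    {xs : List (List ℕ)} (h : ListSeq sl td pv first ts xs) :
    xs.length = ts.countP Option.isSome := by
  induction ts generalizing sl td pv first xs with
  | nil => rw [show xs = [] from h]; rfl
  | cons t ts ih =>
    rcases t with _ | p
    · simpa using ih (first := true) (by simpa [ListSeq] using h)
    · rcases xs with _ | ⟨x, xs⟩
      · exact h.elim
      · simp [ih h.2]

theorem restoreSlack_append (a b a' b' sl : List ℕ) (h : a.length = b.length) :
    restoreSlack (a ++ a') (b ++ b') sl = restoreSlack a' b' (restoreSlack a b sl) := by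
  induction a generalizing b sl with
  | nil => rw [List.length_eq_zero_iff.1 h.symm]; rfl
  | cons s a ih =>
    rcases b with _ | ⟨v, b⟩
    · simp at h
    · exact ih b _ (by simpa using h)

/-- Putting the rows back from the last to the first passes each entry on to the slack of the next
row, as `shiftSlack` does. The last entry has no row below it and goes into the extra entry `g`,
whose value is irrelevant. -/
theorem restoreSlack_reverse (sl x : List ℕ) (h : x.length = sl.length) (g m : ℕ) :
    ∃ g', addHead m (restoreSlack (List.zipWith (· - ·) sl x).reverse x.reverse [g]) =
      shiftSlack m sl x ++ [g'] := by
  induction sl generalizing x m with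
  | nil =>
    rw [List.length_eq_zero_iff.1 h]
    exact ⟨m + g, rfl⟩
  | cons s sl ih =>
    rcases x with _ | ⟨y, x⟩
    · simp at h
    obtain ⟨g', hg⟩ := ih x (by simpa using h) y
    refine ⟨g', ?_⟩
    rw [List.zipWith_cons_cons, List.reverse_cons, List.reverse_cons,
      restoreSlack_append _ _ _ _ _ (by
        have : x.length = sl.length := by simpa using h
        simp [this]), restoreSlack, restoreSlack, hg, addHead, shiftSlack, add_comm m]
    · rfl
    · simp

theorem addHead_zero (l : List ℕ) : addHead 0 l = l := by
  rcases l with _ | ⟨a, l⟩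
  · rfl
  · rw [addHead, zero_add]

theorem length_addHead (v : ℕ) (l : List ℕ) : (addHead v l).length = l.length := by
  rcases l with _ | ⟨a, l⟩ <;> rfl

theorem length_restoreSlack (a b sl : List ℕ) (h : a.length = b.length) :
    (restoreSlack a b sl).length = a.length + sl.length := by
  induction a generalizing b sl with
  | nil => simp [restoreSlack]
  | cons s a ih =>
    rcases b with _ | ⟨v, b⟩
    · simp at h
    · rw [restoreSlack, ih _ _ (by simpa using h)]
      simp only [List.length_cons, length_addHead]
      omega

/-! ### Accepted words and sequences of rows -/

namespace SearchState

/-- When no tokens are left, `advance` is idle and `place` fails, so the only admissible padding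
consists of `false`. -/
theorem accepts_nil {x : SearchState} (h : x.pt = []) {w : List Bool} :
    x.Accepts w ↔ ∃ j, w = List.replicate j false := by
  induction w with
  | nil => exact ⟨fun _ => ⟨0, rfl⟩, fun _ => h⟩
  | cons b w ih =>
    rcases b with _ | _
    · simp only [Accepts, step, advance, h, if_true, Bool.false_eq_true, if_false, Option.some_inj,
        exists_eq_left', ih]
      constructor
      · rintro ⟨j, rfl⟩
        exact ⟨j + 1, rfl⟩
      · rintro ⟨_ | j, hj⟩
        · simp at hj
        · exact ⟨j, by simpa [List.replicate_succ] using hj⟩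
    · constructor
      · rintro ⟨y, hy, -⟩
        rcases hs : x.sl with _ | ⟨_ | s, sl⟩ <;> rcases ht : x.td with _ | ⟨_ | t, td⟩ <;>
          simp [step, place, h, hs, ht] at hy
      · rintro ⟨_ | j, hj⟩
        · simp at hj
        · simp [List.replicate_succ] at hj

/-- The state at the beginning of a row of boxes. -/
def start (sl td pv : List ℕ) (pt : List (Option ℕ)) (first : Bool) : SearchState :=
  ⟨sl, td, pv, [], [], [], 0, 0, pt, first⟩

/-- The decisions which complete the current row of boxes, and the search. -/
def AcceptsSpec (w : List Bool) : Prop :=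
  ∀ {sl td pv slD tdD pvD : List ℕ} {g v e p : ℕ} {ts : List (Option ℕ)} {first : Bool},
    GoodTokens (some p :: ts) → sl.length = td.length → pv.length = td.length → td ≠ [] →
    slD.length = tdD.length → pvD.length = tdD.length →
    (Accepts ⟨sl ++ [g], td, pv, slD, tdD, pvD, v, e, some p :: ts, first⟩ w ↔
      ∃ ys xs j, ValidRow sl td pv e first p ys ∧
        ListSeq (restoreSlack ((List.zipWith (· - ·) sl ys).reverse ++ slD)
            ((addHead v ys).reverse ++ pvD) [g]).dropLast
          (tdD.reverse ++ List.zipWith (· - ·) td ys) (pvD.reverse ++ addHead v ys) false ts xs ∧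
        w = decisions ys ++ (decisions xs.flatten ++ List.replicate j false))

theorem AcceptsSpec.start {w : List Bool} (h : AcceptsSpec w) {sl td pv : List ℕ} {g : ℕ}
    {ts : List (Option ℕ)} {first : Bool} (hts : GoodTokens ts) (h₁ : sl.length = td.length)
    (h₂ : pv.length = td.length) (h₃ : ts = [] ∨ td ≠ []) :
    Accepts (start (sl ++ [g]) td pv ts first) w ↔
      ∃ xs j, ListSeq sl td pv first ts xs ∧
        w = decisions xs.flatten ++ List.replicate j false := by
  rcases ts with _ | ⟨_ | p, ts⟩
  · rw [accepts_nil rfl]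
    constructor
    · rintro ⟨j, rfl⟩
      exact ⟨[], j, rfl, rfl⟩
    · rintro ⟨xs, j, hxs, rfl⟩
      rw [show xs = [] from hxs]
      exact ⟨j, rfl⟩
  · exact hts.elim
  · rw [SearchState.start, h hts h₁ h₂ (h₃.resolve_left (List.cons_ne_nil _ _)) rfl rfl]
    have hS : ∀ ys, ValidRow sl td pv 0 first p ys →
        (restoreSlack ((List.zipWith (· - ·) sl ys).reverse ++ [])
          ((addHead 0 ys).reverse ++ []) [g]).dropLast = shiftSlack 0 sl ys := by
      intro ys hys
      obtain ⟨g', hg⟩ := restoreSlack_reverse sl ys hys.length_eq g 0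
      rw [addHead_zero] at hg
      rw [List.append_nil, List.append_nil, addHead_zero, hg, List.dropLast_concat]
    constructor
    · rintro ⟨ys, xs, j, h₄, h₅, rfl⟩
      rw [hS ys h₄, addHead_zero] at h₅
      exact ⟨ys :: xs, j, ⟨h₄, h₅⟩, by simp [decisions]⟩
    · rintro ⟨_ | ⟨ys, xs⟩, j, h₄, rfl⟩
      · exact h₄.elim
      · refine ⟨ys, xs, j, h₄.1, ?_, by simp [decisions]⟩
        rw [hS ys h₄.1, addHead_zero]
        exact h₄.2

/-- Induction on the word. The list `ys` holds the boxes still to be placed from the current row on;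
as `v` boxes of the current row have been placed already, the complete entries are `addHead v ys`. A
decision `true` lowers the head of `ys` by one, a decision `false` requires it to be zero. -/
theorem acceptsSpec (w : List Bool) : AcceptsSpec w := by
  induction w with
  | nil =>
    intro sl td pv slD tdD pvD g v e p ts first hts h₁ h₂ h₃ h₄ h₅
    refine ⟨fun h => absurd h (List.cons_ne_nil _ _), ?_⟩
    rintro ⟨ys, xs, j, h, -, hw⟩
    have h₆ := h.length_eq
    have h₇ := congrArg List.length hw
    rw [List.length_append, length_decisions] at h₇
    have := List.length_pos_of_ne_nil h₃
    simp only [List.length_nil] at h₇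
    omega
  | cons b w ih =>
    intro sl td pv slD tdD pvD g v e p ts first hts h₁ h₂ h₃ h₄ h₅
    obtain ⟨t, td, rfl⟩ := List.exists_cons_of_ne_nil h₃
    obtain ⟨s, sl, rfl⟩ := List.exists_cons_of_length_eq_add_one h₁
    obtain ⟨q, pv, rfl⟩ := List.exists_cons_of_length_eq_add_one h₂
    simp only [List.length_cons, Nat.add_right_cancel_iff] at h₁ h₂
    rcases b with _ | _
    -- After `false` the remaining entry of the current row is zero, and `v` becomes the entry of a
    -- finished row.
    · have hz : (∃ ys xs j, ValidRow (s :: sl) (t :: td) (q :: pv) e first p ys ∧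
          ListSeq (restoreSlack ((List.zipWith (· - ·) (s :: sl) ys).reverse ++ slD)
              ((addHead v ys).reverse ++ pvD) [g]).dropLast
            (tdD.reverse ++ List.zipWith (· - ·) (t :: td) ys) (pvD.reverse ++ addHead v ys)
            false ts xs ∧
          false :: w = decisions ys ++ (decisions xs.flatten ++ List.replicate j false)) ↔
          ∃ ys xs j, ValidRow sl td pv (e + q) first p ys ∧
          ListSeq (restoreSlack ((List.zipWith (· - ·) sl ys).reverse ++ s :: slD)
              ((addHead 0 ys).reverse ++ v :: pvD) [g]).dropLast
            ((t :: tdD).reverse ++ List.zipWith (· - ·) td ys) ((v :: pvD).reverse ++ addHead 0 ys)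
            false ts xs ∧
          w = decisions ys ++ (decisions xs.flatten ++ List.replicate j false) := by
        have h₉ : (if first = true then e + q else e - 0 + q) = e + q := by split_ifs <;> rfl
        have h₀ : ∀ ys, addHead v (0 :: ys) = v :: ys := fun ys => rfl
        constructor
        · rintro ⟨_ | ⟨_ | y, ys⟩, xs, j, h₆, h₇, h₈⟩
          · exact h₆.elim
          · refine ⟨ys, xs, j, ?_, ?_, by simpa [decisions_cons] using h₈⟩
            · have := h₆.2.2.2.2
              rwa [h₉] at this
            · simpa [h₀, addHead_zero] using h₇
          · simp [decisions_cons, List.replicate_succ] at h₈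
        · rintro ⟨ys, xs, j, h₆, h₇, rfl⟩
          refine ⟨0 :: ys, xs, j, ⟨by simp, by simp, by simp, by simp, ?_⟩, ?_,
            by simp [decisions_cons]⟩
          · rwa [h₉]
          · simpa [h₀, addHead_zero] using h₇
      rw [hz]
      have hne : (some p :: ts : List (Option ℕ)) ≠ [] := List.cons_ne_nil _ _
      by_cases htd : td = []
      · subst htd
        obtain rfl := List.length_eq_zero_iff.1 h₁
        obtain rfl := List.length_eq_zero_iff.1 h₂
        obtain ⟨sl', g', hsl⟩ : ∃ sl' g', restoreSlack (s :: slD) (v :: pvD) [g] = sl' ++ [g'] := by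
          rcases List.eq_nil_or_concat (restoreSlack (s :: slD) (v :: pvD) [g]) with h | ⟨l, a, h⟩
          · have := congrArg List.length h
            rw [length_restoreSlack _ _ _ (by simp [h₄, h₅])] at this
            simp at this
          · exact ⟨l, a, by rw [h, List.concat_eq_append]⟩
        have hlen := congrArg List.length hsl
        rw [length_restoreSlack _ _ _ (by simp [h₄, h₅])] at hlen
        simp only [List.length_cons, List.length_append, List.length_nil] at hlen
        have hstep : ∀ x : SearchState, x.td.tail = [] → x.pt ≠ [] → x.step false = x.next.endRow :=
          fun x h h' => (if_neg h').trans (if_pos h)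
        -- The last row has been passed. The continuation with a further row of the same partition
        -- and the one with a new partition differ only in `ts'` and `first'`.
        have hgoal : ∀ (ts' : List (Option ℕ)) (first' : Bool), GoodTokens ts' →
            (∀ xs, ListSeq sl' (t :: tdD).reverse (v :: pvD).reverse false ts xs ↔
              ListSeq sl' (t :: tdD).reverse (v :: pvD).reverse first' ts' xs) → p = 0 →
            (Accepts (SearchState.start (sl' ++ [g']) (t :: tdD).reverse (v :: pvD).reverse ts' first')
              w ↔ ∃ ys xs j, ValidRow [] [] [] (e + q) first p ys ∧
              ListSeq (restoreSlack ((List.zipWith (· - ·) [] ys).reverse ++ s :: slD)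
                ((addHead 0 ys).reverse ++ v :: pvD) [g]).dropLast
                ((t :: tdD).reverse ++ List.zipWith (· - ·) [] ys)
                ((v :: pvD).reverse ++ addHead 0 ys) false ts xs ∧
              w = decisions ys ++ (decisions xs.flatten ++ List.replicate j false)) := by
          rintro ts' first' hts' hseq rfl
          rw [ih.start hts' (by simp; omega) (by simp [h₅]) (Or.inr (by simp))]
          constructor
          · rintro ⟨xs, j, h₆, rfl⟩
            refine ⟨[], xs, j, rfl, ?_, rfl⟩
            have := (hseq xs).2 h₆
            simpa [addHead, hsl] using this
          · rintro ⟨ys, xs, j, h₆, h₇, rfl⟩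
            obtain rfl := List.length_eq_zero_iff.1 h₆.length_eq
            refine ⟨xs, j, (hseq xs).1 ?_, rfl⟩
            simpa [addHead, hsl] using h₇
        rw [Accepts, hstep _ (by exact rfl) hne]
        rcases p with _ | p
        · rcases ts with _ | ⟨_ | p', ts⟩
          · exact hts.elim
          · rw [← hgoal ts true hts (fun xs => Iff.rfl) rfl, ← hsl]
            exact ⟨fun ⟨y, h, h'⟩ => by obtain rfl := Option.some.inj h; exact h', fun h => ⟨_, rfl, h⟩⟩
          · rw [← hgoal (some p' :: ts) false hts (fun xs => Iff.rfl) rfl, ← hsl]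
            exact ⟨fun ⟨y, h, h'⟩ => by obtain rfl := Option.some.inj h; exact h', fun h => ⟨_, rfl, h⟩⟩
        · constructor
          · rintro ⟨y, hy, -⟩
            exact absurd hy (Option.some_ne_none y).symm
          · rintro ⟨ys, xs, j, h₆, -, -⟩
            rcases ys with _ | ⟨y, ys⟩
            · exact absurd (show p + 1 = 0 from h₆) (Nat.succ_ne_zero p)
            · exact h₆.elim
      · have hstep : ∀ x : SearchState, x.td.tail ≠ [] → x.pt ≠ [] → x.step false = some x.next :=
          fun x h h' => (if_neg h').trans (if_neg h)
        rw [Accepts, hstep _ (by exact htd) hne]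
        simp only [Option.some_inj, exists_eq_left']
        exact ih hts h₁ h₂ htd (congrArg (· + 1) h₄) (congrArg (· + 1) h₅)
    · constructor
      · rintro ⟨y, hy, hw⟩
        rcases s with _ | s
        · exact absurd hy (Option.some_ne_none y).symm
        rcases t with _ | t
        · exact absurd hy (Option.some_ne_none y).symm
        rcases p with _ | p
        · exact absurd hy (Option.some_ne_none y).symm
        change (if first = true ∨ 0 < e then some (SearchState.mk (s :: (sl ++ [g])) (t :: td) (q :: pv)
          slD tdD pvD (v + 1) (if first then e else e - 1) (some p :: ts) first) else none) =
          some y at hy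
        by_cases he : first = true ∨ 0 < e
        swap
        · rw [if_neg he] at hy
          simp at hy
        rw [if_pos he] at hy
        obtain rfl := Option.some.inj hy
        obtain ⟨ys, xs, j, h₆, h₇, rfl⟩ := (ih (p := p) (sl := s :: sl) (goodTokens_congr hts) (by simp [h₁]) (by simp [h₂])
          (by simp) h₄ h₅).1 hw
        rcases ys with _ | ⟨y, ys⟩
        · exact h₆.elim
        refine ⟨(y + 1) :: ys, xs, j, ?_, ?_, by simp [decisions_cons, List.replicate_succ]⟩
        · obtain ⟨a₁, a₂, a₃, a₄, a₅⟩ := h₆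
          refine ⟨by omega, by omega, by omega, ?_, ?_⟩
          · cases first <;> simp_all <;> omega
          · convert a₅ using 1
            · cases first <;> simp <;> omega
            · omega
        · simpa [addHead, add_assoc, add_comm 1] using h₇
      · rintro ⟨ys, xs, j, h₆, h₇, hw⟩
        rcases ys with _ | ⟨_ | y, ys⟩
        · exact h₆.elim
        · simp [decisions_cons] at hw
        obtain ⟨a₁, a₂, a₃, a₄, a₅⟩ := h₆
        obtain ⟨s, rfl⟩ := Nat.exists_eq_add_of_le' (show 1 ≤ s by omega)
        obtain ⟨t, rfl⟩ := Nat.exists_eq_add_of_le' (show 1 ≤ t by omega)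
        obtain ⟨p, rfl⟩ := Nat.exists_eq_add_of_le' (show 1 ≤ p by omega)
        have he : first = true ∨ 0 < e := a₄.imp_right (by omega)
        refine ⟨_, if_pos he, ?_⟩
        refine (ih (p := p) (sl := s :: sl) (goodTokens_congr hts) (by simp [h₁]) (by simp [h₂])
          (by simp) h₄ h₅).2 ⟨y :: ys, xs, j, ⟨by omega, by omega, by omega, ?_, ?_⟩, ?_, ?_⟩
        · cases first <;> simp_all; omega
        · convert a₅ using 1
          · cases first <;> simp; omega
          · omega
        · simpa [addHead, add_assoc, add_comm 1] using h₇
        · simpa [decisions_cons, List.replicate_succ] using hw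

/-- The number of successful decisions is the number of sequences of admissible rows. -/
theorem card_accepts {sl td pv : List ℕ} {g L : ℕ} {ts : List (Option ℕ)} {first : Bool}
    (hts : GoodTokens ts) (h₁ : sl.length = td.length) (h₂ : pv.length = td.length)
    (h₃ : ts = [] ∨ td ≠ []) (hL : tokenSum ts + td.length * ts.countP Option.isSome ≤ L) :
    Nat.card {w : List Bool // w.length = L ∧ (start (sl ++ [g]) td pv ts first).Accepts w} =
      Nat.card {xs // ListSeq sl td pv first ts xs} := by
  have hlen : ∀ {xs}, ListSeq sl td pv first ts xs →
      xs.flatten.length = td.length * ts.countP Option.isSome := by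
    intro xs hxs
    rw [List.length_flatten, ← hxs.length_eq_count, List.map_congr_left hxs.length_eq,
      List.map_const', List.sum_replicate, h₁, smul_eq_mul, mul_comm]
  symm
  -- Padding with `false` gives every sequence exactly one word of length `L`; by `hL` the unpadded
  -- word fits.
  refine Nat.card_congr (Equiv.ofBijective (fun xs => ⟨decisions xs.1.flatten ++
    List.replicate (L - (decisions xs.1.flatten).length) false, ?_, ?_⟩) ⟨?_, ?_⟩)
  · have := length_decisions xs.1.flatten
    rw [xs.2.sum_eq, hlen xs.2] at this
    simp only [List.length_append, List.length_replicate]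
    omega
  · exact (AcceptsSpec.start (acceptsSpec _) hts h₁ h₂ h₃).2 ⟨xs.1, _, xs.2, rfl⟩
  · rintro ⟨xs, hxs⟩ ⟨xs', hxs'⟩ h
    have h₄ := decisions_append_inj ((hlen hxs).trans (hlen hxs').symm) (Subtype.ext_iff.1 h)
    refine Subtype.ext (List.eq_iff_flatten_eq.2 ⟨h₄, ?_⟩)
    rw [List.map_congr_left hxs.length_eq, List.map_congr_left hxs'.length_eq, List.map_const',
      List.map_const', hxs.length_eq_count, hxs'.length_eq_count]
  · rintro ⟨w, hw, hacc⟩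
    obtain ⟨xs, j, hxs, rfl⟩ := (AcceptsSpec.start (acceptsSpec _) hts h₁ h₂ h₃).1 hacc
    refine ⟨⟨xs, hxs⟩, Subtype.ext ?_⟩
    simp only [List.length_append, List.length_replicate] at hw
    have h₄ : L - (decisions xs.flatten).length = j := by omega
    simp only [h₄]

end SearchState

end GelfandTsetlin

/-! ### Subroutines -/

/-- The stacks of the machine. -/
inductive Stk : Type
  | inp | lam | old | new | dif | low | tmp | ones | opens
  | slM | tdM | ptM | guess | cnt | gw | sl | td | pv | pt | slD | tdD | pvD | e
  deriving DecidableEq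

instance : Fintype Stk where
  elems := {.inp, .lam, .old, .new, .dif, .low, .tmp, .ones, .opens, .slM, .tdM, .ptM, .guess,
    .cnt, .gw, .sl, .td, .pv, .pt, .slD, .tdD, .pvD, .e}
  complete x := by cases x <;> decide

/-- The finite control of the machine. -/
structure Reg : Type where
  top : Option InputSymbol
  aux : Option InputSymbol
  aux' : Option InputSymbol
  c : Bool
  d : Bool
  flag : Bool
  ok : Bool
  first : Bool

noncomputable instance : Fintype Reg :=
  Fintype.ofInjective
    (fun r => ((r.top, r.aux, r.aux'), (r.c, r.d, r.flag), (r.ok, r.first))) (by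
      rintro ⟨⟩ ⟨⟩ h
      simpa [and_assoc] using h)

namespace StackProg

/-- A symbol which is a digit. -/
def isBit : Option InputSymbol → Bool
  | some (.bit _) => true
  | _ => false

/-- A symbol which is a part of a partition. -/
def notEnd : Option InputSymbol → Bool
  | some (.bit _) => true
  | some .endPart => true
  | _ => false

/-- Pop a symbol. -/
def popTop (X : Stk) (b : Block Stk Reg) : Block Stk Reg := .pop X (fun r a => { r with top := a }) b

/-- Push a symbol. -/
def pushSym (X : Stk) (a : InputSymbol) (b : Block Stk Reg) : Block Stk Reg := .push X (fun _ => a) b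

/-- Push the symbol which has been popped. -/
def pushTop (X : Stk) (b : Block Stk Reg) : Block Stk Reg :=
  .push X (fun r => r.top.getD .endPart) b

/-- Look at the topmost symbol. -/
def peek (X : Stk) : Block Stk Reg := popTop X (.branch (fun r => r.top.isSome) (pushTop X .nop) .nop)

/-- Push images of the symbol which has been popped. -/
def pushAll : List (Stk × (InputSymbol → InputSymbol)) → Block Stk Reg → Block Stk Reg
  | [], b => b
  | y :: Ys, b => .push y.1 (fun r => y.2 (r.top.getD .endPart)) (pushAll Ys b)

/-- Pop symbols from a stack as long as they satisfy a condition, pushing their images. -/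
def popWhile (c : Option InputSymbol → Bool) (X : Stk) (Ys : List (Stk × (InputSymbol → InputSymbol))) :
    StackProg Stk Reg :=
  .act (popTop X .nop) ;; .loop (fun r => c r.top) (.act (pushAll Ys (popTop X .nop)))

/-- The symbols pushed on a stack. -/
def pushed (Ys : List (Stk × (InputSymbol → InputSymbol))) (l : List InputSymbol) (j : Stk) :
    List InputSymbol :=
  (l.flatMap fun a => (Ys.filter fun y => y.1 = j).map fun y => y.2 a).reverse

theorem run_pushAll (Ys : List (Stk × (InputSymbol → InputSymbol))) (b : Block Stk Reg)
    {s : Store Stk Reg} {a : InputSymbol} (ha : s.reg.top = some a) :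
    (pushAll Ys b).run s = b.run ⟨s.reg, fun j => pushed Ys [a] j ++ s.stk j, s.out⟩ := by
  induction Ys generalizing s with
  | nil => rfl
  | cons y Ys ih =>
    rw [pushAll, Block.run, ih (by exact ha)]
    congr 2
    funext j
    by_cases hj : y.1 = j
    · subst hj
      simp [pushed, ha]
    · simp [pushed, Function.update_of_ne (Ne.symm hj), List.filter_cons_of_neg, hj]

theorem pushed_cons (Ys : List (Stk × (InputSymbol → InputSymbol))) (a : InputSymbol)
    (l : List InputSymbol) (j : Stk) : pushed Ys (a :: l) j = pushed Ys l j ++ pushed Ys [a] j := by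
  simp [pushed]

/-- The loop tests a symbol that has already been popped into `top`, so the stack always holds the
tail. The first symbol violating the condition is consumed as well and survives in `top` only. -/
theorem popWhile_loop_runs {c : Option InputSymbol → Bool} {X : Stk}
    {Ys : List (Stk × (InputSymbol → InputSymbol))} (hX : ∀ y ∈ Ys, y.1 ≠ X) {l : List InputSymbol} :
    ∀ {s : Store Stk Reg} {rest : List InputSymbol}, s.reg.top = (l ++ rest).head? →
      s.stk X = (l ++ rest).tail → (∀ a ∈ l, c (some a) = true) → c rest.head? = false →
      Runs (.loop (fun r => c r.top) (.act (pushAll Ys (popTop X .nop)))) s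
        ⟨{ s.reg with top := rest.head? },
          fun j => if j = X then rest.tail else pushed Ys l j ++ s.stk j, s.out⟩
        (2 * l.length + 1) := by
  have hpX : ∀ l, pushed Ys l X = [] := by
    intro l
    have : (Ys.filter fun y => y.1 = X) = [] := by
      rw [List.filter_eq_nil_iff]
      intro y hy
      simpa using hX y hy
    simp [pushed, this]
  induction l with
  | nil =>
    intro s rest hs₁ hs₂ hl hr
    rw [List.nil_append] at hs₁ hs₂
    have : s = ⟨{ s.reg with top := rest.head? },
        fun j => if j = X then rest.tail else pushed Ys [] j ++ s.stk j, s.out⟩ := by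
      rcases s with ⟨r, k, o⟩
      simp only at hs₁ hs₂
      rw [← hs₁]
      congr 1
      funext j
      split_ifs with h
      · rw [h, hs₂]
      · rfl
    exact this ▸ Runs.loopFalse (by rw [hs₁, hr])
  | cons a l ih =>
    intro s rest hs₁ hs₂ hl hr
    simp only [List.cons_append, List.head?_cons, List.tail_cons] at hs₁ hs₂
    have h₁ : Runs (.act (pushAll Ys (popTop X .nop))) s
        ⟨{ s.reg with top := (l ++ rest).head? }, fun j => if j = X then (l ++ rest).tail
          else pushed Ys [a] j ++ s.stk j, s.out⟩ 1 := by
      refine Runs.act ?_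
      rw [run_pushAll Ys _ hs₁, popTop, Block.run, Block.run]
      simp only [hpX, List.nil_append, hs₂]
      congr 1
      funext j
      by_cases h : j = X
      · subst h; simp
      · simp [h]
    have h₂ := ih (s := ⟨{ s.reg with top := (l ++ rest).head? }, fun j => if j = X then
      (l ++ rest).tail else pushed Ys [a] j ++ s.stk j, s.out⟩) rfl (if_pos rfl)
      (fun b hb => hl b (List.mem_cons_of_mem _ hb)) hr
    refine (Runs.loopTrue (by rw [hs₁]; exact hl a List.mem_cons_self) h₁ h₂).cast ?_ ?_
    · simp only [pushed_cons Ys a l]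
      congr 1
      funext j
      by_cases h : j = X
      · rw [if_pos h, if_pos h]
      · rw [if_neg h, if_neg h, if_neg h, List.append_assoc]
    · simp only [List.length_cons]
      omega

theorem popWhile_runs {c : Option InputSymbol → Bool} {X : Stk}
    {Ys : List (Stk × (InputSymbol → InputSymbol))} {s : Store Stk Reg} (l rest : List InputSymbol)
    (hX : ∀ y ∈ Ys, y.1 ≠ X) (hs : s.stk X = l ++ rest) (hl : ∀ a ∈ l, c (some a) = true)
    (hr : c rest.head? = false) :
    Runs (popWhile c X Ys) s
      ⟨{ s.reg with top := rest.head? },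
        fun j => if j = X then rest.tail else pushed Ys l j ++ s.stk j, s.out⟩
      (2 * l.length + 2) := by
  have h₁ : Runs (.act (popTop X .nop)) s
      ⟨{ s.reg with top := (l ++ rest).head? }, Function.update s.stk X (l ++ rest).tail, s.out⟩ 1 :=
    Runs.act (by rw [← hs]; rfl)
  refine (h₁.seq (popWhile_loop_runs hX (l := l) (rest := rest) rfl (Function.update_self ..) hl
    hr)).cast ?_ (by omega)
  congr 1
  funext j
  by_cases h : j = X
  · rw [if_pos h, if_pos h]
  · simp [h]

theorem pushed_nil (l : List InputSymbol) (j : Stk) : pushed [] l j = [] := by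
  simp [pushed]

theorem pushed_id (Y : Stk) (l : List InputSymbol) (j : Stk) :
    pushed [(Y, id)] l j = if Y = j then l.reverse else [] := by
  by_cases h : Y = j <;> simp [pushed, h]

/-- Empty a stack. -/
def drain (X : Stk) : StackProg Stk Reg := popWhile Option.isSome X []

theorem drain_runs (X : Stk) (s : Store Stk Reg) :
    Runs (drain X) s ⟨{ s.reg with top := none }, Function.update s.stk X [], s.out⟩
      (2 * (s.stk X).length + 2) := by
  refine (popWhile_runs (s.stk X) [] (by simp) (by simp) (by simp) rfl).cast ?_ le_rfl
  congr 1
  funext j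
  by_cases h : j = X
  · subst h; simp
  · simp [h, pushed_nil]

/-- Move a stack to another one, in reversed order. -/
def move (X Y : Stk) : StackProg Stk Reg := popWhile Option.isSome X [(Y, id)]

theorem move_runs {X Y : Stk} (h : Y ≠ X) (s : Store Stk Reg) :
    Runs (move X Y) s ⟨{ s.reg with top := none },
      Function.update (Function.update s.stk X []) Y ((s.stk X).reverse ++ s.stk Y), s.out⟩
      (2 * (s.stk X).length + 2) := by
  refine (popWhile_runs (s.stk X) [] (by simpa using h) (by simp) (by simp) rfl).cast ?_ le_rfl
  congr 1
  funext j
  by_cases h₁ : j = Y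
  · subst h₁; simp [h, pushed_id]
  · by_cases h₂ : j = X
    · subst h₂; simp [h₁]
    · simp [h₁, h₂, pushed_id, Ne.symm h₁]

/-- Move the topmost digits of a stack to another one. -/
def moveBits (X Y : Stk) : StackProg Stk Reg := popWhile isBit X [(Y, id)]

theorem moveBits_runs {X Y : Stk} (h : Y ≠ X) {s : Store Stk Reg} (l rest : List InputSymbol)
    (hs : s.stk X = l ++ rest) (hl : ∀ a ∈ l, isBit (some a) = true)
    (hr : isBit rest.head? = false) :
    Runs (moveBits X Y) s ⟨{ s.reg with top := rest.head? },
      Function.update (Function.update s.stk X rest.tail) Y (l.reverse ++ s.stk Y), s.out⟩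
      (2 * l.length + 2) := by
  refine (popWhile_runs l rest (by simpa using h) hs hl hr).cast ?_ le_rfl
  congr 1
  funext j
  by_cases h₁ : j = Y
  · subst h₁; simp [h, pushed_id]
  · by_cases h₂ : j = X
    · subst h₂; simp [h₁]
    · simp [h₁, h₂, pushed_id, Ne.symm h₁]

/-- Copy a stack to an empty stack. -/
def copy (X Y : Stk) : StackProg Stk Reg :=
  move X .tmp ;; popWhile Option.isSome .tmp [(X, id), (Y, id)]

theorem copy_runs {X Y : Stk} (hX : X ≠ .tmp) (hY : Y ≠ .tmp) (hXY : Y ≠ X)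
    {s : Store Stk Reg} (htmp : s.stk .tmp = []) (hs : s.stk Y = []) :
    Runs (copy X Y) s ⟨{ s.reg with top := none }, Function.update s.stk Y (s.stk X), s.out⟩
      (4 * (s.stk X).length + 4) := by
  have h₁ := move_runs hX.symm s
  refine (h₁.seq (popWhile_runs (s.stk X).reverse [] (by simp [hX, hY]) (by simp [htmp])
    (by simp) rfl)).cast ?_ (by simp; omega)
  congr 1
  funext j
  by_cases h : j = .tmp
  · subst h; simp [hY.symm, htmp]
  · by_cases h₂ : j = X
    · subst h₂; simp [h, hXY.symm, pushed, hXY]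
    · by_cases h₃ : j = Y
      · subst h₃; simp [h, h₂, pushed, Ne.symm h₂, hs]
      · simp [h, h₂, h₃, pushed, Ne.symm h₂, Ne.symm h₃]

/-! ### Binary numbers and their increment -/

/-- The binary number whose digits are given, least significant digit first. -/
def digitsVal (l : List Bool) : ℕ := l.foldr (fun b n => b.toNat + 2 * n) 0

theorem digitsVal_cons (b : Bool) (l : List Bool) :
    digitsVal (b :: l) = b.toNat + 2 * digitsVal l := rfl

theorem digitsVal_lt (l : List Bool) : digitsVal l < 2 ^ l.length := by
  induction l with
  | nil => simp [digitsVal]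
  | cons b l ih =>
    rw [digitsVal_cons, List.length_cons, pow_succ]
    have := b.toNat_lt
    omega

theorem digitsVal_injective {l l' : List Bool} (hl : l.length = l'.length)
    (h : digitsVal l = digitsVal l') : l = l' := by
  induction l generalizing l' with
  | nil => exact (List.length_eq_zero_iff.1 hl.symm).symm
  | cons b l ih =>
    rcases l' with _ | ⟨b', l'⟩
    · simp at hl
    · rw [digitsVal_cons, digitsVal_cons] at h
      have h₁ := b.toNat_lt
      have h₂ := b'.toNat_lt
      rw [ih (by simpa using hl) (by omega), (by cases b <;> cases b' <;> simp at h ⊢ <;> omega :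
        b = b')]

theorem digitsVal_bits (n : ℕ) : digitsVal n.bits = n := by
  induction n using Nat.binaryRec' with
  | zero => rfl
  | bit b n h ih => rw [Nat.bits_append_bit n b h, digitsVal_cons, ih, Nat.bit_val, add_comm]

/-- Increment a binary number, least significant digit first. -/
def succDigits : List Bool → List Bool
  | [] => [true]
  | false :: l => true :: l
  | true :: l => false :: succDigits l

theorem digitsVal_succDigits (l : List Bool) : digitsVal (succDigits l) = digitsVal l + 1 := by
  induction l with
  | nil => rfl
  | cons b l ih =>
    cases b
    · simp [succDigits, digitsVal_cons]; omega
    · simp [succDigits, digitsVal_cons, ih]; omega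

theorem length_succDigits {l : List Bool} (h : l.all id = false) :
    (succDigits l).length = l.length := by
  induction l with
  | nil => simp at h
  | cons b l ih =>
    cases b
    · rfl
    · rw [succDigits, List.length_cons, ih (by simpa using h), List.length_cons]

theorem digitsVal_of_all {l : List Bool} (h : l.all id = true) :
    digitsVal l + 1 = 2 ^ l.length := by
  induction l with
  | nil => rfl
  | cons b l ih =>
    simp only [List.all_cons, id_eq, Bool.and_eq_true] at h
    rw [digitsVal_cons, h.1, List.length_cons, pow_succ, ← ih h.2, Bool.toNat_true]
    omega

theorem succDigits_bits (n : ℕ) : succDigits n.bits = (n + 1).bits := by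
  induction n using Nat.binaryRec' with
  | zero => simp [succDigits]
  | bit b n h ih =>
    rw [Nat.bits_append_bit n b h]
    cases b
    · rw [succDigits, Nat.bit_false, ← Nat.bit1_bits]
    · rw [succDigits, ih, Nat.bit_true, ← Nat.bit0_bits _ (Nat.succ_ne_zero n)]
      congr 1

/-- Increment a binary number. -/
def incr (X : Stk) : StackProg Stk Reg :=
  popWhile (fun a => decide (a = some (.bit true))) X [(.tmp, fun _ => .bit false)] ;;
    .act (.load (fun r => { r with c := r.top.isNone }) (pushSym X (.bit true) .nop)) ;; move .tmp X

theorem incr_runs {X : Stk} (hX : X ≠ .tmp) {s : Store Stk Reg} (htmp : s.stk .tmp = [])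
    (l : List Bool) (hs : s.stk X = l.map .bit) :
    Runs (incr X) s ⟨{ s.reg with top := none, c := l.all id },
      Function.update s.stk X ((succDigits l).map .bit), s.out⟩ (4 * l.length + 5) := by
  -- The increment flips the initial run of ones and the zero after it. There is no such zero
  -- exactly if all digits are ones, and the register `c` records this overflow.
  have key : ∀ l : List Bool, ∃ j rest, l = List.replicate j true ++ rest ∧ rest.head? ≠ some true ∧
      l.all id = rest.isEmpty ∧ succDigits l = List.replicate j false ++ true :: rest.tail := by
    intro l
    induction l with
    | nil => exact ⟨0, [], rfl, by simp, rfl, rfl⟩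
    | cons b l ih =>
      cases b
      · exact ⟨0, false :: l, rfl, by simp, rfl, rfl⟩
      · obtain ⟨j, rest, h₁, h₂, h₃, h₄⟩ := ih
        refine ⟨j + 1, rest, ?_, h₂, by simpa using h₃, ?_⟩
        · rw [h₁]; rfl
        · rw [succDigits, h₄]; rfl
  obtain ⟨j, rest, h₁, h₂, h₃, h₄⟩ := key l
  have r₁ := popWhile_runs (c := fun a => decide (a = some (.bit true))) (X := X)
    (Ys := [(.tmp, fun _ => .bit false)]) (s := s) (List.replicate j (.bit true))
    (rest.map .bit) (by simpa using hX.symm) (by simp [hs, h₁])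
    (by simp) (by
      rcases rest with _ | ⟨_ | _, rest⟩
      · simp
      · simp
      · simp at h₂)
  have hp : pushed [(Stk.tmp, fun _ => InputSymbol.bit false)] (List.replicate j (.bit true)) .tmp =
      List.replicate j (.bit false) := by
    simp [pushed, List.flatMap_replicate]
  refine (r₁.seq ((Runs.act rfl).seq (move_runs hX _))).cast ?_ ?_
  · simp only [Block.run, pushSym]
    congr 1
    · congr 1
      rw [h₃]
      rcases rest with _ | _ <;> simp
    · funext i
      by_cases hi : i = X
      · subst hi
        simp [hX.symm, hp, htmp, h₄]
      · by_cases hi' : i = .tmp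
        · subst hi'
          simp [hi, htmp]
        · simp [hi, hi', pushed, Ne.symm hi']
  · have : l.length = j + rest.length := by rw [h₁]; simp
    simp [Block.run, pushSym, hX.symm, hp, htmp]
    omega

end StackProg

/-! ### The search, on the stack machine -/

namespace StackProg

open GelfandTsetlin

/-- Lists of numbers in unary notation. -/
def unary (l : List ℕ) : List InputSymbol :=
  l.flatMap fun n => List.replicate n (.bit true) ++ [.endPart]

theorem unary_cons (n : ℕ) (l : List ℕ) :
    unary (n :: l) = List.replicate n (.bit true) ++ .endPart :: unary l := by
  simp [unary]

/-- Tokens in unary notation. -/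
def unaryTokens (l : List (Option ℕ)) : List InputSymbol :=
  l.flatMap fun
    | some n => List.replicate n (.bit true) ++ [.endPart]
    | none => [.endPartition]

theorem unaryTokens_some (n : ℕ) (l : List (Option ℕ)) :
    unaryTokens (some n :: l) = List.replicate n (.bit true) ++ .endPart :: unaryTokens l := by
  simp [unaryTokens]

theorem unaryTokens_none (l : List (Option ℕ)) :
    unaryTokens (none :: l) = .endPartition :: unaryTokens l := by
  simp [unaryTokens]

/-- The mark of unary notation. -/
def isMark : Option InputSymbol → Bool
  | some (.bit true) => true
  | _ => false

/-- Pop a mark, or fail. -/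
def popMark (X : Stk) (b : Block Stk Reg) : Block Stk Reg :=
  .pop X (fun r a => { r with ok := r.ok && isMark a }) b

/-- Place a box. -/
def placeBox : Block Stk Reg :=
  popMark .sl (popMark .td (popMark .pt (.branch (fun r => r.first) (pushSym .pvD (.bit true) .nop)
    (popMark .e (pushSym .pvD (.bit true) .nop)))))

/-- Put a finished row back. -/
def restoreRow : StackProg Stk Reg :=
  .act (pushSym .td .endPart (pushSym .pv .endPart .nop)) ;;
  moveBits .tdD .td ;;
  popWhile isBit .pvD [(.pv, id), (.sl, id)] ;;
  .act (pushSym .sl .endPart .nop) ;;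
  moveBits .slD .sl ;;
  .act (peek .tdD)

/-- Put the finished rows back. -/
def restore : StackProg Stk Reg :=
  .act (peek .tdD) ;; .loop (fun r => r.top.isSome) restoreRow

/-- Inspect the end of a row of boxes. -/
def popToken : Block Stk Reg :=
  .pop .pt (fun r a => { r with ok := r.ok && decide (a = some .endPart) })
    (.pop .pt (fun r a => { r with top := a, first := decide (a = some .endPartition) })
      (.branch (fun r => r.first || r.top.isNone) .nop (pushTop .pt .nop)))

/-- Complete a row of boxes. -/
def completeRow : StackProg Stk Reg :=
  .act popToken ;; drain .e ;; restore ;; .act (pushSym .pvD .endPart .nop)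

/-- Proceed to the next row. -/
def shiftRow : StackProg Stk Reg :=
  .act (pushSym .slD .endPart (pushSym .tdD .endPart .nop)) ;;
    moveBits .sl .slD ;; moveBits .td .tdD ;; moveBits .pv .e ;; .act (peek .td)

/-- Proceed to the next row, or to the next row of boxes. -/
def nextRow : StackProg Stk Reg :=
  .act (peek .pt) ;; .ite (fun r => r.top.isNone) (.act .nop) (
    shiftRow ;; .ite (fun r => r.top.isSome) (.act (pushSym .pvD .endPart .nop)) completeRow)

/-- A step of the search. -/
def searchStep : StackProg Stk Reg :=
  .ite (fun r => isMark r.top) (.act placeBox) nextRow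

/-- The stacks hold the state `x` of the search. -/
structure Represents (s : Store Stk Reg) (x : SearchState) : Prop where
  sl : s.stk .sl = unary x.sl
  td : s.stk .td = unary x.td
  pv : s.stk .pv = unary x.pv
  slD : s.stk .slD = unary x.slD
  tdD : s.stk .tdD = unary x.tdD
  pvD : s.stk .pvD = unary (x.v :: x.pvD)
  e : s.stk .e = List.replicate x.e (.bit true)
  pt : s.stk .pt = unaryTokens x.pt
  first : s.reg.first = x.first

end StackProg

/-! ### Well-formed states and the bound for their size -/

namespace GelfandTsetlin.SearchState

/-- The lists of a state fit together. -/
structure WF (x : SearchState) : Prop where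
  sl : x.sl.length = x.td.length + 1
  pv : x.pv.length = x.td.length
  slD : x.slD.length = x.tdD.length
  pvD : x.pvD.length = x.tdD.length
  td : x.pt ≠ [] → x.td ≠ []
  pt : GoodTokens x.pt

/-- A bound for the size of a state, which does not grow. -/
def size (x : SearchState) : ℕ :=
  (x.sl.sum + x.sl.length) + (x.td.sum + x.td.length) + (x.pv.sum + x.pv.length) +
    (x.slD.sum + x.slD.length) + (x.tdD.sum + x.tdD.length) + (2 * x.pvD.sum + x.pvD.length) +
    2 * x.v + x.e + ((x.pt.map (Option.getD · 0)).sum + x.pt.length)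

theorem restoreSlack_sum (a c sl : List ℕ) (h : a.length = c.length) (hsl : sl ≠ []) :
    (restoreSlack a c sl).sum = a.sum + c.sum + sl.sum := by
  induction a generalizing c sl with
  | nil => rw [List.length_eq_zero_iff.1 h.symm]; simp [restoreSlack]
  | cons s a ih =>
    rcases c with _ | ⟨v, c⟩
    · simp at h
    · obtain ⟨y, sl, rfl⟩ := List.exists_cons_of_ne_nil hsl
      rw [restoreSlack, ih _ _ (by simpa using h) (by simp)]
      simp only [addHead, List.sum_cons]
      omega

theorem WF.next {x : SearchState} (h : x.WF) (hpt : x.pt ≠ []) (htd : x.td.tail ≠ []) :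
    x.next.WF ∧ x.next.size ≤ x.size := by
  rcases x with ⟨sl, td, pv, slD, tdD, pvD, v, e, pt, first⟩
  obtain ⟨h₁, h₂, h₃, h₄, h₅, h₆⟩ := h
  simp only at *
  obtain ⟨t, td, rfl⟩ := List.exists_cons_of_ne_nil (h₅ hpt)
  obtain ⟨s, sl, rfl⟩ := List.exists_cons_of_length_eq_add_one h₁
  obtain ⟨q, pv, rfl⟩ := List.exists_cons_of_length_eq_add_one h₂
  simp only [List.length_cons, List.tail_cons] at *
  refine ⟨⟨?_, ?_, ?_, ?_, fun _ => htd, h₆⟩, ?_⟩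
  · simpa [SearchState.next] using h₁
  · simpa [SearchState.next] using h₂
  · simpa [SearchState.next] using h₃
  · simpa [SearchState.next] using h₄
  · simp only [SearchState.next, size, List.sum_cons, List.length_cons, List.tail_cons, List.headI_cons]
    omega

theorem WF.restart {x : SearchState} (h : x.WF) (hpt : x.pt ≠ []) (htd : x.td.tail = [])
    {pt : List (Option ℕ)} (hp : GoodTokens pt) (first : Bool)
    (hsum : (pt.map (Option.getD · 0)).sum + pt.length ≤
      (x.pt.map (Option.getD · 0)).sum + x.pt.length) :
    (x.next.restart pt first).WF ∧ (x.next.restart pt first).size ≤ x.size := by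
  rcases x with ⟨sl, td, pv, slD, tdD, pvD, v, e, pt', first'⟩
  obtain ⟨h₁, h₂, h₃, h₄, h₅, h₆⟩ := h
  simp only at *
  obtain ⟨t, td, rfl⟩ := List.exists_cons_of_ne_nil (h₅ hpt)
  obtain rfl : td = [] := htd
  obtain ⟨s, sl, rfl⟩ := List.exists_cons_of_length_eq_add_one h₁
  obtain ⟨q, pv, rfl⟩ := List.exists_cons_of_length_eq_add_one h₂
  simp only [List.length_cons, List.length_nil, Nat.add_right_cancel_iff] at h₁ h₂
  obtain rfl := List.length_eq_zero_iff.1 h₂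
  obtain ⟨g, sl, rfl⟩ := List.exists_cons_of_length_eq_add_one h₁
  obtain rfl := List.length_eq_zero_iff.1 (Nat.succ.inj h₁)
  have hl : (s :: slD).length = (v :: pvD).length := by simp [h₃, h₄]
  have hlen := length_restoreSlack (s :: slD) (v :: pvD) [g] hl
  refine ⟨⟨?_, ?_, rfl, rfl, fun _ => by simp [SearchState.restart, SearchState.next], hp⟩, ?_⟩
  · simp only [SearchState.restart, SearchState.next, List.tail_cons, List.headI_cons, hlen]
    simp [h₃]
  · simp [SearchState.restart, SearchState.next, h₄]
  · simp only [SearchState.restart, SearchState.next, size, List.tail_cons, List.headI_cons, hlen,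
      restoreSlack_sum _ _ _ hl (List.cons_ne_nil g []), List.sum_reverse, List.length_reverse,
      List.sum_cons, List.length_cons, List.sum_nil, List.length_nil]
    omega

/-- Placed boxes count twice in `size`, because a finished entry is later copied both to `pv` and to
`sl`. Placing a box removes one from each of `sl`, `td` and `pt`, which pays for this. -/
theorem WF.step {x y : SearchState} (h : x.WF) {b : Bool} (hy : x.step b = some y) :
    y.WF ∧ y.size ≤ x.size := by
  rcases b with _ | _
  · change x.advance = some y at hy
    rw [advance] at hy
    split_ifs at hy with hpt htd
    · obtain rfl := Option.some.inj hy
      exact ⟨h, le_rfl⟩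
    · have hG := h.pt
      rcases hp : x.pt with _ | ⟨_ | _ | p, _ | ⟨_ | q, ts⟩⟩ <;>
        simp only [endRow, SearchState.next, hp, reduceCtorEq, Option.some_inj] at hy
      · subst hy
        rw [hp] at hG
        exact h.restart hpt htd (pt := ts) hG true (by simp [hp]; omega)
      · subst hy
        rw [hp] at hG
        exact h.restart hpt htd (pt := some q :: ts) hG false (by simp [hp])
    · obtain rfl := Option.some.inj hy
      exact h.next hpt htd
  · change x.place = some y at hy
    rcases x with ⟨_ | ⟨_ | s, sl⟩, _ | ⟨_ | t, td⟩, pv, slD, tdD, pvD, v, e, _ | ⟨_ | _ | p, pt⟩,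
      first⟩ <;> simp only [place, reduceCtorEq] at hy
    split_ifs at hy with he hf
    all_goals
      obtain rfl := Option.some.inj hy
      refine ⟨⟨h.sl, h.pv, h.slD, h.pvD, fun _ => by simp, goodTokens_congr h.pt⟩, ?_⟩
      simp only [size, List.sum_cons, List.length_cons, List.map_cons, Option.getD_some]
      omega

end GelfandTsetlin.SearchState

/-! ### Simulation of a step of the search -/

namespace StackProg

open GelfandTsetlin

theorem isBit_of_mem_replicate {n : ℕ} : ∀ a ∈ List.replicate n (InputSymbol.bit true),
    isBit (some a) = true := by
  intro a ha
  rw [List.eq_of_mem_replicate ha]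
  rfl

theorem unary_addHead (v : ℕ) {l : List ℕ} (hl : l ≠ []) :
    unary (addHead v l) = List.replicate v (.bit true) ++ unary l := by
  obtain ⟨a, l, rfl⟩ := List.exists_cons_of_ne_nil hl
  rw [addHead, unary_cons, unary_cons, List.replicate_add, List.append_assoc]

theorem head?_unary (l : List ℕ) : (unary l).head? = none ↔ l = [] := by
  rcases l with _ | ⟨_ | n, l⟩ <;> simp [unary, List.replicate_succ]

theorem run_peek (X : Stk) (s : Store Stk Reg) :
    (peek X).run s = ⟨{ s.reg with top := (s.stk X).head? }, s.stk, s.out⟩ := by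
  rw [peek, popTop, Block.run, Block.run]
  rcases h : s.stk X with _ | ⟨a, l⟩
  · simp only [List.head?_nil, Option.isSome_none, cond_false, Block.run, List.tail_nil]
    congr 1
    rw [← h, Function.update_eq_self]
  · simp only [List.head?_cons, Option.isSome_some, cond_true, Block.run, List.tail_cons, pushTop,
      Function.update_self, Option.getD_some, Function.update_idem]
    congr 1
    rw [← h, Function.update_eq_self]

theorem peek_runs (X : Stk) (s : Store Stk Reg) :
    Runs (.act (peek X)) s ⟨{ s.reg with top := (s.stk X).head? }, s.stk, s.out⟩ 1 :=
  Runs.act (run_peek X s)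

theorem flatMap_const_nil (l : List InputSymbol) :
    (l.flatMap fun _ => ([] : List InputSymbol)) = [] := by
  simp

/-- The marks of the entry `v` are written to `sl` before the end marker of the slack of its own
row, so they join the slack of the row below; this realizes `addHead`. -/
theorem restoreRow_runs {a b c sl td pv : List ℕ} {x t v : ℕ} {s : Store Stk Reg}
    (ha : s.stk .slD = unary (x :: a)) (hb : s.stk .tdD = unary (t :: b))
    (hc : s.stk .pvD = unary (v :: c)) (hs : s.stk .sl = unary sl) (hsl : sl ≠ [])
    (ht : s.stk .td = unary td) (hp : s.stk .pv = unary pv) :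
    ∃ s', Runs restoreRow s s' (2 * (x + t + v) + 9) ∧ s'.stk .slD = unary a ∧
      s'.stk .tdD = unary b ∧ s'.stk .pvD = unary c ∧ s'.stk .sl = unary (x :: addHead v sl) ∧
      s'.stk .td = unary (t :: td) ∧ s'.stk .pv = unary (v :: pv) ∧
      s'.reg = { s.reg with top := (unary b).head? } := by
  have r := Runs.seq (Runs.act (s := s)
    (b := pushSym .td .endPart (pushSym .pv .endPart .nop)) rfl)
    (Runs.seq (moveBits_runs (X := .tdD) (Y := .td) (by decide)
    (List.replicate t (.bit true)) (.endPart :: unary b) (by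
      simp [Block.run, pushSym, hb, unary_cons]) isBit_of_mem_replicate rfl)
    (Runs.seq (popWhile_runs (c := isBit) (X := .pvD) (Ys := [(.pv, id), (.sl, id)])
    (List.replicate v (.bit true)) (.endPart :: unary c) (by simp) (by
      simp [Block.run, pushSym, hc, unary_cons]) isBit_of_mem_replicate rfl)
    (Runs.seq (Runs.act (b := pushSym .sl .endPart .nop) rfl)
    (Runs.seq (moveBits_runs (X := .slD) (Y := .sl) (by decide)
    (List.replicate x (.bit true)) (.endPart :: unary a) (by
      simp [Block.run, pushSym, ha, unary_cons, pushed]) isBit_of_mem_replicate rfl)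
    (peek_runs .tdD _)))))
  refine ⟨_, r.mono ?_, ?_⟩
  · simp only [List.length_replicate]
    omega
  · simp [Block.run, pushSym, pushed, hs, ht, hp, unary_cons, unary_addHead v hsl, flatMap_const_nil]

theorem restore_loop_runs {c : List ℕ} : ∀ {a b sl td pv : List ℕ} {s : Store Stk Reg},
    a.length = b.length → c.length = b.length → sl ≠ [] → s.stk .slD = unary a →
    s.stk .tdD = unary b → s.stk .pvD = unary c → s.stk .sl = unary sl → s.stk .td = unary td →
    s.stk .pv = unary pv → s.reg.top = (unary b).head? →
    ∃ s', Runs (.loop (fun r => r.top.isSome) restoreRow) s s'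
        (2 * (a.sum + b.sum + c.sum) + 10 * b.length + 1) ∧
      s'.stk .slD = [] ∧ s'.stk .tdD = [] ∧ s'.stk .pvD = [] ∧
      s'.stk .sl = unary (restoreSlack a c sl) ∧ s'.stk .td = unary (b.reverse ++ td) ∧
      s'.stk .pv = unary (c.reverse ++ pv) ∧ s'.reg = { s.reg with top := none } := by
  induction c with
  | nil =>
    intro a b sl td pv s h₁ h₂ hsl ha hb hc hs ht hp htop
    obtain rfl := List.length_eq_zero_iff.1 h₂.symm
    obtain rfl := List.length_eq_zero_iff.1 h₁
    refine ⟨s, (Runs.loopFalse (by rw [htop]; rfl)).mono (by omega), ha, hb, hc, hs, ht, hp, ?_⟩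
    rw [show none = s.reg.top from htop.symm]
  | cons v c ih =>
    intro a b sl td pv s h₁ h₂ hsl ha hb hc hs ht hp htop
    obtain ⟨t, b, rfl⟩ := List.exists_cons_of_length_eq_add_one h₂.symm
    obtain ⟨x, a, rfl⟩ := List.exists_cons_of_length_eq_add_one h₁
    obtain ⟨s₁, r, ha₁, hb₁, hc₁, hs₁, ht₁, hp₁, hr₁⟩ := restoreRow_runs ha hb hc hs hsl ht hp
    obtain ⟨s', r', h'⟩ := ih (by simpa using h₁) (by simpa using h₂) (by simp) ha₁ hb₁ hc₁ hs₁ ht₁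
      hp₁ (by rw [hr₁])
    refine ⟨s', (Runs.loopTrue ?_ r r').mono ?_, ?_⟩
    · simp [htop, unary_cons]
    · simp only [List.sum_cons, List.length_cons]
      omega
    · simpa [restoreSlack, hr₁] using h'

theorem restore_runs {a b c sl td pv : List ℕ} {s : Store Stk Reg}
    (h₁ : a.length = b.length) (h₂ : c.length = b.length) (hsl : sl ≠ [])
    (ha : s.stk .slD = unary a) (hb : s.stk .tdD = unary b) (hc : s.stk .pvD = unary c)
    (hs : s.stk .sl = unary sl) (ht : s.stk .td = unary td) (hp : s.stk .pv = unary pv) :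
    ∃ s', Runs restore s s' (2 * (a.sum + b.sum + c.sum) + 10 * b.length + 2) ∧
      s'.stk .slD = [] ∧ s'.stk .tdD = [] ∧ s'.stk .pvD = [] ∧
      s'.stk .sl = unary (restoreSlack a c sl) ∧ s'.stk .td = unary (b.reverse ++ td) ∧
      s'.stk .pv = unary (c.reverse ++ pv) ∧ s'.reg = { s.reg with top := none } := by
  obtain ⟨s', r, h⟩ := restore_loop_runs (s := ⟨{ s.reg with top := (s.stk .tdD).head? }, s.stk, s.out⟩)
    h₁ h₂ hsl ha hb hc hs ht hp (by rw [hb])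
  exact ⟨s', ((peek_runs .tdD s).seq r).mono (by omega), h⟩

/-- The outcome of a step. -/
def Outcome (s : Store Stk Reg) : Option SearchState → Prop
  | none => s.reg.ok = false
  | some y => s.reg.ok = true ∧ Represents s y

theorem isMark_head?_unary (n : ℕ) (l : List ℕ) :
    isMark (unary (n :: l)).head? = decide (0 < n) := by
  rcases n with _ | n <;> simp [unary_cons, List.replicate_succ, isMark]

theorem reg_ok_placeBox (s : Store Stk Reg) : (placeBox.run s).reg.ok =
    ((((s.reg.ok && isMark (s.stk .sl).head?) && isMark (s.stk .td).head?) &&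
      isMark (s.stk .pt).head?) && (s.reg.first || isMark (s.stk .e).head?)) := by
  cases h : s.reg.first <;> simp [placeBox, popMark, pushSym, Block.run, h]

/-- A failure is recorded in `ok` alone. The stacks are then meaningless, and `Outcome` says nothing
about them. -/
theorem placeBox_runs {s : Store Stk Reg} {x : SearchState} (hx : x.WF) (h : Represents s x)
    (hok : s.reg.ok = true) : Outcome (placeBox.run s) x.place := by
  have hreg := reg_ok_placeBox s
  rcases x with ⟨sl, td, pv, slD, tdD, pvD, v, e, pt, first⟩
  obtain ⟨h₁, h₂, h₃, h₄, h₅, h₆, h₇, h₈, h₉⟩ := h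
  have hG := hx.pt
  have hsl := hx.sl
  simp only at *
  rw [h₁, h₂, h₇, h₈, h₉, hok] at hreg
  obtain ⟨n, sl, rfl⟩ := List.exists_cons_of_length_eq_add_one hsl
  rcases n with _ | n
  · simpa [SearchState.place, Outcome, isMark_head?_unary] using hreg
  rcases td with _ | ⟨_ | t, td⟩
  · simpa [SearchState.place, Outcome, unary, isMark] using hreg
  · simpa [SearchState.place, Outcome, isMark_head?_unary] using hreg
  rcases pt with _ | ⟨_ | _ | p, pt⟩
  · simpa [SearchState.place, Outcome, unaryTokens, isMark] using hreg
  · exact hG.elim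
  · simpa [SearchState.place, Outcome, unaryTokens, isMark] using hreg
  have hp : isMark (unaryTokens (some (p + 1) :: pt)).head? = true := rfl
  simp only [isMark_head?_unary, hp, Nat.zero_lt_succ, decide_true, Bool.and_true,
    Bool.true_and] at hreg
  have hm : ∀ e : ℕ, isMark (List.replicate e (InputSymbol.bit true)).head? = decide (0 < e) := by
    rintro (_ | e)
    · rfl
    · simp [List.replicate_succ, isMark]
  rw [hm] at hreg
  simp only [SearchState.place]
  split_ifs with he hf
  · subst hf
    refine ⟨by simpa using hreg, ?_⟩
    constructor <;> simp [placeBox, popMark, pushSym, Block.run, h₁, h₂, h₃, h₄, h₅, h₆, h₇, h₈, h₉,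
      unary_cons, unaryTokens_some, List.replicate_succ]
  · obtain ⟨e, rfl⟩ := Nat.exists_eq_add_of_le' (he.resolve_left hf)
    refine ⟨by simpa using hreg, ?_⟩
    simp only [Bool.not_eq_true] at hf
    subst hf
    constructor <;> simp [placeBox, popMark, pushSym, Block.run, h₁, h₂, h₃, h₄, h₅, h₆, h₇, h₈, h₉,
      unary_cons, unaryTokens_some, List.replicate_succ]
  · simp only [not_or, Bool.not_eq_true] at he
    simp [Outcome, hreg, he]

theorem completeRow_runs {s : Store Stk Reg} {x : SearchState} (hx : x.WF) (hpt : x.pt ≠ [])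
    (htd : x.td.tail = []) (hsl : s.stk .sl = unary x.sl.tail) (htd' : s.stk .td = [])
    (hpv : s.stk .pv = []) (hslD : s.stk .slD = unary (x.sl.headI :: x.slD))
    (htdD : s.stk .tdD = unary (x.td.headI :: x.tdD)) (hpvD : s.stk .pvD = unary (x.v :: x.pvD))
    (he : s.stk .e = List.replicate (x.e + x.pv.headI) (.bit true))
    (hpt' : s.stk .pt = unaryTokens x.pt) (hok : s.reg.ok = true) :
    ∃ s', Runs completeRow s s' (14 * x.size + 30) ∧ Outcome s' x.next.endRow := by
  rcases x with ⟨sl, td, pv, slD, tdD, pvD, v, e, pt, first⟩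
  have hw₁ := hx.sl
  have hw₂ := hx.pv
  have hw₃ := hx.slD
  have hw₄ := hx.pvD
  have hw₅ := hx.td
  have hG := hx.pt
  simp only [SearchState.next] at *
  obtain ⟨t, td, rfl⟩ := List.exists_cons_of_ne_nil (hw₅ hpt)
  obtain rfl : td = [] := htd
  obtain ⟨y, sl, rfl⟩ := List.exists_cons_of_length_eq_add_one hw₁
  obtain ⟨g, sl, rfl⟩ := List.exists_cons_of_length_eq_add_one (Nat.succ.inj hw₁)
  obtain rfl : sl = [] := List.length_eq_zero_iff.1 (Nat.succ.inj (Nat.succ.inj hw₁))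
  obtain ⟨q, pv, rfl⟩ := List.exists_cons_of_length_eq_add_one hw₂
  obtain rfl : pv = [] := List.length_eq_zero_iff.1 (Nat.succ.inj hw₂)
  simp only [List.headI_cons, List.tail_cons] at *
  -- An end marker on top of `pt` says that all boxes of the row have been placed. The symbol after
  -- it decides between a new partition, whose separator is consumed, and another row, whose first
  -- symbol is pushed back.
  have hpop : ∃ s₁ : Store Stk Reg, popToken.run s = s₁ ∧ (∀ j, j ≠ .pt → s₁.stk j = s.stk j) ∧
      (match pt with
        | some 0 :: none :: pt => s₁.reg.ok = true ∧ s₁.reg.first = true ∧ s₁.stk .pt = unaryTokens pt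
        | some 0 :: some p :: pt => s₁.reg.ok = true ∧ s₁.reg.first = false ∧
          s₁.stk .pt = unaryTokens (some p :: pt)
        | _ => s₁.reg.ok = false) := by
    refine ⟨_, rfl, ?_, ?_⟩
    · intro j hj
      exact Block.run_frame _ _ _ (by simp [popToken, Block.touches, pushTop, hj])
    · rcases pt with _ | ⟨_ | _ | p, _ | ⟨_ | q, ts⟩⟩
      · exact absurd rfl hpt
      · exact hG.elim
      · exact hG.elim
      · exact hG.elim
      · exact hG.elim
      · simp [popToken, Block.run, pushTop, hpt', unaryTokens, hok]
      · rcases q with _ | q <;>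
          simp [popToken, Block.run, pushTop, hpt', unaryTokens, hok, List.replicate_succ]
      · exact hG.elim
      · change (popToken.run s).reg.ok = false
        simp [popToken, Block.run, pushTop, hpt', unaryTokens, List.replicate_succ, apply_ite,
          Bool.cond_eq_ite]
      · change (popToken.run s).reg.ok = false
        simp [popToken, Block.run, pushTop, hpt', unaryTokens, List.replicate_succ, apply_ite,
          Bool.cond_eq_ite]
  obtain ⟨s₁, hs₁, hf₁, hm⟩ := hpop
  have r₁ : Runs (.act popToken) s s₁ 1 := Runs.act hs₁
  have r₂ := drain_runs .e s₁
  obtain ⟨s₃, r₃, h₃⟩ := restore_runs (s := ⟨{ s₁.reg with top := none }, Function.update s₁.stk .e [],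
    s₁.out⟩) (a := y :: slD) (b := t :: tdD) (c := v :: pvD) (sl := [g]) (td := []) (pv := [])
    (by simp [hw₃]) (by simp [hw₄]) (by simp) (by simp [hf₁, hslD]) (by simp [hf₁, htdD])
    (by simp [hf₁, hpvD]) (by simp [hf₁, hsl]) (by simp [hf₁, htd', unary])
    (by simp [hf₁, hpv, unary])
  have r₄ : Runs (.act (pushSym .pvD .endPart .nop)) s₃ _ 1 := Runs.act rfl
  have hfe := r₃.frame .e rfl
  have hfpt := r₃.frame .pt rfl
  refine ⟨_, (r₁.seq (r₂.seq (r₃.seq r₄))).mono ?_, ?_⟩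
  · simp only [hf₁ .e (by decide), he, SearchState.size, List.length_replicate, List.sum_cons,
      List.length_cons, List.sum_nil, List.length_nil]
    omega
  · rcases pt with _ | ⟨_ | _ | p, _ | ⟨_ | q, ts⟩⟩ <;>
      simp only [SearchState.endRow, Outcome] at hm ⊢
    all_goals first
      | exact absurd rfl hpt
      | exact hG.elim
      | simpa [pushSym, Block.run, h₃] using hm
      | skip
    · refine ⟨by simpa [pushSym, Block.run, h₃] using hm.1, ?_⟩
      constructor <;> simp [pushSym, Block.run, h₃, SearchState.restart, hfe, hfpt, hm, unary]
    · refine ⟨by simpa [pushSym, Block.run, h₃] using hm.1, ?_⟩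
      constructor <;> simp [pushSym, Block.run, h₃, SearchState.restart, hfe, hfpt, hm, unary]

theorem nextRow_runs {s : Store Stk Reg} {x : SearchState} (hx : x.WF) (h : Represents s x)
    (hok : s.reg.ok = true) :
    ∃ s', Runs nextRow s s' (20 * x.size + 50) ∧ Outcome s' x.advance := by
  rcases hpt : x.pt with _ | ⟨p, pt⟩
  · refine ⟨_, ((peek_runs .pt s).seq (Runs.iteTrue (by simp [h.pt, hpt, unaryTokens])
      (Runs.act rfl))).mono (by omega), ?_⟩
    rw [SearchState.advance, if_pos hpt]
    exact ⟨hok, ⟨h.sl, h.td, h.pv, h.slD, h.tdD, h.pvD, h.e, h.pt, h.first⟩⟩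
  have hne : x.pt ≠ [] := by simp [hpt]
  obtain ⟨t, td, htd⟩ := List.exists_cons_of_ne_nil (hx.td hne)
  obtain ⟨y, sl, hsl⟩ := List.exists_cons_of_length_eq_add_one hx.sl
  obtain ⟨q, pv, hpv⟩ := List.exists_cons_of_length_eq_add_one (hx.pv.trans (by rw [htd]; rfl))
  have hhead : (unaryTokens x.pt).head?.isNone = false := by
    rw [hpt]
    rcases p with _ | _ | p <;> simp [unaryTokens, List.replicate_succ]
  have r := Runs.seq (Runs.act (s := ⟨{ s.reg with top := (s.stk .pt).head? }, s.stk, s.out⟩)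
    (b := pushSym .slD .endPart (pushSym .tdD .endPart .nop)) rfl)
    (Runs.seq (moveBits_runs (X := .sl) (Y := .slD) (by decide)
      (List.replicate y (.bit true)) (.endPart :: unary sl) (by
        simp [Block.run, pushSym, h.sl, hsl, unary_cons]) isBit_of_mem_replicate rfl)
    (Runs.seq (moveBits_runs (X := .td) (Y := .tdD) (by decide)
      (List.replicate t (.bit true)) (.endPart :: unary td) (by
        simp [Block.run, pushSym, h.td, htd, unary_cons]) isBit_of_mem_replicate rfl)
    (Runs.seq (moveBits_runs (X := .pv) (Y := .e) (by decide)
      (List.replicate q (.bit true)) (.endPart :: unary pv) (by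
        simp [Block.run, pushSym, h.pv, hpv, unary_cons]) isBit_of_mem_replicate rfl)
      (peek_runs .td _))))
  obtain ⟨s₁, r₁, hr₁, e₁, e₂, e₃, e₄, e₅, e₆⟩ : ∃ s₁, Runs shiftRow
      ⟨{ s.reg with top := (s.stk .pt).head? }, s.stk, s.out⟩ s₁ (2 * (y + t + q) + 8) ∧
      s₁.reg = { s.reg with top := (unary td).head? } ∧ s₁.stk .sl = unary sl ∧
      s₁.stk .td = unary td ∧ s₁.stk .pv = unary pv ∧ s₁.stk .slD = unary (y :: x.slD) ∧
      s₁.stk .tdD = unary (t :: x.tdD) ∧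
      s₁.stk .e = List.replicate (x.e + q) (.bit true) := by
    refine ⟨_, r.mono ?_, ?_⟩
    · simp only [List.length_replicate]
      omega
    · simp [Block.run, pushSym, h.slD, h.tdD, h.e, unary_cons, add_comm x.e]
  have f₁ : s₁.stk .pt = s.stk .pt := r₁.frame .pt rfl
  have f₂ : s₁.stk .pvD = s.stk .pvD := r₁.frame .pvD rfl
  have hsize : y + t + q ≤ x.size := by
    simp only [SearchState.size, hsl, htd, hpv, List.sum_cons]
    omega
  have hite : (s.stk .pt).head?.isNone = false := by rw [h.pt, hhead]
  by_cases htd' : x.td.tail = []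
  · have htd₂ : td = [] := by simpa [htd] using htd'
    subst htd₂
    obtain rfl : pv = [] := by
      have := hx.pv
      rw [htd, hpv] at this
      exact List.length_eq_zero_iff.1 (Nat.succ.inj this)
    obtain ⟨s₂, r₂, h₂⟩ := completeRow_runs hx hne htd' (by simp [e₁, hsl]) e₂ e₃
      (by simp [e₄, hsl]) (by simp [e₅, htd]) (f₂.trans h.pvD) (by simp [e₆, hpv])
      (f₁.trans h.pt) (by simp [hr₁, hok])
    refine ⟨s₂, ((peek_runs .pt s).seq (Runs.iteFalse hite
      (r₁.seq (Runs.iteFalse (by simp [hr₁, unary]) r₂)))).mono (by omega), ?_⟩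
    rwa [SearchState.advance, if_neg hne, if_pos htd']
  · have htd₂ : td ≠ [] := by simpa [htd] using htd'
    have hsome : (unary td).head?.isSome = true := by
      rw [Option.isSome_iff_ne_none, ne_eq, head?_unary]
      exact htd₂
    refine ⟨_, ((peek_runs .pt s).seq (Runs.iteFalse hite
      (r₁.seq (Runs.iteTrue (by simp [hr₁, hsome]) (Runs.act rfl))))).mono (by omega), ?_⟩
    rw [SearchState.advance, if_neg hne, if_neg htd']
    refine ⟨by simp [Block.run, pushSym, hr₁, hok], ?_⟩
    constructor <;> simp [Block.run, pushSym, SearchState.next, hsl, htd, hpv, e₁, e₂, e₃, e₄, e₅, e₆,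
      f₁, f₂, h.pt, h.pvD, hr₁, h.first]
    simp [unary_cons]

theorem searchStep_runs {s : Store Stk Reg} {x : SearchState} (hx : x.WF) (h : Represents s x)
    (hok : s.reg.ok = true) {b : Bool} (hb : s.reg.top = some (.bit b)) :
    ∃ s', Runs searchStep s s' (20 * x.size + 51) ∧ Outcome s' (x.step b) := by
  rcases b with _ | _
  · obtain ⟨s', r, h'⟩ := nextRow_runs hx h hok
    exact ⟨s', (Runs.iteFalse (by rw [hb]; rfl) r).mono (by omega), h'⟩
  · exact ⟨_, (Runs.iteTrue (by rw [hb]; rfl) (Runs.act rfl)).mono (by omega),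
      placeBox_runs hx h hok⟩

end StackProg

/-! ### Counting the successful decisions -/

namespace StackProg

open GelfandTsetlin

/-- Try the decisions on the stack `gw`. -/
def verify : StackProg Stk Reg :=
  .act (popTop .gw .nop) ;;
    .loop (fun r => r.top.isSome && r.ok) (searchStep ;; .act (popTop .gw .nop))

theorem unaryTokens_eq_nil {l : List (Option ℕ)} : unaryTokens l = [] ↔ l = [] := by
  rcases l with _ | ⟨_ | p, l⟩ <;> simp [unaryTokens]

/-- The loop stops at the first failing decision with the rest of the word unread: no continuation
of a failing word is accepted. The bound per decision stays valid because `size` does not grow. -/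
theorem verify_loop_runs (w : List Bool) : ∀ {s : Store Stk Reg} {x : SearchState}, x.WF →
    Represents s x → s.reg.ok = true → s.reg.top = (w.map .bit).head? →
    s.stk .gw = (w.map .bit).tail →
    ∃ s', Runs (.loop (fun r => r.top.isSome && r.ok) (searchStep ;; .act (popTop .gw .nop))) s s'
      ((20 * x.size + 53) * w.length + 1) ∧
      ((s'.reg.ok && (s'.stk .pt).isEmpty) = true ↔ x.Accepts w) := by
  induction w with
  | nil =>
    intro s x hx h hok htop hgw
    refine ⟨s, Runs.loopFalse (by rw [htop]; rfl), ?_⟩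
    rw [hok, Bool.true_and, List.isEmpty_iff, h.pt, unaryTokens_eq_nil, SearchState.Accepts]
  | cons b w ih =>
    intro s x hx h hok htop hgw
    obtain ⟨s₁, r₁, h₁⟩ := searchStep_runs hx h hok (b := b) htop
    have hgw₁ : s₁.stk .gw = w.map .bit := (r₁.frame .gw rfl).trans hgw
    have r₂ : Runs (.act (popTop .gw .nop)) s₁
      ⟨{ s₁.reg with top := (w.map .bit).head? },
        Function.update s₁.stk .gw (w.map InputSymbol.bit).tail, s₁.out⟩ 1 :=
      Runs.act (by rw [← hgw₁]; rfl)
    have hc : (s.reg.top.isSome && s.reg.ok) = true := by rw [htop, hok]; rfl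
    rcases hst : x.step b with _ | y
    · rw [hst] at h₁
      refine ⟨_, (Runs.loopTrue hc (r₁.seq r₂) (Runs.loopFalse ?_)).mono ?_, ?_⟩
      · simp only [show s₁.reg.ok = false from h₁, Bool.and_false]
      · rw [List.length_cons, Nat.mul_succ]
        generalize (20 * x.size + 53) * w.length = z
        omega
      · simp only [show s₁.reg.ok = false from h₁, Bool.false_and, Bool.false_eq_true, false_iff,
          SearchState.Accepts, hst]
        simp
    · rw [hst] at h₁
      obtain ⟨hy, hsize⟩ := hx.step hst
      obtain ⟨s', r', h'⟩ := ih (s := ⟨{ s₁.reg with top := (w.map .bit).head? },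
        Function.update s₁.stk .gw (w.map InputSymbol.bit).tail, s₁.out⟩) hy
        ⟨h₁.2.1, h₁.2.2, h₁.2.3, h₁.2.4, h₁.2.5, h₁.2.6, h₁.2.7, h₁.2.8, h₁.2.9⟩ h₁.1 rfl
        (by simp)
      refine ⟨s', (Runs.loopTrue hc (r₁.seq r₂) r').mono ?_, ?_⟩
      · have : (20 * y.size + 53) * w.length ≤ (20 * x.size + 53) * w.length :=
          Nat.mul_le_mul_right _ (by omega)
        rw [List.length_cons, Nat.mul_succ]
        omega
      · rw [h', SearchState.Accepts, hst]
        simp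

theorem verify_runs (w : List Bool) {s : Store Stk Reg} {x : SearchState} (hx : x.WF)
    (h : Represents s x) (hok : s.reg.ok = true) (hgw : s.stk .gw = w.map .bit) :
    ∃ s', Runs verify s s' ((20 * x.size + 53) * w.length + 2) ∧
      ((s'.reg.ok && (s'.stk .pt).isEmpty) = true ↔ x.Accepts w) := by
  have r : Runs (.act (popTop .gw .nop)) s
      ⟨{ s.reg with top := (w.map .bit).head? },
        Function.update s.stk .gw (w.map InputSymbol.bit).tail, s.out⟩ 1 :=
      Runs.act (by rw [← hgw]; rfl)
  obtain ⟨s', r', h'⟩ := verify_loop_runs w (s := ⟨{ s.reg with top := (w.map .bit).head? },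
        Function.update s.stk .gw (w.map InputSymbol.bit).tail, s.out⟩) hx
    ⟨h.1, h.2, h.3, h.4, h.5, h.6, h.7, h.8, h.9⟩ hok rfl (by simp)
  exact ⟨s', (r.seq r').mono (by omega), h'⟩

/-- Set up a trial. -/
def setup : StackProg Stk Reg :=
  copy .slM .sl ;; copy .tdM .td ;; copy .tdM .pv ;; copy .ptM .pt ;; copy .guess .gw ;;
    .act (.load (fun r => { r with ok := true, first := true }) (pushSym .pvD .endPart .nop))

/-- Count a success. -/
def count : StackProg Stk Reg :=
  .act (popTop .pt (.load (fun r => { r with ok := r.ok && r.top.isNone }) .nop)) ;;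
    .ite (fun r => r.ok) (incr .cnt) (.act .nop)

/-- Empty the stacks used in a trial. -/
def clean : StackProg Stk Reg :=
  drain .sl ;; drain .td ;; drain .pv ;; drain .slD ;; drain .tdD ;; drain .pvD ;; drain .e ;;
    drain .pt ;; drain .gw

/-- The stacks used in a trial. -/
def isWork : Stk → Bool
  | .sl | .td | .pv | .slD | .tdD | .pvD | .e | .pt | .gw => true
  | _ => false

theorem clean_runs {s : Store Stk Reg} {B : ℕ} (hB : ∀ j, isWork j = true → (s.stk j).length ≤ B) :
    ∃ s', Runs clean s s' (18 * B + 18) ∧ (∀ j, isWork j = true → s'.stk j = []) := by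
  refine ⟨_, (Runs.seq (drain_runs .sl s) (Runs.seq (drain_runs .td _) (Runs.seq (drain_runs .pv _)
    (Runs.seq (drain_runs .slD _) (Runs.seq (drain_runs .tdD _) (Runs.seq (drain_runs .pvD _)
    (Runs.seq (drain_runs .e _) (Runs.seq (drain_runs .pt _) (drain_runs .gw _))))))))).mono ?_, ?_⟩
  · have h₁ := hB .sl rfl
    have h₂ := hB .td rfl
    have h₃ := hB .pv rfl
    have h₄ := hB .slD rfl
    have h₅ := hB .tdD rfl
    have h₆ := hB .pvD rfl
    have h₇ := hB .e rfl
    have h₈ := hB .pt rfl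
    have h₉ := hB .gw rfl
    simp
    omega
  · intro j hj
    cases j <;> simp [isWork] at hj ⊢

/-- The state between two trials: `g` is the next list of decisions, `n` the number of successes. -/
structure Ready (sl td : List ℕ) (ts : List (Option ℕ)) (g : List Bool) (n : ℕ)
    (s : Store Stk Reg) : Prop where
  slM : s.stk .slM = unary sl
  tdM : s.stk .tdM = unary td
  ptM : s.stk .ptM = unaryTokens ts
  guess : s.stk .guess = g.map .bit
  cnt : s.stk .cnt = n.bits.map .bit
  tmp : s.stk .tmp = []
  work : ∀ j, isWork j = true → s.stk j = []
  out : s.out = []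

/-- A trial. -/
def trial : StackProg Stk Reg := setup ;; verify ;; count ;; clean ;; incr .guess

theorem length_unary (l : List ℕ) : (unary l).length = l.sum + l.length := by
  induction l with
  | nil => rfl
  | cons n l ih => simp [unary_cons, ih]; omega

theorem length_unaryTokens (l : List (Option ℕ)) :
    (unaryTokens l).length = tokenSum l + l.length := by
  induction l with
  | nil => rfl
  | cons n l ih =>
    rcases n with _ | n
    · simp [unaryTokens_none, ih, tokenSum]; omega
    · simp [unaryTokens_some, ih, tokenSum]; omega

theorem setup_runs {sl td : List ℕ} {ts : List (Option ℕ)} {g : List Bool} {n : ℕ}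
    {s : Store Stk Reg} (h : Ready sl td ts g n s) :
    ∃ s', Runs setup s s' (8 * (SearchState.start sl td td ts true).size + 4 * g.length + 21) ∧
      Represents s' (SearchState.start sl td td ts true) ∧ s'.reg.ok = true ∧
      s'.stk .gw = g.map .bit ∧ s'.stk .slM = unary sl ∧ s'.stk .tdM = unary td ∧
      s'.stk .ptM = unaryTokens ts ∧ s'.stk .guess = g.map .bit ∧ s'.stk .tmp = [] := by
  have hw := h.work
  refine ⟨_, (Runs.seq (copy_runs (X := .slM) (Y := .sl) (s := s) (by decide) (by decide) (by decide)
    (by simp [h.tmp]) (by simp [hw .sl rfl]))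
    (Runs.seq (copy_runs (X := .tdM) (Y := .td) (by decide) (by decide) (by decide)
    (by simp [h.tmp]) (by simp [hw .td rfl]))
    (Runs.seq (copy_runs (X := .tdM) (Y := .pv) (by decide) (by decide) (by decide)
    (by simp [h.tmp]) (by simp [hw .pv rfl]))
    (Runs.seq (copy_runs (X := .ptM) (Y := .pt) (by decide) (by decide) (by decide)
    (by simp [h.tmp]) (by simp [hw .pt rfl]))
    (Runs.seq (copy_runs (X := .guess) (Y := .gw) (by decide) (by decide) (by decide)
    (by simp [h.tmp]) (by simp [hw .gw rfl])) (Runs.act rfl)))))).mono ?_, ?_, ?_⟩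
  · simp [h.slM, h.tdM, h.ptM, h.guess, length_unary, length_unaryTokens, SearchState.size,
      SearchState.start, tokenSum]
    omega
  · constructor <;> simp [Block.run, pushSym, SearchState.start, h.slM, h.tdM, h.ptM, h.guess,
      hw .pvD rfl, hw .slD rfl, hw .tdD rfl, hw .e rfl, unary]
  · simp [Block.run, pushSym, h.slM, h.tdM, h.ptM, h.guess, h.tmp]


theorem count_runs {s : Store Stk Reg} {n : ℕ} (hcnt : s.stk .cnt = n.bits.map .bit)
    (htmp : s.stk .tmp = []) :
    ∃ s', Runs count s s' (4 * n.bits.length + 7) ∧ s'.stk .tmp = [] ∧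
      s'.stk .cnt = (if (s.reg.ok && (s.stk .pt).isEmpty) = true then n + 1 else n).bits.map .bit ∧
      ∀ j, isWork j = true → (s'.stk j).length ≤ (s.stk j).length := by
  have r₁ : Runs (.act (popTop .pt (.load (fun r => { r with ok := r.ok && r.top.isNone }) .nop))) s
      ⟨{ s.reg with top := (s.stk .pt).head?, ok := s.reg.ok && (s.stk .pt).head?.isNone },
        Function.update s.stk .pt (s.stk .pt).tail, s.out⟩ 1 := Runs.act rfl
  have he : (s.stk .pt).head?.isNone = (s.stk .pt).isEmpty := by rcases s.stk .pt with _ | _ <;> rfl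
  have hpt : ∀ j, (Function.update s.stk .pt (s.stk .pt).tail j).length ≤ (s.stk j).length := by
    intro j
    by_cases hj : j = .pt
    · subst hj; simp
    · simp [hj]
  rw [he] at r₁
  by_cases hacc : (s.reg.ok && (s.stk .pt).isEmpty) = true
  · refine ⟨_, (r₁.seq (Runs.iteTrue hacc (incr_runs (X := .cnt) (by decide) (by simp [htmp]) n.bits
      (by simp [hcnt])))).mono (by omega), by simp [htmp], ?_, ?_⟩
    · rw [if_pos hacc, ← succDigits_bits]
      simp
    · intro j hj
      have : j ≠ .cnt := by rintro rfl; simp [isWork] at hj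
      simpa [this] using hpt j
  · refine ⟨_, (r₁.seq (Runs.iteFalse (by simpa using hacc) (Runs.act rfl))).mono (by omega),
      by simp [Block.run, htmp], ?_, ?_⟩
    · rw [if_neg hacc]
      simp [Block.run, hcnt]
    · intro j hj
      exact hpt j

open Classical in
theorem trial_runs {sl td : List ℕ} {ts : List (Option ℕ)} {g : List Bool} {n : ℕ}
    {s : Store Stk Reg} (h : Ready sl td ts g n s) (hn : n.bits.length ≤ g.length + 1)
    (hx : (SearchState.start sl td td ts true).WF) {z : ℕ}
    (hz : (SearchState.start sl td td ts true).size ≤ z) :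
    ∃ s', Runs trial s s' (50000 * ((z + 1) * (g.length + 1))) ∧
      Ready sl td ts (succDigits g)
        (if (SearchState.start sl td td ts true).Accepts g then n + 1 else n) s' ∧
      s'.reg.c = g.all id := by
  set x := SearchState.start sl td td ts true with hxd
  obtain ⟨s₁, r₁, hrep, hok, hgw, hslM, htdM, hptM, hguess, htmp₁⟩ := setup_runs h
  obtain ⟨s₂, r₂, hacc⟩ := verify_runs g hx hrep hok hgw
  rw [← hxd] at r₁
  have htmp₂ : s₂.stk .tmp = [] := (r₂.frame .tmp rfl).trans htmp₁
  have hcnt₂ : s₂.stk .cnt = n.bits.map .bit := by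
    rw [r₂.frame .cnt rfl, r₁.frame .cnt rfl, h.cnt]
  obtain ⟨s₃, r₃, htmp₃, hcnt₃, hlen₃⟩ := count_runs hcnt₂ htmp₂
  have hlen₁ : ∀ j, isWork j = true → (s₁.stk j).length ≤ z + g.length + 1 := by
    intro j hj
    cases j <;> simp only [isWork, Bool.false_eq_true] at hj <;>
      simp only [hrep.1, hrep.2, hrep.3, hrep.4, hrep.5, hrep.6, hrep.7, hrep.8, hgw, length_unary,
        length_unaryTokens, List.length_map, List.length_replicate, hxd, SearchState.start,
        SearchState.size, List.sum_cons, List.length_cons, tokenSum, List.sum_nil,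
        List.length_nil] at hz ⊢ <;>
      omega
  -- After a failed trial the stacks are only known to be bounded through the running time; `40`
  -- bounds the number of pushes of `verify` per step.
  have hlen₂ : ∀ j, isWork j = true → (s₂.stk j).length ≤
      z + g.length + 1 + 40 * ((20 * x.size + 53) * g.length + 2) := fun j hj =>
    (r₂.length_le j).trans (add_le_add (hlen₁ j hj) (Nat.mul_le_mul_right _ (by decide)))
  obtain ⟨s₄, r₄, hwork₄⟩ := clean_runs (fun j hj => (hlen₃ j hj).trans (hlen₂ j hj))
  have htmp₄ : s₄.stk .tmp = [] := (r₄.frame .tmp rfl).trans htmp₃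
  have hguess₄ : s₄.stk .guess = g.map .bit := by
    rw [r₄.frame .guess rfl, r₃.frame .guess rfl, r₂.frame .guess rfl, hguess]
  have r₅ := incr_runs (X := .guess) (by decide) htmp₄ g hguess₄
  refine ⟨_, (r₁.seq (r₂.seq (r₃.seq (r₄.seq r₅)))).mono ?_, ⟨?_, ?_, ?_, ?_, ?_, ?_, ?_, ?_⟩, rfl⟩
  · have h₁ : (20 * x.size + 53) * g.length ≤ (20 * z + 53) * g.length :=
      Nat.mul_le_mul_right _ (by omega)
    have h₂ : (20 * z + 53) * g.length = 20 * (z * g.length) + 53 * g.length := by ring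
    have h₃ : (z + 1) * (g.length + 1) = z * g.length + z + g.length + 1 := by ring
    rw [h₂] at h₁
    rw [h₃]
    generalize (20 * x.size + 53) * g.length = a at *
    generalize z * g.length = b at *
    omega
  · simp [r₄.frame .slM rfl, r₃.frame .slM rfl, r₂.frame .slM rfl, hslM]
  · simp [r₄.frame .tdM rfl, r₃.frame .tdM rfl, r₂.frame .tdM rfl, htdM]
  · simp [r₄.frame .ptM rfl, r₃.frame .ptM rfl, r₂.frame .ptM rfl, hptM]
  · simp
  · simp only [ne_eq, reduceCtorEq, not_false_eq_true, Function.update_of_ne,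
      r₄.frame .cnt rfl, hcnt₃, hacc]
  · simp [htmp₄]
  · intro j hj
    have : j ≠ .guess := by rintro rfl; simp [isWork] at hj
    simp [this, hwork₄ j hj]
  · simp [r₄.frame_out rfl, r₃.frame_out rfl, r₂.frame_out rfl, r₁.frame_out rfl, h.out]

/-! ### Enumeration of all words -/

/-- The number of successful lists of `L` decisions which have been tried before the list with
number `m`. -/
noncomputable def successes (x : SearchState) (L m : ℕ) : ℕ :=
  Set.ncard {w : List Bool | w.length = L ∧ x.Accepts w ∧ digitsVal w < m}

theorem finite_successes (x : SearchState) (L m : ℕ) :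
    {w : List Bool | w.length = L ∧ x.Accepts w ∧ digitsVal w < m}.Finite :=
  (List.finite_length_eq Bool L).subset fun _ hw => hw.1

-- Words of the same length are determined by their binary value, so raising the bound by one admits
-- the word `g` only.
open Classical in
theorem successes_succ (x : SearchState) (g : List Bool) :
    successes x g.length (digitsVal g + 1) =
      if x.Accepts g then successes x g.length (digitsVal g) + 1
      else successes x g.length (digitsVal g) := by
  split_ifs with h
  · rw [successes, successes, ← Set.ncard_insert_of_notMem (a := g) (by simp)
      (finite_successes x _ _)]
    congr 1
    ext w
    simp only [Set.mem_ofPred_eq, Set.mem_insert_iff]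
    constructor
    · rintro ⟨h₁, h₂, h₃⟩
      by_cases hw : digitsVal w = digitsVal g
      · exact Or.inl (digitsVal_injective h₁ hw)
      · exact Or.inr ⟨h₁, h₂, by omega⟩
    · rintro (rfl | ⟨h₁, h₂, h₃⟩)
      · exact ⟨rfl, h, by omega⟩
      · exact ⟨h₁, h₂, by omega⟩
  · rw [successes, successes]
    congr 1
    ext w
    simp only [Set.mem_ofPred_eq]
    constructor
    · rintro ⟨h₁, h₂, h₃⟩
      refine ⟨h₁, h₂, lt_of_le_of_ne (by omega) fun hw => h ?_⟩
      rwa [← digitsVal_injective h₁ hw]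
    · rintro ⟨h₁, h₂, h₃⟩
      exact ⟨h₁, h₂, by omega⟩

theorem successes_le (x : SearchState) (L m : ℕ) : successes x L m ≤ 2 ^ L := by
  have : successes x L m ≤ (Finset.range (2 ^ L)).card := by
    rw [← Set.ncard_coe_finset]
    refine Set.ncard_le_ncard_of_injOn digitsVal ?_ ?_ (Finset.finite_toSet _)
    · rintro w ⟨rfl, -, -⟩
      simpa using digitsVal_lt w
    · rintro w ⟨h, -, -⟩ w' ⟨h', -, -⟩ hw
      exact digitsVal_injective (h.trans h'.symm) hw
  simpa using this

theorem length_bits_le {n L : ℕ} (h : n ≤ 2 ^ L) : n.bits.length ≤ L + 1 := by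
  rw [Nat.size_eq_bits_len, Nat.size_le]
  exact h.trans_lt (Nat.pow_lt_pow_right (by decide) (Nat.lt_succ_self L))

/-- Try all lists of decisions. -/
def tryAll : StackProg Stk Reg :=
  .act (.load (fun r => { r with c := false }) .nop) ;; .loop (fun r => !r.c) trial

/-- The number of words after the present one is `r`. The loop ends when the increment of the
all-`true` word overflows; as this adds a digit, the final guess is left unspecified. -/
theorem tryAll_loop_runs {sl td : List ℕ} {ts : List (Option ℕ)}
    (hx : (SearchState.start sl td td ts true).WF) {z L : ℕ}
    (hz : (SearchState.start sl td td ts true).size ≤ z) (r : ℕ) : ∀ {g : List Bool}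
    {s : Store Stk Reg}, g.length = L → digitsVal g + r + 1 = 2 ^ L →
    Ready sl td ts g (successes (SearchState.start sl td td ts true) L (digitsVal g)) s →
    s.reg.c = false →
    ∃ s', Runs (.loop (fun r => !r.c) trial) s s'
        ((50000 * ((z + 1) * (L + 1)) + 1) * (r + 1) + 1) ∧
      ∃ g', Ready sl td ts g' (successes (SearchState.start sl td td ts true) L (2 ^ L)) s' := by
  induction r with
  | zero =>
    intro g s hg hr h hc
    subst hg
    obtain ⟨s₁, r₁, h₁, hc₁⟩ := trial_runs h (length_bits_le (successes_le _ _ _)) hx hz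
    have hall : g.all id = true := by
      by_contra hne
      have h₂ := length_succDigits (by simpa using hne)
      have h₃ := digitsVal_succDigits g
      have h₄ := digitsVal_lt (succDigits g)
      rw [h₂] at h₄
      omega
    refine ⟨s₁, (Runs.loopTrue (by rw [hc]; rfl) r₁ (Runs.loopFalse (by rw [hc₁, hall]; rfl))).mono
      (by omega), succDigits g, ?_⟩
    rwa [← successes_succ, show digitsVal g + 1 = 2 ^ g.length from hr] at h₁
  | succ r ih =>
    intro g s hg hr h hc
    subst hg
    obtain ⟨s₁, r₁, h₁, hc₁⟩ := trial_runs h (length_bits_le (successes_le _ _ _)) hx hz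
    have hall : g.all id = false := by
      by_contra hne
      have h₂ := digitsVal_of_all (by simpa using hne : g.all id = true)
      omega
    rw [← successes_succ, ← digitsVal_succDigits] at h₁
    obtain ⟨s', r', h'⟩ := ih (length_succDigits hall) (by rw [digitsVal_succDigits]; omega) h₁
      (by rw [hc₁, hall])
    refine ⟨s', (Runs.loopTrue (by rw [hc]; rfl) r₁ r').mono ?_, h'⟩
    rw [Nat.mul_succ _ (r + 1)]
    omega

/-- Write the number of successes to the output. -/
def output : StackProg Stk Reg :=
  move .cnt .tmp ;; .act (popTop .tmp .nop) ;;
    .loop (fun r => r.top.isSome)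
      (.act (.pushOut (fun r => isMark r.top) (popTop .tmp .nop)))

theorem output_loop_runs (l : List Bool) : ∀ {s : Store Stk Reg},
    s.reg.top = (l.map InputSymbol.bit).head? → s.stk .tmp = (l.map InputSymbol.bit).tail →
    ∃ s', Runs (.loop (fun r => r.top.isSome)
      (.act (.pushOut (fun r => isMark r.top) (popTop .tmp .nop)))) s s' (2 * l.length + 1) ∧
      s'.out = l.reverse ++ s.out := by
  induction l with
  | nil =>
    intro s h₁ h₂
    exact ⟨s, Runs.loopFalse (by rw [h₁]; rfl), rfl⟩
  | cons b l ih =>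
    intro s h₁ h₂
    simp only [List.map_cons, List.head?_cons, List.tail_cons] at h₁ h₂
    obtain ⟨s', r', h'⟩ := ih (s := Block.run (.pushOut (fun r => isMark r.top) (popTop .tmp .nop)) s)
      (by simp [Block.run, popTop, h₂]) (by simp [Block.run, popTop, h₂])
    refine ⟨s', (Runs.loopTrue (by rw [h₁]; rfl) (Runs.act rfl) r').mono ?_, ?_⟩
    · rw [List.length_cons]
      omega
    · rw [h']
      cases b <;> simp [Block.run, popTop, h₁, isMark]

/-- The digits are reversed on the way to `tmp` and again on the way to the output, so the least
significant one is on top. -/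
theorem output_runs (l : List Bool) {s : Store Stk Reg} (htmp : s.stk .tmp = [])
    (hcnt : s.stk .cnt = l.map .bit) (hout : s.out = []) :
    ∃ s', Runs output s s' (4 * l.length + 4) ∧ s'.out = l := by
  have r₁ := move_runs (X := .cnt) (Y := .tmp) (by decide) s
  obtain ⟨s', r', h'⟩ := output_loop_runs l.reverse (s := Block.run (popTop .tmp .nop)
    ⟨{ s.reg with top := none }, Function.update (Function.update s.stk .cnt []) .tmp
      ((s.stk .cnt).reverse ++ s.stk .tmp), s.out⟩)
    (by simp [Block.run, popTop, htmp, hcnt]) (by simp [Block.run, popTop, htmp, hcnt])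
  refine ⟨s', (r₁.seq ((Runs.act rfl).seq r')).mono ?_, ?_⟩
  · simp [hcnt]
    omega
  · simpa [Block.run, popTop, hout] using h'

theorem digitsVal_replicate (L : ℕ) : digitsVal (List.replicate L false) = 0 := by
  induction L with
  | zero => rfl
  | succ L ih => rw [List.replicate_succ, digitsVal_cons, ih]; rfl

theorem tryAll_runs {sl td : List ℕ} {ts : List (Option ℕ)}
    (hx : (SearchState.start sl td td ts true).WF) {z L : ℕ}
    (hz : (SearchState.start sl td td ts true).size ≤ z) {s : Store Stk Reg}
    (h : Ready sl td ts (List.replicate L false) 0 s) :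
    ∃ s', Runs (tryAll ;; output) s s' (100000 * ((z + 1) * (L + 1)) * 2 ^ L + 100) ∧
      s'.out = (Nat.card {w : List Bool // w.length = L ∧
        (SearchState.start sl td td ts true).Accepts w}).bits := by
  have hval := digitsVal_replicate L
  have hzero : successes (SearchState.start sl td td ts true) L 0 = 0 := by
    simp [successes]
  have hall : successes (SearchState.start sl td td ts true) L (2 ^ L) =
      Nat.card {w : List Bool // w.length = L ∧
        (SearchState.start sl td td ts true).Accepts w} := by
    rw [successes, ← Nat.card_coe_set_eq]
    refine Nat.card_congr (Equiv.subtypeEquivRight fun w => ?_)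
    constructor
    · rintro ⟨h₁, h₂, -⟩
      exact ⟨h₁, h₂⟩
    · rintro ⟨rfl, h₂⟩
      exact ⟨rfl, h₂, digitsVal_lt w⟩
  have hpos := Nat.one_le_two_pow (n := L)
  obtain ⟨s₁, r₁, g', h₁⟩ := tryAll_loop_runs hx hz (2 ^ L - 1) (L := L) (s := ⟨{ s.reg with c := false },
    s.stk, s.out⟩) (g := List.replicate L false) (by simp) (by omega)
    (by rw [hval, hzero]; exact ⟨h.1, h.2, h.3, h.4, h.5, h.6, h.7, h.8⟩) rfl
  obtain ⟨s', r', h'⟩ := output_runs _ h₁.tmp h₁.cnt h₁.out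
  refine ⟨s', (((Runs.act rfl).seq r₁).seq r').mono ?_, by rw [h', hall]⟩
  have h₂ := length_bits_le (successes_le (SearchState.start sl td td ts true) L (2 ^ L))
  have h₃ : 2 ^ L - 1 + 1 = 2 ^ L := by omega
  rw [h₃]
  have h₄ : L + 1 ≤ (z + 1) * (L + 1) := Nat.le_mul_of_pos_left _ (by omega)
  have h₅ : (z + 1) * (L + 1) ≤ (z + 1) * (L + 1) * 2 ^ L := Nat.le_mul_of_pos_right _ (by omega)
  have h₆ : (50000 * ((z + 1) * (L + 1)) + 1) * 2 ^ L =
    50000 * ((z + 1) * (L + 1) * 2 ^ L) + 2 ^ L := by ring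
  have h₇ : 2 ^ L ≤ (z + 1) * (L + 1) * 2 ^ L := Nat.le_mul_of_pos_left _ (by positivity)
  rw [h₆, mul_assoc 100000]
  omega

end StackProg

/-! ### Subtraction of partitions, in binary -/

namespace StackProg

/-- The borrow of a digit of a difference. -/
def borrow (x y c : Bool) : Bool := (!x && (y || c)) || (y && c)

/-- The digits of a difference. -/
def subDigits : Bool → List Bool → List Bool → List Bool
  | _, [], _ => []
  | c, x :: xs, ys =>
    (x ^^ (ys.headD false ^^ c)) :: subDigits (borrow x (ys.headD false) c) xs ys.tail

/-- The last borrow of a difference. -/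
def subBorrow : Bool → List Bool → List Bool → Bool
  | c, [], _ => c
  | c, x :: xs, ys => subBorrow (borrow x (ys.headD false) c) xs ys.tail

theorem length_subDigits (c : Bool) (xs ys : List Bool) :
    (subDigits c xs ys).length = xs.length := by
  induction xs generalizing c ys with
  | nil => rfl
  | cons x xs ih => rw [subDigits, List.length_cons, ih, List.length_cons]

/-- Schoolbook subtraction, with the final borrow counted as `2 ^ xs.length`. The identity also
covers negative differences, where the digits wrap around. -/
theorem digitsVal_subDigits (c : Bool) (xs ys : List Bool) (h : ys.length ≤ xs.length) :
    digitsVal xs + 2 ^ xs.length * (subBorrow c xs ys).toNat =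
      digitsVal (subDigits c xs ys) + digitsVal ys + c.toNat := by
  induction xs generalizing c ys with
  | nil =>
    rw [List.length_eq_zero_iff.1 (Nat.le_zero.1 h)]
    simp [digitsVal, subBorrow, subDigits]
  | cons x xs ih =>
    have hy : digitsVal ys = (ys.headD false).toNat + 2 * digitsVal ys.tail := by
      rcases ys with _ | ⟨y, ys⟩ <;> rfl
    have := ih (borrow x (ys.headD false) c) ys.tail (by simpa using h)
    rw [subDigits, subBorrow, digitsVal_cons, digitsVal_cons, hy, List.length_cons, pow_succ]
    generalize ys.headD false = y at *
    have h₁ : (x ^^ (y ^^ c)).toNat + y.toNat + c.toNat = x.toNat + 2 * (borrow x y c).toNat := by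
      cases x <;> cases y <;> cases c <;> rfl
    have h₂ : 2 ^ xs.length * 2 * (subBorrow (borrow x y c) xs ys.tail).toNat =
      2 * (2 ^ xs.length * (subBorrow (borrow x y c) xs ys.tail).toNat) := by ring
    omega

/-- `Nat.bits` has no leading zeros, so a smaller number is not longer, and among numbers that are
not longer the final borrow decides. -/
theorem le_iff_subBorrow (p q : ℕ) :
    (q.bits.length ≤ p.bits.length ∧ subBorrow false p.bits q.bits = false) ↔ q ≤ p := by
  constructor
  · rintro ⟨h₁, h₂⟩
    have := digitsVal_subDigits false p.bits q.bits h₁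
    rw [h₂, digitsVal_bits, digitsVal_bits, Bool.toNat_false] at this
    omega
  · intro h
    have h₁ : q.bits.length ≤ p.bits.length := by
      rw [Nat.size_eq_bits_len, Nat.size_eq_bits_len]
      exact Nat.size_le_size h
    refine ⟨h₁, ?_⟩
    have h₂ := digitsVal_subDigits false p.bits q.bits h₁
    have h₃ := digitsVal_lt (subDigits false p.bits q.bits)
    rw [length_subDigits] at h₃
    rw [digitsVal_bits, digitsVal_bits] at h₂
    cases hb : subBorrow false p.bits q.bits
    · rfl
    · rw [hb, Bool.toNat_true, Bool.toNat_false] at h₂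
      omega

theorem digitsVal_sub {p q : ℕ} (h : q ≤ p) : digitsVal (subDigits false p.bits q.bits) = p - q := by
  obtain ⟨h₁, h₂⟩ := (le_iff_subBorrow p q).2 h
  have := digitsVal_subDigits false p.bits q.bits h₁
  rw [h₂, digitsVal_bits, digitsVal_bits, Bool.toNat_false] at this
  omega

/-- Subtract a digit of `inp` and a digit of `old` from the digit which has been popped. -/
def subDigit : Block Stk Reg :=
  .pop .inp (fun r a => { r with aux := a }) (
    .branch (fun r => isBit r.aux) (.push .new (fun r => r.aux.getD .endPart) k)
      (.push .inp (fun r => r.aux.getD .endPart) k))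
where k : Block Stk Reg :=
  .pop .old (fun r a => { r with aux' := a }) (
    .push .dif (fun r => .bit (isMark r.top ^^ (isMark r.aux ^^ r.c))) (
    .push .low (fun r => .bit (isMark r.top ^^ (isMark r.aux' ^^ r.d))) (
    .load (fun r => { r with
      c := borrow (isMark r.top) (isMark r.aux) r.c, d := borrow (isMark r.top) (isMark r.aux') r.d })
    (popTop .lam .nop))))

/-- Complete the subtraction of a part. -/
def subEnd : Block Stk Reg :=
  .pop .inp (fun r a => { r with aux := a }) (
    .branch (fun r => decide (r.aux = some .endPart)) k (
      .branch (fun r => decide (r.aux = some .endPartition)) (pushSym .inp .endPartition k)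
        (.load (fun r => { r with ok := false }) k)))
where k : Block Stk Reg :=
  .load (fun r => { r with ok := r.ok && !r.c }) (
    pushSym .dif .endPart (
    .pop .old (fun r a => { r with aux' := a }) (
    .push .low (fun r => if r.aux'.isNone && !r.d && !r.flag then .endPart else .endPartition) (
    .load (fun r => { r with flag := false }) .nop))))

/-- Subtract a part of `inp` and a part of `old` from a part of `lam`. -/
def subPart : StackProg Stk Reg :=
  .act (.load (fun r => { r with c := false, d := false }) (popTop .lam .nop)) ;;
    .loop (fun r => isBit r.top) (.act subDigit) ;; .act subEnd ;; drain .old ;; move .new .old ;;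
    .act (peek .lam)

theorem subDigits_loop_runs (xs : List Bool) : ∀ {ys zs : List Bool} {s : Store Stk Reg}
    {rest I : List InputSymbol}, I ≠ [] → isBit I.head? = false →
    s.reg.top = (xs.map InputSymbol.bit ++ InputSymbol.endPart :: rest).head? →
    s.stk .lam = (xs.map InputSymbol.bit ++ .endPart :: rest).tail →
    s.stk .inp = ys.map .bit ++ I → s.stk .old = zs.map .bit →
    ∃ s', Runs (.loop (fun r => isBit r.top) (.act subDigit)) s s' (2 * xs.length + 1) ∧
      s'.reg.top = some .endPart ∧ s'.stk .lam = rest ∧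
      s'.stk .inp = (ys.drop xs.length).map .bit ++ I ∧
      s'.stk .old = (zs.drop xs.length).map .bit ∧
      s'.stk .new = (ys.take xs.length).reverse.map .bit ++ s.stk .new ∧
      s'.stk .dif = (subDigits s.reg.c xs ys).reverse.map .bit ++ s.stk .dif ∧
      s'.stk .low = (subDigits s.reg.d xs zs).reverse.map .bit ++ s.stk .low ∧
      s'.reg.c = subBorrow s.reg.c xs ys ∧ s'.reg.d = subBorrow s.reg.d xs zs ∧
      s'.reg.ok = s.reg.ok ∧ s'.reg.flag = s.reg.flag := by
  induction xs with
  | nil =>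
    intro ys zs s rest I hI hI' htop hlam hinp hold
    refine ⟨s, Runs.loopFalse (by rw [htop]; rfl), htop, hlam, ?_⟩
    simp [hinp, hold, subDigits, subBorrow]
  | cons x xs ih =>
    intro ys zs s rest I hI hI' htop hlam hinp hold
    simp only [List.map_cons, List.cons_append, List.head?_cons, List.tail_cons] at htop hlam
    have hz : isMark (Option.map InputSymbol.bit zs.head?) = zs.head?.getD false := by
      rcases zs with _ | ⟨_ | _, zs⟩ <;> rfl
    have hx : isMark (some (.bit x)) = x := by cases x <;> rfl
    obtain ⟨i, I, rfl⟩ := List.exists_cons_of_ne_nil hI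
    have hi : isMark (some i) = false := by
      rcases i with _ | _ | _ <;> simp [isMark, isBit] at hI' ⊢
    have step : ∃ s₁, subDigit.run s = s₁ ∧ s₁.reg.top = (xs.map InputSymbol.bit ++ InputSymbol.endPart :: rest).head? ∧
        s₁.stk .lam = (xs.map InputSymbol.bit ++ .endPart :: rest).tail ∧
        s₁.stk .inp = ys.tail.map .bit ++ i :: I ∧ s₁.stk .old = zs.tail.map .bit ∧
        s₁.stk .new = (ys.take 1).map .bit ++ s.stk .new ∧
        s₁.stk .dif = .bit (x ^^ (ys.headD false ^^ s.reg.c)) :: s.stk .dif ∧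
        s₁.stk .low = .bit (x ^^ (zs.headD false ^^ s.reg.d)) :: s.stk .low ∧
        s₁.reg.c = borrow x (ys.headD false) s.reg.c ∧
        s₁.reg.d = borrow x (zs.headD false) s.reg.d ∧
        s₁.reg.ok = s.reg.ok ∧ s₁.reg.flag = s.reg.flag := by
      refine ⟨_, rfl, ?_⟩
      rcases ys with _ | ⟨y, ys⟩
      · simp only [List.map_nil, List.nil_append] at hinp
        have hI'' : isBit (some i) = false := hI'
        simp [subDigit, subDigit.k, Block.run, popTop, htop, hlam, hinp, hold, hz, hx, hi, hI'']
      · have hy : isMark (some (.bit y)) = y := by cases y <;> rfl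
        have hy' : isBit (some (.bit y)) = true := rfl
        simp [subDigit, subDigit.k, Block.run, popTop, htop, hlam, hinp, hold, hz, hx, hy, hy']
    obtain ⟨s₁, hs₁, a₁, a₂, a₃, a₄, a₅, a₆, a₇, a₈, a₉, a₁₀, a₁₁⟩ := step
    obtain ⟨s', r', b₁, b₂, b₃, b₄, b₅, b₆, b₇, b₈, b₉, b₁₀, b₁₁⟩ :=
      ih (s := s₁) hI hI' a₁ a₂ a₃ a₄
    refine ⟨s', (Runs.loopTrue (by rw [htop]; rfl) (Runs.act hs₁) r').mono ?_, b₁, b₂, ?_⟩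
    · rw [List.length_cons]
      omega
    · rw [b₃, b₄, b₅, b₆, b₇, b₈, b₉, b₁₀, b₁₁, a₅, a₆, a₇, a₈, a₉, a₁₀, a₁₁]
      rcases ys with _ | ⟨y, ys⟩ <;> rcases zs with _ | ⟨z, zs⟩ <;> simp [subDigits, subBorrow]

/-- A sequence of parts, in binary. -/
def encParts (ps : List ℕ) : List InputSymbol :=
  ps.flatMap fun p => p.bits.map InputSymbol.bit ++ [InputSymbol.endPart]

theorem encParts_cons (p : ℕ) (ps : List ℕ) :
    encParts (p :: ps) = p.bits.map .bit ++ .endPart :: encParts ps := by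
  simp [encParts]

/-- The end marker of a number. -/
def sep (b : Bool) : InputSymbol := if b then .endPart else .endPartition

/-- A sequence of binary numbers, most significant digit first, each with a preceding marker. -/
def word (es : List (Bool × List Bool)) : List InputSymbol :=
  es.flatMap fun e => sep e.1 :: e.2.reverse.map .bit

/-- A number, which is replaced by zero if it is not valid. -/
def entryVal (e : Bool × List Bool) : ℕ := if e.1 then digitsVal e.2 else 0

theorem word_cons (e : Bool × List Bool) (es : List (Bool × List Bool)) :
    word (e :: es) = sep e.1 :: (e.2.reverse.map .bit ++ word es) := by
  simp [word]

theorem word_append (es es' : List (Bool × List Bool)) : word (es ++ es') = word es ++ word es' := by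
  simp [word]

/-- One pass over the digits of `p` subtracts both the corresponding part `q` of the other partition
and its previous part `o`, while the digits of `q` are saved to become the next `old`. If `q` is
longer than `p`, a digit is left on the input after the pass and `ok` is cleared; hence the cost
does not depend on `q`. -/
theorem subPart_runs {p o : ℕ} {ps qs : List ℕ} {J : List InputSymbol} {s : Store Stk Reg}
    (hlam : s.stk .lam = encParts (p :: ps)) (hinp : s.stk .inp = encParts qs ++ .endPartition :: J)
    (hold : s.stk .old = o.bits.map .bit) (hnew : s.stk .new = []) (hok : s.reg.ok = true) :
    ∃ s', Runs subPart s s' (4 * p.bits.length + 2 * o.bits.length + 9) ∧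
      s'.stk .lam = encParts ps ∧ s'.reg.top = (encParts ps).head? ∧
      s'.reg.ok = decide (qs.headD 0 ≤ p) ∧ (qs.headD 0 ≤ p →
        s'.stk .inp = encParts qs.tail ++ .endPartition :: J ∧
        s'.stk .old = (qs.headD 0).bits.map .bit ∧ s'.stk .new = [] ∧ s'.reg.flag = false ∧
        s'.stk .dif = word [(true, subDigits false p.bits (qs.headD 0).bits)] ++ s.stk .dif ∧
        s'.stk .low = word [(decide (o ≤ p) && !s.reg.flag, subDigits false p.bits o.bits)] ++
          s.stk .low) := by
  obtain ⟨I, hI, hI', hinp'⟩ : ∃ I, I ≠ [] ∧ isBit I.head? = false ∧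
      s.stk .inp = (qs.headD 0).bits.map .bit ++ I := by
    rcases qs with _ | ⟨q, qs⟩
    · exact ⟨.endPartition :: J, by simp, rfl, by simpa [encParts] using hinp⟩
    · exact ⟨.endPart :: (encParts qs ++ .endPartition :: J), by simp, rfl, by
        simpa [encParts_cons] using hinp⟩
  -- When the second partition is exhausted its end marker is pushed back, so that missing parts
  -- read as zero for all further rows.
  have hII : ∀ t : Store Stk Reg, t.stk .inp = I → ∃ t', subEnd.run t = t' ∧
      t'.stk .inp = encParts qs.tail ++ .endPartition :: J ∧ t'.reg.ok = (t.reg.ok && !t.reg.c) ∧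
      t'.reg.flag = false ∧ t'.stk .dif = .endPart :: t.stk .dif ∧
      t'.stk .low = sep ((t.stk .old).isEmpty && !t.reg.d && !t.reg.flag) :: t.stk .low := by
    intro t ht
    have hn : (t.stk .old).head?.isNone = (t.stk .old).isEmpty := by
      cases t.stk .old <;> rfl
    rcases qs with _ | ⟨q, qs⟩
    · have : I = .endPartition :: J := by simpa [encParts, hinp] using hinp'.symm
      refine ⟨_, rfl, ?_⟩
      simp [subEnd, subEnd.k, Block.run, pushSym, ht, this, encParts, sep]
    · have : I = .endPart :: (encParts qs ++ .endPartition :: J) := by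
        simpa [encParts_cons, hinp] using hinp'.symm
      refine ⟨_, rfl, ?_⟩
      simp [subEnd, subEnd.k, Block.run, pushSym, ht, this, sep]
  set q := qs.headD 0
  obtain ⟨s₁, hs₁⟩ : ∃ s₁, s₁ = Block.run
    (.load (fun r => { r with c := false, d := false }) (popTop .lam .nop)) s := ⟨_, rfl⟩
  obtain ⟨s₂, r₂, a₁, a₂, a₃, a₄, a₅, a₆, a₇, a₈, a₉, a₁₀, a₁₁⟩ := subDigits_loop_runs p.bits
    (ys := q.bits) (zs := o.bits) (s := s₁) (rest := encParts ps) hI hI'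
    (by simp [hs₁, Block.run, popTop, hlam, encParts_cons])
    (by simp [hs₁, Block.run, popTop, hlam, encParts_cons])
    (by simp [hs₁, Block.run, popTop, hinp'])
    (by simp [hs₁, Block.run, popTop, hold])
  have e₁ : s₁.reg.c = false := by simp [hs₁, Block.run, popTop]
  have e₂ : s₁.reg.d = false := by simp [hs₁, Block.run, popTop]
  have e₃ : s₁.reg.flag = s.reg.flag := by simp [hs₁, Block.run, popTop]
  have e₄ : s₁.reg.ok = true := by simp [hs₁, Block.run, popTop, hok]
  have e₅ : s₁.stk .new = [] := by simp [hs₁, Block.run, popTop, hnew]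
  have e₆ : s₁.stk .dif = s.stk .dif := by simp [hs₁, Block.run, popTop]
  have e₇ : s₁.stk .low = s.stk .low := by simp [hs₁, Block.run, popTop]
  rw [e₁] at a₆ a₈
  rw [e₂] at a₇ a₉
  rw [e₃] at a₁₁
  rw [e₄] at a₁₀
  rw [e₅, List.append_nil] at a₅
  rw [e₆] at a₆
  rw [e₇] at a₇
  obtain ⟨s₃, hs₃⟩ : ∃ s₃, s₃ = subEnd.run s₂ := ⟨_, rfl⟩
  have r₃ : Runs (.act subEnd) s₂ s₃ 1 := Runs.act hs₃.symm
  have b₁ : s₃.stk .lam = encParts ps := by rw [r₃.frame .lam rfl, a₂]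
  have b₂ : s₃.stk .new = (q.bits.take p.bits.length).reverse.map .bit := by
    rw [r₃.frame .new rfl, a₅]
  -- Also in the failing case `old` has only become shorter, so emptying it is paid for by `o`.
  have b₃ : (s₃.stk .old).length ≤ o.bits.length := by
    have : ((s₂.stk .old).tail).length ≤ o.bits.length := by
      rw [a₄, List.length_tail, List.length_map, List.length_drop]
      omega
    refine le_trans (le_of_eq ?_) this
    rw [hs₃, subEnd, subEnd.k]
    simp only [Block.run, pushSym, Bool.cond_decide]
    split_ifs <;> simp
  have b₄ : s₃.reg.ok = decide (q ≤ p) := by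
    by_cases hl : q.bits.length ≤ p.bits.length
    · obtain ⟨t, ht, -, h₂, -⟩ := hII s₂ (by
        rw [a₃, List.drop_eq_nil_of_le hl]; rfl)
      rw [hs₃, ht, h₂, a₈, a₁₀]
      rw [show decide (q ≤ p) = decide (q.bits.length ≤ p.bits.length ∧
        subBorrow false p.bits q.bits = false) from
          decide_eq_decide.2 (le_iff_subBorrow p q).symm]
      by_cases hb : subBorrow false p.bits q.bits = true <;> simp [hb, hl]
    · have h₁ : ¬ q ≤ p := fun h => hl ((le_iff_subBorrow p q).2 h).1
      have : ∃ b l, s₂.stk .inp = InputSymbol.bit b :: l := by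
        rw [a₃]
        rcases hd : q.bits.drop p.bits.length with _ | ⟨b, l⟩
        · exact absurd (List.drop_eq_nil_iff.1 hd) hl
        · exact ⟨b, _, rfl⟩
      obtain ⟨b, l, hb⟩ := this
      rw [hs₃, subEnd, subEnd.k]
      simp [Block.run, pushSym, hb, h₁]
  have r₄ := drain_runs .old s₃
  have r₅ := move_runs (X := .new) (Y := .old) (by decide)
    (⟨{ s₃.reg with top := none }, Function.update s₃.stk .old [], s₃.out⟩ : Store Stk Reg)
  obtain ⟨s₅, hs₅⟩ : ∃ s₅ : Store Stk Reg, s₅ = ⟨{ s₃.reg with top := none }, Function.update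
    (Function.update (Function.update s₃.stk .old []) .new []) .old
      ((q.bits.take p.bits.length).map .bit), s₃.out⟩ := ⟨_, rfl⟩
  have r₅' := r₅.cast (s₂ := s₅) (by
    rw [hs₅]
    simp [b₂]) le_rfl
  have r₆ := peek_runs .lam s₅
  refine ⟨_, (Runs.seq (Runs.act hs₁.symm) (r₂.seq (r₃.seq (r₄.seq (r₅'.seq r₆))))).mono ?_, ?_⟩
  · simp [b₂]
    omega
  · refine ⟨by simp [hs₅, b₁], by simp [hs₅, b₁], by simp [hs₅, b₄], fun hq => ?_⟩
    have hl := ((le_iff_subBorrow p q).2 hq).1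
    obtain ⟨t, ht, h₁, h₂, h₃, h₄, h₅⟩ := hII s₂ (by
      rw [a₃, List.drop_eq_nil_of_le hl]; rfl)
    rw [← hs₃] at ht
    subst ht
    refine ⟨by simp [hs₅, h₁], by simp [hs₅, List.take_of_length_le hl], by simp [hs₅],
      by simp [hs₅, h₃], by simp [hs₅, h₄, a₆, word, sep], ?_⟩
    have hd : ((s₂.stk .old).isEmpty && !s₂.reg.d) = decide (o ≤ p) := by
      rw [a₄, a₉]
      rw [show decide (o ≤ p) = decide (o.bits.length ≤ p.bits.length ∧
        subBorrow false p.bits o.bits = false) from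
          decide_eq_decide.2 (le_iff_subBorrow p o).symm]
      by_cases hb : subBorrow false p.bits o.bits = true <;>
        by_cases hl : o.bits.length ≤ p.bits.length <;>
        simp [hb, hl, List.isEmpty_iff, ← Bool.not_eq_true]
    simp only [hs₅]
    rw [Function.update_of_ne (by decide), Function.update_of_ne (by decide),
      Function.update_of_ne (by decide), h₅, hd, a₁₁, a₇]
    simp [word]

/-- Whether each part is at most the corresponding one. -/
def fits : List ℕ → List ℕ → Bool
  | [], qs => qs.isEmpty
  | p :: ps, qs => decide (qs.headD 0 ≤ p) && fits ps qs.tail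

/-- The differences of corresponding parts, in binary. -/
def difs : List ℕ → List ℕ → List (Bool × List Bool)
  | [], _ => []
  | p :: ps, qs => (true, subDigits false p.bits (qs.headD 0).bits) :: difs ps qs.tail

/-- The differences of the parts and the previous parts of the other partition, in binary; there is
no previous part if the flag is set. -/
def lows : Bool → ℕ → List ℕ → List ℕ → List (Bool × List Bool)
  | _, _, [], _ => []
  | b, o, p :: ps, qs => (decide (o ≤ p) && !b, subDigits false p.bits o.bits) ::
      lows false (qs.headD 0) ps qs.tail

/-- The subtraction of a partition. -/
def subLoop : StackProg Stk Reg := .loop (fun r => r.top.isSome && r.ok) subPart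

/-- The second partition fails to fit either through a part that is too large, which clears `ok`, or
through parts left over, so that its end marker is not on top. Where the parts fit, the cost of the
saved part `q` in the next round is charged to `p`, as `q` has no more digits than `p`. -/
theorem subLoop_runs (ps : List ℕ) : ∀ {qs : List ℕ} {o : ℕ} {J : List InputSymbol}
    {s : Store Stk Reg}, s.reg.top = (encParts ps).head? → s.stk .lam = encParts ps →
      s.stk .inp = encParts qs ++ .endPartition :: J →
      s.stk .old = o.bits.map .bit → s.stk .new = [] → s.reg.ok = true →
      ∃ s', Runs subLoop s s' (10 * (encParts ps).length + 2 * o.bits.length + 1) ∧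
        (fits ps qs = false → s'.reg.ok = false ∨ (s'.stk .inp).head? ≠ some .endPartition) ∧
        (fits ps qs = true → s'.reg.ok = true ∧ s'.stk .inp = .endPartition :: J ∧
          s'.stk .dif = word (difs ps qs).reverse ++ s.stk .dif ∧
          s'.stk .low = word (lows s.reg.flag o ps qs).reverse ++ s.stk .low) := by
  induction ps with
  | nil =>
    intro qs o J s htop hlam hinp hold hnew hok
    refine ⟨s, (Runs.loopFalse (by rw [htop]; rfl)).mono (by omega), fun h => ?_, fun h => ?_⟩
    · right
      rw [hinp]
      rcases qs with _ | ⟨q, qs⟩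
      · simp [fits] at h
      · rw [encParts_cons]
        rcases q.bits with _ | ⟨b, l⟩ <;> simp
    · have : qs = [] := by simpa [fits] using h
      subst this
      exact ⟨hok, hinp, by simp [difs, word], by simp [lows, word]⟩
  | cons p ps ih =>
    intro qs o J s htop hlam hinp hold hnew hok
    obtain ⟨s₁, r₁, a₁, a₂, a₃, a₄⟩ := subPart_runs hlam hinp hold hnew hok
    have hc : (s.reg.top.isSome && s.reg.ok) = true := by
      rw [htop, hok, encParts_cons]
      rcases p.bits with _ | ⟨b, l⟩ <;> simp
    have hlen : (encParts (p :: ps)).length = p.bits.length + 1 + (encParts ps).length := by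
      simp [encParts_cons]
      omega
    by_cases hq : qs.headD 0 ≤ p
    · obtain ⟨b₁, b₂, b₃, b₄, b₅, b₆⟩ := a₄ hq
      obtain ⟨s', r', c₁, c₂⟩ := ih a₂ a₁ b₁ b₂ b₃ (by rw [a₃]; exact decide_eq_true hq)
      refine ⟨s', (Runs.loopTrue hc r₁ r').mono ?_, ?_, ?_⟩
      · have := ((le_iff_subBorrow p (qs.headD 0)).2 hq).1
        omega
      · rw [fits, decide_eq_true hq, Bool.true_and]
        exact c₁
      · rw [fits, decide_eq_true hq, Bool.true_and]
        intro h
        obtain ⟨d₁, d₂, d₃, d₄⟩ := c₂ h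
        refine ⟨d₁, d₂, ?_, ?_⟩
        · rw [d₃, b₅, difs, List.reverse_cons, word_append, List.append_assoc]
        · rw [d₄, b₆, b₄, lows, List.reverse_cons, word_append, List.append_assoc]
    · rw [decide_eq_false hq] at a₃
      refine ⟨s₁, (Runs.loopTrue hc r₁ (Runs.loopFalse (by rw [a₃, Bool.and_false]))).mono ?_,
        fun _ => .inl a₃, fun h => ?_⟩
      · omega
      · rw [fits, decide_eq_false hq, Bool.false_and] at h
        cases h

/-- Read a partition. -/
def readLam : StackProg Stk Reg := popWhile notEnd .inp [(.tmp, id)] ;; move .tmp .lam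

theorem notEnd_of_mem_encParts {ps : List ℕ} {a : InputSymbol} (h : a ∈ encParts ps) :
    notEnd (some a) = true := by
  simp only [encParts, List.mem_flatMap, List.mem_append, List.mem_map, List.mem_singleton] at h
  obtain ⟨p, -, ⟨b, -, rfl⟩ | rfl⟩ := h <;> rfl

/-- Subtract the second partition from the first one. -/
def subAll : StackProg Stk Reg :=
  readLam ;; .act (.load (fun r => { r with ok := true, flag := true }) (peek .lam)) ;; subLoop ;;
    .act (.pop .inp (fun r a => { r with ok := r.ok && decide (a = some .endPartition) }) .nop)

/-- Initially `flag` marks the first row, which has no row above it. The bound involves the first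
partition only: the second one is not read further than it fits. -/
theorem subAll_runs {ps qs : List ℕ} {J : List InputSymbol} {s : Store Stk Reg}
    (hinp : s.stk .inp = encParts ps ++ .endPartition :: (encParts qs ++ .endPartition :: J))
    (h : ∀ j, j ≠ .inp → s.stk j = []) :
    ∃ s', Runs subAll s s' (14 * (encParts ps).length + 7) ∧ s'.reg.ok = fits ps qs ∧
      s'.stk .tmp = [] ∧ (fits ps qs = true → s'.stk .inp = J ∧ s'.stk .dif = word (difs ps qs).reverse ∧
        s'.stk .low = word (lows true 0 ps qs).reverse) := by
  have r₁ := popWhile_runs (c := notEnd) (X := .inp) (Ys := [(.tmp, id)]) _ _ (by simp) hinp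
    (fun a ha => notEnd_of_mem_encParts ha) rfl
  obtain ⟨s₂, hs₂⟩ : ∃ s₂ : Store Stk Reg, s₂ = ⟨{ s.reg with top := none }, Function.update
    (Function.update s.stk .inp (encParts qs ++ .endPartition :: J)) .lam (encParts ps), s.out⟩ :=
    ⟨_, rfl⟩
  have r₂ := (r₁.seq (move_runs (X := .tmp) (Y := .lam) (by decide) _)).cast (s₂ := s₂) (by
    rw [hs₂]
    congr 1
    funext j
    by_cases h₁ : j = .lam
    · subst h₁; simp [pushed_id, h]
    · by_cases h₂ : j = .tmp
      · subst h₂; simp [h]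
      · by_cases h₃ : j = .inp
        · subst h₃; simp
        · simp [h₁, h₂, h₃, pushed_id, Ne.symm h₂]) le_rfl
  obtain ⟨s₃, hs₃⟩ : ∃ s₃, s₃ = Block.run
    (.load (fun r => { r with ok := true, flag := true }) (peek .lam)) s₂ := ⟨_, rfl⟩
  have hs₃' : s₃ = ⟨{ s₂.reg with ok := true, flag := true, top := (encParts ps).head? }, s₂.stk,
      s₂.out⟩ := by
    rw [hs₃, Block.run, run_peek]
    simp [hs₂]
  obtain ⟨s₄, r₄, a₁, a₂⟩ := subLoop_runs ps (qs := qs) (o := 0) (J := J) (s := s₃)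
    (by rw [hs₃']) (by simp [hs₃', hs₂]) (by simp [hs₃', hs₂]) (by simp [hs₃', hs₂, h])
    (by simp [hs₃', hs₂, h]) (by rw [hs₃'])
  refine ⟨_, (r₂.seq (Runs.seq (Runs.act hs₃.symm) (r₄.seq (Runs.act rfl)))).mono ?_, ?_, ?_, ?_⟩
  · simp [pushed_id, h]
    omega
  · simp only [Block.run]
    cases hf : fits ps qs
    · rcases a₁ hf with h₁ | h₁
      · rw [h₁, Bool.false_and]
      · rw [decide_eq_false h₁, Bool.and_false]
    · obtain ⟨h₁, h₂, -⟩ := a₂ hf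
      rw [h₁, h₂]
      rfl
  · simp [Block.run, r₄.frame .tmp rfl, hs₃', hs₂, h]
  · intro hf
    obtain ⟨h₁, h₂, h₃, h₄⟩ := a₂ hf
    refine ⟨by simp [Block.run, h₂], ?_, ?_⟩
    · simp [Block.run, h₃, hs₃', hs₂, h]
    · simp [Block.run, h₄, hs₃', hs₂, h]

end StackProg

/-! ### Conversion to unary notation -/

namespace StackProg

/-- A sequence of numbers in unary notation, each with an end marker. -/
def marks (es : List (Bool × ℕ)) : List InputSymbol :=
  es.flatMap fun e => List.replicate e.2 (.bit true) ++ [sep e.1]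

theorem marks_cons (e : Bool × ℕ) (es : List (Bool × ℕ)) :
    marks (e :: es) = List.replicate e.2 (.bit true) ++ sep e.1 :: marks es := by
  simp [marks]

theorem marks_append (es es' : List (Bool × ℕ)) : marks (es ++ es') = marks es ++ marks es' := by
  simp [marks]

/-- Double the number on top of a stack and add the digit which has been popped. -/
def doubleAdd (W : Stk) : StackProg Stk Reg :=
  .act (.load (fun r => { r with aux := r.top }) .nop) ;; popWhile isMark W [(.tmp, id), (.tmp, id)] ;;
    .act (pushTop W (.branch (fun r => isMark r.aux) (pushSym W (.bit true) .nop) .nop)) ;; move .tmp W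

/-- Process a digit. -/
def convertDigit (X W : Stk) : StackProg Stk Reg :=
  .ite (fun r => r.flag) (doubleAdd W) (.act .nop) ;; .act (popTop X .nop)

/-- Process a number. -/
def convertEntry (X W : Stk) : StackProg Stk Reg :=
  .act (.load (fun r => { r with flag := decide (r.top = some .endPart) }) (pushTop W (popTop X .nop))) ;;
    .loop (fun r => isBit r.top) (convertDigit X W)

/-- Replace binary notation by unary notation. -/
def convert (X W : Stk) : StackProg Stk Reg :=
  .act (popTop X .nop) ;; .loop (fun r => r.top.isSome) (convertEntry X W)

theorem sep_ne_mark (b : Bool) : isMark (some (sep b)) = false := by cases b <;> rfl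

theorem doubleAdd_runs {W : Stk} (hW : W ≠ .tmp) {s : Store Stk Reg} {v : ℕ} {b : Bool}
    {m : Bool} {R : List InputSymbol} (hs : s.stk W = List.replicate v (.bit true) ++ sep m :: R)
    (htmp : s.stk .tmp = []) (htop : s.reg.top = some (.bit b)) :
    ∃ s', Runs (doubleAdd W) s s' (6 * v + 6) ∧
      s'.stk = Function.update s.stk W (List.replicate (b.toNat + 2 * v) (.bit true) ++ sep m :: R) ∧
      s'.reg.flag = s.reg.flag := by
  have r₂ := popWhile_runs (c := isMark) (X := W) (Ys := [(.tmp, id), (.tmp, id)])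
    (s := ⟨{ s.reg with aux := s.reg.top }, s.stk, s.out⟩) (List.replicate v (.bit true)) (sep m :: R)
    (by simpa using hW.symm) hs (by simp [isMark]) (sep_ne_mark m)
  have hp : pushed [(Stk.tmp, id), (Stk.tmp, id)] (List.replicate v (.bit true)) .tmp =
      List.replicate (2 * v) (.bit true) := by
    rw [pushed, List.flatMap_replicate]
    simp [List.eq_replicate_iff, mul_comm]
  refine ⟨_, ((Runs.act rfl).seq (r₂.seq ((Runs.act rfl).seq (move_runs hW _)))).mono ?_, ?_, ?_⟩
  · cases b <;> simp [Block.run, pushTop, pushSym, htop, isMark, hW.symm, hp, htmp] <;> omega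
  · funext j
    by_cases h₁ : j = W
    · subst h₁
      cases b
      · simp [Block.run, pushTop, pushSym, htop, isMark, hW.symm, hp, htmp]
      · simp [Block.run, pushTop, pushSym, htop, isMark, hW.symm, hp, htmp]
        rw [add_comm 1, List.replicate_succ', List.append_assoc, List.singleton_append]
    · by_cases h₂ : j = .tmp
      · subst h₂
        simp [h₁, htmp]
      · cases b <;> simp [Block.run, pushTop, pushSym, htop, isMark, h₁, h₂, pushed, Ne.symm h₂]
  · cases b <;> simp [Block.run, pushTop, pushSym, htop, isMark]

/-- The number whose digits are given, most significant digit first, after some digits. -/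
theorem digitsVal_append (l l' : List Bool) :
    digitsVal (l ++ l') = digitsVal l + 2 ^ l.length * digitsVal l' := by
  induction l with
  | nil => simp [digitsVal]
  | cons b l ih =>
    rw [List.cons_append, digitsVal_cons, digitsVal_cons, ih, List.length_cons, pow_succ]
    ring

/-- Horner's scheme from the most significant digit. An entry marked invalid skips the doubling and
stays zero, so the wrapped digits of a negative difference are never expanded. -/
theorem convertDigits_runs {X W : Stk} (hX : X ≠ .tmp) (hW : W ≠ .tmp) (hXW : W ≠ X) (ds : List Bool) :
    ∀ {s : Store Stk Reg} {l : List Bool} {rest R : List InputSymbol}, isBit rest.head? = false →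
      s.reg.top = (ds.map InputSymbol.bit ++ rest).head? → s.stk X = (ds.map InputSymbol.bit ++ rest).tail →
      s.stk W = List.replicate (entryVal (s.reg.flag, l)) (.bit true) ++ sep s.reg.flag :: R →
      s.stk .tmp = [] →
      ∃ s', Runs (.loop (fun r => isBit r.top) (convertDigit X W)) s s'
          ((6 * entryVal (s.reg.flag, ds.reverse ++ l) + 9) * ds.length + 1) ∧
        s'.reg.top = rest.head? ∧ s'.stk X = rest.tail ∧ s'.stk .tmp = [] ∧
        s'.stk W = List.replicate (entryVal (s.reg.flag, ds.reverse ++ l)) (.bit true) ++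
          sep s.reg.flag :: R := by
  induction ds with
  | nil =>
    intro s l rest R hr htop hX' hW' htmp
    exact ⟨s, (Runs.loopFalse (by rw [htop]; exact hr)).mono (by omega), htop, hX', htmp, hW'⟩
  | cons d ds ih =>
    intro s l rest R hr htop hX' hW' htmp
    simp only [List.map_cons, List.cons_append, List.head?_cons, List.tail_cons] at htop hX'
    obtain ⟨s₁, r₁, a₁, a₂⟩ : ∃ s₁, Runs (.ite (fun r => r.flag) (doubleAdd W) (.act .nop)) s s₁
        (6 * entryVal (s.reg.flag, l) + 7) ∧ s₁.stk = Function.update s.stk W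
          (List.replicate (entryVal (s.reg.flag, d :: l)) (.bit true) ++ sep s.reg.flag :: R) ∧
        s₁.reg.flag = s.reg.flag := by
      cases hf : s.reg.flag
      · refine ⟨_, (Runs.iteFalse hf (Runs.act rfl)).mono (by omega), ?_, hf⟩
        rw [hf] at hW'
        rw [Block.run, eq_comm, Function.update_eq_self_iff, hW']
        rfl
      · rw [hf] at hW'
        obtain ⟨s₁, r₁, h₁, h₂⟩ := doubleAdd_runs hW hW' htmp htop
        exact ⟨s₁, (Runs.iteTrue hf r₁).mono (by omega), h₁, by rw [h₂, hf]⟩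
    obtain ⟨s₂, hs₂⟩ : ∃ s₂, s₂ = Block.run (popTop X .nop) s₁ := ⟨_, rfl⟩
    obtain ⟨s', r', h'⟩ := ih (s := s₂) (l := d :: l) (R := R) hr
      (by simp [hs₂, Block.run, popTop, a₁, hXW.symm, hX'])
      (by simp [hs₂, Block.run, popTop, a₁, hXW.symm, hX'])
      (by simp [hs₂, Block.run, popTop, a₁, a₂, hXW])
      (by simp [hs₂, Block.run, popTop, a₁, hX.symm, hW.symm, htmp])
    have hf : s₂.reg.flag = s.reg.flag := by simp [hs₂, Block.run, popTop, a₂]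
    have he : ds.reverse ++ d :: l = (d :: ds).reverse ++ l := by simp
    rw [hf, he] at r' h'
    refine ⟨s', (Runs.loopTrue (by rw [htop]; rfl) (r₁.seq (Runs.act hs₂.symm)) r').mono ?_, h'⟩
    -- The intermediate values do not exceed the final one, which therefore bounds the cost of every
    -- doubling.
    have : entryVal (s.reg.flag, l) ≤ entryVal (s.reg.flag, (d :: ds).reverse ++ l) := by
      simp only [entryVal]
      split_ifs
      · rw [digitsVal_append]
        exact le_trans (Nat.le_mul_of_pos_left _ (by positivity)) (Nat.le_add_left _ _)
      · exact le_rfl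
    rw [List.length_cons]
    nlinarith

theorem convert_loop_runs {X W : Stk} (hX : X ≠ .tmp) (hW : W ≠ .tmp) (hXW : W ≠ X) {B : ℕ}
    (es : List (Bool × List Bool)) : ∀ {s : Store Stk Reg}, (∀ e ∈ es, entryVal e ≤ B) →
      s.reg.top = (word es).head? → s.stk X = (word es).tail → s.stk .tmp = [] →
      ∃ s', Runs (.loop (fun r => r.top.isSome) (convertEntry X W)) s s'
          ((6 * B + 9) * (word es).length + 1) ∧ s'.stk X = [] ∧ s'.stk .tmp = [] ∧
        s'.stk W = marks (es.map fun e => (e.1, entryVal e)).reverse ++ s.stk W := by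
  induction es with
  | nil =>
    intro s hB htop hX' htmp
    exact ⟨s, (Runs.loopFalse (by rw [htop]; rfl)).mono (by omega), hX', htmp, rfl⟩
  | cons e es ih =>
    intro s hB htop hX' htmp
    simp only [word_cons, List.head?_cons, List.tail_cons] at htop hX'
    obtain ⟨s₁, hs₁⟩ : ∃ s₁, s₁ = Block.run (.load (fun r => { r with
      flag := decide (r.top = some .endPart) }) (pushTop W (popTop X .nop))) s := ⟨_, rfl⟩
    have hf : s₁.reg.flag = e.1 := by
      rw [hs₁]
      simp only [Block.run, pushTop, popTop, htop]
      cases e.1 <;> rfl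
    have hr : isBit (word es).head? = false := by
      rcases es with _ | ⟨⟨_ | _, _⟩, es⟩ <;> rfl
    obtain ⟨s₂, r₂, a₁, a₂, a₃, a₄⟩ := convertDigits_runs hX hW hXW e.2.reverse (s := s₁) (l := [])
      (R := s.stk W) hr (by simp [hs₁, Block.run, pushTop, popTop, hXW.symm, hX'])
      (by simp [hs₁, Block.run, pushTop, popTop, hXW.symm, hX'])
      (by
        have : entryVal (e.1, []) = 0 := by simp [entryVal, digitsVal]
        rw [hf, this]
        simp [hs₁, Block.run, pushTop, popTop, hXW, htop])
      (by simp [hs₁, Block.run, pushTop, popTop, hX.symm, hW.symm, htmp])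
    rw [hf, List.reverse_reverse, List.append_nil] at r₂ a₄
    obtain ⟨s', r', b₁, b₂, b₃⟩ := ih (fun e he => hB e (List.mem_cons_of_mem _ he)) a₁ a₂ a₃
    refine ⟨s', (Runs.loopTrue (by rw [htop]; rfl) (Runs.seq (Runs.act hs₁.symm) r₂) r').mono ?_,
      b₁, b₂, ?_⟩
    · have := hB e List.mem_cons_self
      have h₁ : (6 * entryVal (e.1, e.2) + 9) * e.2.reverse.length ≤ (6 * B + 9) * e.2.length := by
        rw [List.length_reverse]
        exact Nat.mul_le_mul_right _ (Nat.add_le_add_right (Nat.mul_le_mul_left _ this) _)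
      rw [word_cons, List.length_cons, List.length_append, List.length_map, List.length_reverse]
      rw [List.length_reverse] at h₁
      nlinarith
    · rw [b₃, a₄, List.map_cons, List.reverse_cons, marks_append, marks_cons]
      simp [marks]

theorem convert_runs {X W : Stk} (hX : X ≠ .tmp) (hW : W ≠ .tmp) (hXW : W ≠ X) {B : ℕ}
    {es : List (Bool × List Bool)} {s : Store Stk Reg} (hB : ∀ e ∈ es, entryVal e ≤ B)
    (h : s.stk X = word es.reverse) (htmp : s.stk .tmp = []) :
    ∃ s', Runs (convert X W) s s' ((6 * B + 9) * (word es).length + 2) ∧ s'.stk X = [] ∧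
      s'.stk .tmp = [] ∧ s'.stk W = marks (es.map fun e => (e.1, entryVal e)) ++ s.stk W := by
  obtain ⟨s', r', h₁, h₂, h₃⟩ := convert_loop_runs hX hW hXW es.reverse
    (s := Block.run (popTop X .nop) s) (by simpa using hB) (by simp [Block.run, popTop, h])
    (by simp [Block.run, popTop, h]) (by simp [Block.run, popTop, hX.symm, htmp])
  have hl : (word es.reverse).length = (word es).length := by simp [word, List.length_flatMap]
  rw [hl] at r'
  refine ⟨s', ((Runs.act rfl).seq r').mono (by omega), h₁, h₂, ?_⟩
  rw [h₃]
  simp [Block.run, popTop, hXW]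

end StackProg

/-! ### Preparation of the search -/

namespace StackProg

/-- Process a box of a row. -/
def combineBox : Block Stk Reg :=
  pushSym .td (.bit true) (.load (fun r => { r with c := true }) (
    .pop .opens (fun r a => { r with aux := a }) (
      .branch (fun r => isMark r.aux) (popTop .ones .nop)
        (.push .opens (fun r => r.aux.getD .endPart) (
          pushSym .sl (.bit true) (popTop .ones .nop))))))

/-- Complete a row. -/
def combineEnd : Block Stk Reg :=
  .pop .opens (fun r a => { r with aux := a }) (
    .branch (fun r => r.c) (pushSym .td .endPart (pushSym .sl .endPart (popTop .ones .nop)))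
      (popTop .ones .nop))

/-- Process a row. -/
def combineRow : StackProg Stk Reg :=
  .act (.load (fun r => { r with c := false }) .nop) ;; .loop (fun r => isMark r.top) (.act combineBox) ;;
    .act combineEnd

/-- Omit the empty rows, and compute the slacks. -/
def combine : StackProg Stk Reg :=
  .act (popTop .ones .nop) ;; .loop (fun r => r.top.isSome) combineRow ;;
    .act (pushSym .sl .endPart .nop) ;; move .sl .slM ;; move .td .tdM

theorem replicate_append_cons (m : ℕ) (a : InputSymbol) (l : List InputSymbol) :
    List.replicate m a ++ a :: l = a :: (List.replicate m a ++ l) := by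
  rw [← List.singleton_append, ← List.append_assoc, ← List.replicate_succ', List.replicate_succ,
    List.cons_append]

/-- Each of the `m` missing boxes is matched against a mark of `opens`, as long as there are any;
the `m - o` unmatched ones form the slack. -/
theorem combineBoxes_runs (m : ℕ) : ∀ {o : ℕ} {b : Bool} {s : Store Stk Reg} {R O : List InputSymbol},
    o ≤ m → s.reg.top = (List.replicate m (InputSymbol.bit true) ++ InputSymbol.endPart :: R).head? →
    s.stk .ones = (List.replicate m (InputSymbol.bit true) ++ InputSymbol.endPart :: R).tail →
    s.stk .opens = List.replicate o (.bit true) ++ sep b :: O →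
    ∃ s', Runs (.loop (fun r => isMark r.top) (.act combineBox)) s s' (2 * m + 1) ∧
      s'.reg.top = some .endPart ∧ s'.stk .ones = R ∧ s'.stk .opens = sep b :: O ∧
      s'.stk .td = List.replicate m (.bit true) ++ s.stk .td ∧
      s'.stk .sl = List.replicate (m - o) (.bit true) ++ s.stk .sl ∧
      s'.reg.c = (s.reg.c || decide (0 < m)) := by
  induction m with
  | zero =>
    intro o b s R O ho htop hones hopens
    obtain rfl := Nat.le_zero.1 ho
    exact ⟨s, Runs.loopFalse (by rw [htop]; rfl), htop, hones, hopens, rfl, rfl, by simp⟩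
  | succ m ih =>
    intro o b s R O ho htop hones hopens
    simp only [List.replicate_succ, List.cons_append, List.head?_cons, List.tail_cons] at htop hones
    obtain ⟨s₁, hs₁⟩ : ∃ s₁, s₁ = Block.run combineBox s := ⟨_, rfl⟩
    have hb := sep_ne_mark b
    rcases o with _ | o
    · obtain ⟨s', r', h₁, h₂, h₃, h₄, h₅, h₆⟩ := ih (o := 0) (b := b) (s := s₁) (R := R) (O := O)
        (Nat.zero_le _)
        (by simp [hs₁, combineBox, Block.run, popTop, pushSym, hopens, hb, hones])
        (by simp [hs₁, combineBox, Block.run, popTop, pushSym, hopens, hb, hones])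
        (by simp [hs₁, combineBox, Block.run, popTop, pushSym, hopens, hb])
      refine ⟨s', (Runs.loopTrue (by rw [htop]; rfl) (Runs.act hs₁.symm) r').mono (by omega),
        h₁, h₂, h₃, ?_, ?_, ?_⟩
      · simp [h₄, hs₁, combineBox, Block.run, popTop, pushSym, hopens, hb, List.replicate_succ']
      · simp [h₅, hs₁, combineBox, Block.run, popTop, pushSym, hopens, hb, List.replicate_succ']
      · simp [h₆, hs₁, combineBox, Block.run, popTop, pushSym, hopens, hb]
    · have hm : isMark (some (.bit true)) = true := rfl
      obtain ⟨s', r', h₁, h₂, h₃, h₄, h₅, h₆⟩ := ih (o := o) (b := b) (s := s₁) (R := R) (O := O)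
        (by omega)
        (by simp [hs₁, combineBox, Block.run, popTop, pushSym, hopens, hm, hones, List.replicate_succ])
        (by simp [hs₁, combineBox, Block.run, popTop, pushSym, hopens, hm, hones, List.replicate_succ])
        (by simp [hs₁, combineBox, Block.run, popTop, pushSym, hopens, hm, List.replicate_succ])
      refine ⟨s', (Runs.loopTrue (by rw [htop]; rfl) (Runs.act hs₁.symm) r').mono (by omega),
        h₁, h₂, h₃, ?_, ?_, ?_⟩
      · simp [h₄, hs₁, combineBox, Block.run, popTop, pushSym, hopens, hm, List.replicate_succ,
          replicate_append_cons]
      · simp [h₅, hs₁, combineBox, Block.run, popTop, pushSym, hopens, hm, List.replicate_succ]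
      · simp [h₆, hs₁, combineBox, Block.run, popTop, pushSym, hopens, hm, List.replicate_succ]

/-- The register `c` records whether the row had a box. Rows without boxes leave no trace on `td`
and `sl`, which selects the active rows. -/
theorem combine_loop_runs (rows : List (ℕ × ℕ × Bool)) : ∀ {s : Store Stk Reg},
    (∀ x ∈ rows, x.2.1 ≤ x.1) → s.reg.top = (unary (rows.map fun x => x.1)).head? →
    s.stk .ones = (unary (rows.map fun x => x.1)).tail →
    s.stk .opens = marks (rows.map fun x => (x.2.2, x.2.1)) →
    ∃ s', Runs (.loop (fun r => r.top.isSome) combineRow) s s'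
        (2 * (rows.map fun x => x.1).sum + 4 * rows.length + 1) ∧
      s'.stk .td = (unary ((rows.filter fun x => decide (0 < x.1)).map fun x => x.1)).reverse ++
        s.stk .td ∧
      s'.stk .sl = (unary ((rows.filter fun x => decide (0 < x.1)).map
        fun x => x.1 - x.2.1)).reverse ++ s.stk .sl := by
  induction rows with
  | nil =>
    intro s h htop hones hopens
    exact ⟨s, Runs.loopFalse (by rw [htop]; rfl), rfl, rfl⟩
  | cons x rows ih =>
    intro s h htop hones hopens
    obtain ⟨m, o, b⟩ := x
    rw [List.map_cons, unary_cons] at htop hones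
    rw [List.map_cons, marks_cons] at hopens
    obtain ⟨s₁, hs₁⟩ : ∃ s₁ : Store Stk Reg, s₁ = ⟨{ s.reg with c := false }, s.stk, s.out⟩ := ⟨_, rfl⟩
    obtain ⟨s₂, r₂, a₁, a₂, a₃, a₄, a₅, a₆⟩ := combineBoxes_runs m (s := s₁)
      (h _ List.mem_cons_self) (by rw [hs₁]; exact htop) (by rw [hs₁]; exact hones)
      (by rw [hs₁]; exact hopens)
    obtain ⟨s₃, hs₃⟩ : ∃ s₃, s₃ = Block.run combineEnd s₂ := ⟨_, rfl⟩
    have key : s₃.reg.top = (unary (rows.map fun x => x.1)).head? ∧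
        s₃.stk .ones = (unary (rows.map fun x => x.1)).tail ∧
        s₃.stk .opens = marks (rows.map fun x => (x.2.2, x.2.1)) := by
      cases hc : s₂.reg.c <;>
      simp [hs₃, combineEnd, Block.run, popTop, pushSym, a₂, a₃, hc]
    obtain ⟨s', r', b₁, b₂⟩ := ih (s := s₃) (fun x hx => h x (List.mem_cons_of_mem _ hx)) key.1
      key.2.1 key.2.2
    have htop' : s.reg.top.isSome = true := by rw [htop]; cases m <;> rfl
    refine ⟨s', (Runs.loopTrue htop' (Runs.seq (Runs.act hs₁.symm) (r₂.seq (Runs.act hs₃.symm)))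
      r').mono ?_, ?_, ?_⟩
    · simp only [List.map_cons, List.sum_cons, List.length_cons]
      omega
    · rw [b₁]
      rcases m with _ | m
      · simp [hs₃, combineEnd, Block.run, popTop, pushSym, a₆, a₄, hs₁]
      · simp [hs₃, combineEnd, Block.run, popTop, pushSym, a₆, a₄, hs₁, unary_cons]
    · rw [b₂]
      rcases m with _ | m
      · simp [hs₃, combineEnd, Block.run, popTop, pushSym, a₆, a₅, hs₁]
      · simp [hs₃, combineEnd, Block.run, popTop, pushSym, a₆, a₅, hs₁, unary_cons]

/-- The last end marker written to `sl` is the extra entry `0`, which the search needs below the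
last row. -/
theorem combine_runs {rows : List (ℕ × ℕ × Bool)} {s : Store Stk Reg}
    (h : ∀ x ∈ rows, x.2.1 ≤ x.1) (hones : s.stk .ones = unary (rows.map fun x => x.1))
    (hopens : s.stk .opens = marks (rows.map fun x => (x.2.2, x.2.1)))
    (h₁ : s.stk .td = []) (h₂ : s.stk .sl = []) (h₃ : s.stk .tdM = []) (h₄ : s.stk .slM = []) :
    ∃ s', Runs combine s s' (6 * (rows.map fun x => x.1).sum + 8 * rows.length + 9) ∧
      s'.stk .tdM = unary ((rows.filter fun x => decide (0 < x.1)).map fun x => x.1) ∧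
      s'.stk .slM = unary ((rows.filter fun x => decide (0 < x.1)).map (fun x => x.1 - x.2.1) ++
        [0]) ∧ s'.stk .td = [] ∧ s'.stk .sl = [] := by
  obtain ⟨s₁, r₁, a₁, a₂⟩ := combine_loop_runs rows (s := Block.run (popTop .ones .nop) s) h
    (by simp [Block.run, popTop, hones]) (by simp [Block.run, popTop, hones])
    (by simp [Block.run, popTop, hopens])
  have b₁ : s₁.stk .tdM = [] := by rw [r₁.frame .tdM rfl]; simp [Block.run, popTop, h₃]
  have b₂ : s₁.stk .slM = [] := by rw [r₁.frame .slM rfl]; simp [Block.run, popTop, h₄]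
  refine ⟨_, ((Runs.act rfl).seq (r₁.seq ((Runs.act rfl).seq ((move_runs (by decide) _).seq
    (move_runs (by decide) _))))).mono ?_, ?_, ?_, ?_, ?_⟩
  · have l₁ : ((rows.filter fun x => decide (0 < x.1)).map fun x => x.1).sum ≤
        (rows.map fun x => x.1).sum :=
      (List.filter_sublist.map _).sum_le_sum (by simp)
    have l₂ : (rows.filter fun x => decide (0 < x.1)).length ≤ rows.length := List.length_filter_le _ _
    have l₃ : ((rows.filter fun x => decide (0 < x.1)).map fun x => x.1 - x.2.1).sum ≤
        ((rows.filter fun x => decide (0 < x.1)).map fun x => x.1).sum :=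
      List.sum_le_sum fun x _ => Nat.sub_le _ _
    simp [Block.run, pushSym, popTop, a₁, a₂, h₁, h₂, length_unary]
    omega
  · simp [Block.run, pushSym, popTop, a₁, h₁, b₁]
  · simp [Block.run, pushSym, popTop, a₂, h₂, b₂, unary]
  · simp [Block.run, pushSym]
  · simp [Block.run, pushSym]

/-- For each symbol, append a list of zeros. -/
def guessStep : StackProg Stk Reg :=
  popWhile Option.isSome .ptM [(.tmp, id), (.guess, fun _ => .bit false)] ;; move .tmp .ptM ;;
    .act (popTop .pt .nop)

/-- Write a sufficiently long list of decisions. -/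
def initGuess : StackProg Stk Reg :=
  copy .ptM .pt ;; .act (popTop .pt .nop) ;; .loop (fun r => r.top.isSome) guessStep

theorem initGuess_loop_runs (l : List InputSymbol) {P : List InputSymbol} : ∀ {s : Store Stk Reg} {g : ℕ},
    s.reg.top = l.head? → s.stk .pt = l.tail → s.stk .ptM = P → s.stk .tmp = [] →
    s.stk .guess = List.replicate g (.bit false) →
    ∃ s', Runs (.loop (fun r => r.top.isSome) guessStep) s s' ((4 * P.length + 6) * l.length + 1) ∧
      s'.stk .pt = [] ∧ s'.stk .ptM = P ∧ s'.stk .tmp = [] ∧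
      s'.stk .guess = List.replicate (g + l.length * P.length) (.bit false) := by
  induction l with
  | nil =>
    intro s g htop hpt hP htmp hg
    exact ⟨s, (Runs.loopFalse (by rw [htop]; rfl)).mono (by omega), hpt, hP, htmp, by simp [hg]⟩
  | cons a l ih =>
    intro s g htop hpt hP htmp hg
    have r₁ := popWhile_runs (c := Option.isSome) (X := .ptM)
      (Ys := [(.tmp, id), (.guess, fun _ => .bit false)]) (s := s) P [] (by simp) (by simp [hP])
      (by simp) rfl
    have r₂ := move_runs (X := .tmp) (Y := .ptM) (by decide) (⟨{ s.reg with top := none },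
      fun j => if j = .ptM then [] else pushed [(.tmp, id), (.guess, fun _ => .bit false)] P j ++ s.stk j,
      s.out⟩ : Store Stk Reg)
    have hp : pushed [(Stk.tmp, id), (Stk.guess, fun _ => .bit false)] P .tmp = P.reverse := by
      simp [pushed]
    have hp' : pushed [(Stk.tmp, id), (Stk.guess, fun _ => .bit false)] P .guess =
        List.replicate P.length (.bit false) := by
      simp [pushed, List.eq_replicate_iff]
    obtain ⟨s₂, hs₂⟩ : ∃ s₂ : Store Stk Reg, s₂ = _ := ⟨_, rfl⟩
    have r₃ := r₂.cast hs₂.symm le_rfl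
    have r₄ : Runs (.act (popTop .pt .nop)) s₂ ((popTop .pt .nop).run s₂) 1 := Runs.act rfl
    obtain ⟨s', r', h₁, h₂, h₃, h₄⟩ := ih (s := (popTop .pt .nop).run s₂) (g := g + P.length)
      (by simp [Block.run, popTop, hs₂, hpt, pushed, flatMap_const_nil])
      (by simp [Block.run, popTop, hs₂, hpt, pushed, flatMap_const_nil])
      (by simp [Block.run, popTop, hs₂, hp, htmp])
      (by simp [Block.run, popTop, hs₂])
      (by simp [Block.run, popTop, hs₂, hp', hg, add_comm])
    refine ⟨s', (Runs.loopTrue (c := fun r => r.top.isSome) (by rw [htop]; rfl) (r₁.seq (r₃.seq r₄)) r').mono ?_, h₁, h₂, h₃, ?_⟩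
    · simp [hp, htmp]
      ring_nf
      omega
    · rw [h₄, List.length_cons]
      congr 1
      ring

/-- Each symbol of `ptM` contributes as many zeros as `ptM` has symbols, which squares a length
without arithmetic. -/
theorem initGuess_runs {s : Store Stk Reg} (htmp : s.stk .tmp = []) (hpt : s.stk .pt = [])
    (hg : s.stk .guess = []) :
    ∃ s', Runs initGuess s s' (20 * ((s.stk .ptM).length + 1) ^ 2) ∧ s'.stk .pt = [] ∧
      s'.stk .ptM = s.stk .ptM ∧ s'.stk .tmp = [] ∧
      s'.stk .guess = List.replicate ((s.stk .ptM).length ^ 2) (.bit false) := by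
  have r₁ := copy_runs (X := .ptM) (Y := .pt) (by decide) (by decide) (by decide) htmp hpt
  obtain ⟨s', r', h₁, h₂, h₃, h₄⟩ := initGuess_loop_runs (s.stk .ptM) (P := s.stk .ptM) (g := 0)
    (s := (popTop .pt .nop).run ⟨{ s.reg with top := none }, Function.update s.stk .pt (s.stk .ptM),
      s.out⟩) (by simp [Block.run, popTop]) (by simp [Block.run, popTop]) (by simp [Block.run, popTop])
    (by simp [Block.run, popTop, htmp]) (by simp [Block.run, popTop, hg])
  refine ⟨s', (r₁.seq ((Runs.act rfl).seq r')).mono ?_, h₁, h₂, h₃, ?_⟩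
  · nlinarith
  · rw [h₄]
    congr 1
    ring

end StackProg

/-! ### The algorithm -/

namespace StackProg

open GelfandTsetlin

/-- The encoding of a sequence of partitions, given by their parts and end markers. -/
def encTokens (ts : List (Option ℕ)) : List InputSymbol :=
  ts.flatMap fun
    | some p => p.bits.map InputSymbol.bit ++ [InputSymbol.endPart]
    | none => [InputSymbol.endPartition]

/-- A part, or an end marker. -/
def tokenEntry : Option ℕ → Bool × List Bool
  | some p => (true, p.bits)
  | none => (false, [])

/-- Read backwards, the marker comes before the digits and the most significant digit comes first,
which is the format that `convert` consumes. -/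
theorem reverse_encTokens (ts : List (Option ℕ)) :
    (encTokens ts).reverse = word (ts.map tokenEntry).reverse := by
  induction ts with
  | nil => rfl
  | cons t ts ih =>
    rw [List.map_cons, List.reverse_cons, word_append, ← ih]
    rcases t with _ | p <;> simp [encTokens, tokenEntry, word, sep]

theorem entryVal_tokenEntry (t : Option ℕ) : entryVal (tokenEntry t) = t.getD 0 := by
  rcases t with _ | p
  · rfl
  · simp [tokenEntry, entryVal, digitsVal_bits]

theorem marks_tokenEntry (ts : List (Option ℕ)) :
    marks ((ts.map tokenEntry).map fun e => (e.1, entryVal e)) = unaryTokens ts := by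
  induction ts with
  | nil => rfl
  | cons t ts ih =>
    rw [List.map_cons, List.map_cons, marks_cons, ih, entryVal_tokenEntry]
    rcases t with _ | p
    · rw [unaryTokens_none]; rfl
    · rw [unaryTokens_some]; rfl

theorem length_word_reverse (es : List (Bool × List Bool)) :
    (word es.reverse).length = (word es).length := by
  simp [word, List.length_flatMap]

/-- Translate the input to unary notation. -/
def prepare : StackProg Stk Reg :=
  move .inp .gw ;; convert .gw .ptM ;; convert .dif .ones ;; convert .low .opens ;; combine ;; initGuess

/-- The stacks which the subtraction does not use. -/
def isFresh : Stk → Bool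
  | .inp | .lam | .old | .new | .dif | .low | .tmp => false
  | _ => true

theorem prepare_runs {es fs : List (Bool × List Bool)} {rows : List (ℕ × ℕ × Bool)}
    {ts : List (Option ℕ)} {B E : ℕ} {s : Store Stk Reg}
    (hinp : s.stk .inp = encTokens ts) (hdif : s.stk .dif = word es.reverse)
    (hlow : s.stk .low = word fs.reverse)
    (hes : (es.map fun e => (e.1, entryVal e)) = rows.map fun x => (true, x.1))
    (hfs : (fs.map fun e => (e.1, entryVal e)) = rows.map fun x => (x.2.2, x.2.1))
    (hrows : ∀ x ∈ rows, x.2.1 ≤ x.1) (hB : ∀ x ∈ rows, x.1 ≤ B) (htB : ∀ t ∈ ts, t.getD 0 ≤ B)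
    (hesE : (word es).length ≤ E) (hfsE : (word fs).length ≤ E)
    (htmp : s.stk .tmp = []) (hs : ∀ j, isFresh j = true → s.stk j = []) (hout : s.out = []) :
    ∃ s', Runs prepare s s' (2 * (encTokens ts).length + 2 + ((6 * B + 9) * (encTokens ts).length + 2) +
        2 * ((6 * B + 9) * E + 2) + (6 * (rows.map fun x => x.1).sum + 8 * rows.length + 9) +
        20 * ((unaryTokens ts).length + 1) ^ 2) ∧
      Ready ((rows.filter fun x => decide (0 < x.1)).map (fun x => x.1 - x.2.1) ++ [0])
        ((rows.filter fun x => decide (0 < x.1)).map fun x => x.1) ts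
        (List.replicate ((unaryTokens ts).length ^ 2) false) 0 s' := by
  have hbe : ∀ e ∈ es, entryVal e ≤ B := by
    intro e he
    have : (e.1, entryVal e) ∈ rows.map fun x => (true, x.1) :=
      hes ▸ List.mem_map_of_mem (f := fun e => (e.1, entryVal e)) he
    obtain ⟨x, hx, h⟩ := List.mem_map.1 this
    exact (Prod.ext_iff.1 h).2.symm.trans_le (hB x hx)
  have hbf : ∀ e ∈ fs, entryVal e ≤ B := by
    intro e he
    have : (e.1, entryVal e) ∈ rows.map fun x => (x.2.2, x.2.1) :=
      hfs ▸ List.mem_map_of_mem (f := fun e => (e.1, entryVal e)) he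
    obtain ⟨x, hx, h⟩ := List.mem_map.1 this
    exact (Prod.ext_iff.1 h).2.symm.trans_le ((hrows x hx).trans (hB x hx))
  have r₁ := move_runs (X := .inp) (Y := .gw) (by decide) s
  obtain ⟨s₁, hs₁⟩ : ∃ s₁ : Store Stk Reg, s₁ = ⟨{ s.reg with top := none }, Function.update
    (Function.update s.stk .inp []) .gw ((s.stk .inp).reverse ++ s.stk .gw), s.out⟩ := ⟨_, rfl⟩
  rw [← hs₁] at r₁
  obtain ⟨s₂, r₂, a₁, a₂, a₃⟩ := convert_runs (X := .gw) (W := .ptM) (by decide) (by decide)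
    (by decide) (B := B) (es := ts.map tokenEntry) (s := s₁)
    (by
      intro e he
      obtain ⟨t, ht, rfl⟩ := List.mem_map.1 he
      rw [entryVal_tokenEntry]
      exact htB t ht)
    (by rw [hs₁, ← reverse_encTokens, ← hinp]; simp [hs .gw rfl])
    (by rw [r₁.frame .tmp rfl, htmp])
  rw [r₁.frame .ptM rfl, hs .ptM rfl, marks_tokenEntry, List.append_nil] at a₃
  obtain ⟨s₃, r₃, b₁, b₂, b₃⟩ := convert_runs (X := .dif) (W := .ones) (by decide) (by decide)
    (by decide) hbe (s := s₂) (by rw [r₂.frame .dif rfl, r₁.frame .dif rfl, hdif]) a₂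
  rw [r₂.frame .ones rfl, r₁.frame .ones rfl, hs .ones rfl, hes, List.append_nil] at b₃
  obtain ⟨s₄, r₄, c₁, c₂, c₃⟩ := convert_runs (X := .low) (W := .opens) (by decide) (by decide)
    (by decide) hbf (s := s₃)
    (by rw [r₃.frame .low rfl, r₂.frame .low rfl, r₁.frame .low rfl, hlow]) b₂
  rw [r₃.frame .opens rfl, r₂.frame .opens rfl, r₁.frame .opens rfl, hs .opens rfl, hfs,
    List.append_nil] at c₃
  have r₁₄ := r₁.seq (r₂.seq (r₃.seq r₄))
  obtain ⟨s₅, r₅, d₁, d₂, d₃, d₄⟩ := combine_runs (s := s₄) hrows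
    (by
      rw [r₄.frame .ones rfl, b₃]
      simp [marks, unary, List.flatMap_map, sep])
    c₃ (by rw [r₁₄.frame .td rfl, hs .td rfl]) (by rw [r₁₄.frame .sl rfl, hs .sl rfl])
    (by rw [r₁₄.frame .tdM rfl, hs .tdM rfl]) (by rw [r₁₄.frame .slM rfl, hs .slM rfl])
  have htM : s₅.stk .ptM = unaryTokens ts := by
    rw [r₅.frame .ptM rfl, r₄.frame .ptM rfl, r₃.frame .ptM rfl, a₃]
  obtain ⟨s₆, r₆, e₁, e₂, e₃, e₄⟩ := initGuess_runs (s := s₅)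
    (by rw [r₅.frame .tmp rfl, c₂])
    (by rw [r₅.frame .pt rfl, r₁₄.frame .pt rfl, hs .pt rfl])
    (by rw [r₅.frame .guess rfl, r₁₄.frame .guess rfl, hs .guess rfl])
  rw [htM] at r₆ e₂ e₄
  have r := r₁.seq (r₂.seq (r₃.seq (r₄.seq (r₅.seq r₆))))
  refine ⟨s₆, r.mono ?_, ⟨?_, ?_, e₂, ?_, ?_, e₃, ?_, ?_⟩⟩
  · have h₁ : (word (ts.map tokenEntry)).length = (encTokens ts).length := by
      rw [← length_word_reverse, ← reverse_encTokens, List.length_reverse]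
    have h₂ := Nat.mul_le_mul_left (6 * B + 9) hesE
    have h₃ := Nat.mul_le_mul_left (6 * B + 9) hfsE
    rw [h₁, hinp]
    omega
  · rw [r₆.frame .slM rfl, d₂]
  · rw [r₆.frame .tdM rfl, d₁]
  · rw [e₄, List.map_replicate]
  · rw [r.frame .cnt rfl, hs .cnt rfl]
    simp
  · intro j hj
    cases j <;> simp [isWork] at hj
    · rw [r₆.frame .gw rfl, r₅.frame .gw rfl, r₄.frame .gw rfl, r₃.frame .gw rfl, a₁]
    · rw [r₆.frame .sl rfl, d₄]
    · rw [r₆.frame .td rfl, d₃]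
    · rw [r.frame .pv rfl, hs .pv rfl]
    · exact e₁
    · rw [r.frame .slD rfl, hs .slD rfl]
    · rw [r.frame .tdD rfl, hs .tdD rfl]
    · rw [r.frame .pvD rfl, hs .pvD rfl]
    · rw [r.frame .e rfl, hs .e rfl]
  · rw [r.frame_out rfl, hout]

/-- The algorithm. -/
def multiLR : StackProg Stk Reg :=
  subAll ;; .ite (fun r => r.ok) (prepare ;; (tryAll ;; output)) (.act .nop)

/-- Nothing is written; the empty word is the binary notation of zero. -/
theorem multiLR_runs_of_not_fits {ps qs : List ℕ} {J : List InputSymbol} {s : Store Stk Reg}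
    (hinp : s.stk .inp = encParts ps ++ .endPartition :: (encParts qs ++ .endPartition :: J))
    (hs : ∀ j, j ≠ .inp → s.stk j = []) (hout : s.out = []) (h : fits ps qs = false) :
    ∃ s', Runs multiLR s s' (14 * (encParts ps).length + 9) ∧ s'.out = [] := by
  obtain ⟨s₁, r₁, h₁, -⟩ := subAll_runs hinp hs
  have r := r₁.seq (Runs.iteFalse (c := fun r => r.ok) (p := prepare ;; (tryAll ;; output))
    (q := .act .nop) (h₁.trans h) (Runs.act rfl))
  exact ⟨_, r, by simpa [Block.run, hout] using r₁.frame_out rfl⟩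

theorem multiLR_runs {ps qs : List ℕ} {rows : List (ℕ × ℕ × Bool)}
    {ts : List (Option ℕ)} {B E z L : ℕ} {s : Store Stk Reg}
    (hinp : s.stk .inp = encParts ps ++ .endPartition :: (encParts qs ++ .endPartition :: encTokens ts))
    (hs : ∀ j, j ≠ .inp → s.stk j = []) (hout : s.out = []) (h : fits ps qs = true)
    (hes : ((difs ps qs).map fun e => (e.1, entryVal e)) = rows.map fun x => (true, x.1))
    (hfs : ((lows true 0 ps qs).map fun e => (e.1, entryVal e)) = rows.map fun x => (x.2.2, x.2.1))
    (hrows : ∀ x ∈ rows, x.2.1 ≤ x.1) (hB : ∀ x ∈ rows, x.1 ≤ B) (htB : ∀ t ∈ ts, t.getD 0 ≤ B)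
    (hesE : (word (difs ps qs)).length ≤ E) (hfsE : (word (lows true 0 ps qs)).length ≤ E)
    {sl td : List ℕ} (hsl : (rows.filter fun x => decide (0 < x.1)).map (fun x => x.1 - x.2.1) ++ [0] = sl)
    (htd : (rows.filter fun x => decide (0 < x.1)).map (fun x => x.1) = td)
    (hx : (SearchState.start sl td td ts true).WF)
    (hz : (SearchState.start sl td td ts true).size ≤ z) (hL : (unaryTokens ts).length ^ 2 = L) :
    ∃ s', Runs multiLR s s' (14 * (encParts ps).length + 7 +
        (2 * (encTokens ts).length + 2 + ((6 * B + 9) * (encTokens ts).length + 2) +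
        2 * ((6 * B + 9) * E + 2) + (6 * (rows.map fun x => x.1).sum + 8 * rows.length + 9) +
        20 * ((unaryTokens ts).length + 1) ^ 2 + (100000 * ((z + 1) * (L + 1)) * 2 ^ L + 100) + 1)) ∧
      s'.out = (Nat.card {w : List Bool // w.length = L ∧
        (SearchState.start sl td td ts true).Accepts w}).bits := by
  obtain ⟨s₁, r₁, h₁, h₂, h₃⟩ := subAll_runs hinp hs
  obtain ⟨b₁, b₂, b₃⟩ := h₃ h
  obtain ⟨s₂, r₂, h₄⟩ := prepare_runs b₁ b₂ b₃ hes hfs hrows hB htB hesE hfsE h₂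
    (by
      intro j hj
      have hj' : j ≠ .inp := by rintro rfl; cases hj
      rw [← hs j hj']
      cases j <;> first | exact absurd hj (by decide) | (refine r₁.frame _ ?_; rfl))
    (by rw [r₁.frame_out rfl, hout])
  rw [hsl, htd, hL] at h₄
  obtain ⟨s', r₃, h₅⟩ := tryAll_runs hx hz h₄
  exact ⟨s', r₁.seq (Runs.iteTrue (c := fun r => r.ok) (h₁.trans h) (r₂.seq r₃)), h₅⟩

end StackProg

/-! ### Correctness of the algorithm -/

open Finset

namespace StackProg

theorem difs_eq (ps qs : List ℕ) : difs ps qs = (List.range ps.length).map fun a =>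
    (true, subDigits false (ps.getD a 0).bits (qs.getD a 0).bits) := by
  induction ps generalizing qs with
  | nil => rfl
  | cons p ps ih =>
    rw [difs, ih, List.length_cons, List.range_succ_eq_map, List.map_cons, List.map_map]
    rcases qs with _ | ⟨q, qs⟩ <;> simp [Function.comp_def]

theorem lows_eq (b : Bool) (o : ℕ) (ps qs : List ℕ) : lows b o ps qs = (List.range ps.length).map
    fun a => if a = 0 then
      (decide (o ≤ ps.getD 0 0) && !b, subDigits false (ps.getD 0 0).bits o.bits)
    else (decide (qs.getD (a - 1) 0 ≤ ps.getD a 0),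
      subDigits false (ps.getD a 0).bits (qs.getD (a - 1) 0).bits) := by
  induction ps generalizing b o qs with
  | nil => rfl
  | cons p ps ih =>
    rw [lows, ih, List.length_cons, List.range_succ_eq_map, List.map_cons, List.map_map]
    simp only [if_true, List.getD_cons_zero, Function.comp_def, Nat.succ_ne_zero, if_false,
      Nat.succ_sub_one, List.getD_cons_succ, Nat.succ_eq_add_one]
    congr 1
    refine List.map_congr_left fun a _ => ?_
    rcases a with _ | a
    · rcases qs with _ | ⟨q, qs⟩ <;> simp
    · rcases qs with _ | ⟨q, qs⟩ <;> simp

theorem getD_le_of_fits {ps qs : List ℕ} (h : fits ps qs = true) (a : ℕ) :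
    qs.getD a 0 ≤ ps.getD a 0 := by
  induction ps generalizing qs a with
  | nil =>
    have : qs = [] := by simpa [fits] using h
    simp [this]
  | cons p ps ih =>
    simp only [fits, Bool.and_eq_true, decide_eq_true_eq] at h
    rcases a with _ | a
    · rcases qs with _ | ⟨q, qs⟩
      · simp
      · simpa using h.1
    · have := ih h.2 a
      rcases qs with _ | ⟨q, qs⟩
      · simp
      · simpa using this

theorem exists_lt_getD_of_not_fits {ps qs : List ℕ} (hq : ∀ q ∈ qs, 0 < q) (h : fits ps qs = false) :
    ∃ a, ps.getD a 0 < qs.getD a 0 := by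
  induction ps generalizing qs with
  | nil =>
    rcases qs with _ | ⟨q, qs⟩
    · simp [fits] at h
    · exact ⟨0, by simpa using hq q List.mem_cons_self⟩
  | cons p ps ih =>
    simp only [fits, Bool.and_eq_false_iff, decide_eq_false_iff_not, not_le] at h
    rcases h with h | h
    · refine ⟨0, ?_⟩
      rcases qs with _ | ⟨q, qs⟩
      · simp at h
      · simpa using h
    · obtain ⟨a, ha⟩ := ih (fun q hq' => hq q (List.mem_of_mem_tail hq')) h
      refine ⟨a + 1, ?_⟩
      rcases qs with _ | ⟨q, qs⟩
      · simp at ha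
      · simpa using ha

theorem length_word_difs (ps qs : List ℕ) : (word (difs ps qs)).length = (encParts ps).length := by
  induction ps generalizing qs with
  | nil => rfl
  | cons p ps ih => simp [difs, word_cons, encParts_cons, ih, length_subDigits]; omega

theorem length_word_lows (b : Bool) (o : ℕ) (ps qs : List ℕ) :
    (word (lows b o ps qs)).length = (encParts ps).length := by
  induction ps generalizing b o qs with
  | nil => rfl
  | cons p ps ih => simp [lows, word_cons, encParts_cons, ih, length_subDigits]; omega

theorem entryVal_sub (p o : ℕ) (b : Bool) :
    entryVal (decide (o ≤ p) && !b, subDigits false p.bits o.bits) = if b then 0 else p - o := by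
  cases b
  · by_cases h : o ≤ p
    · simp [entryVal, h, digitsVal_sub h]
    · simp [entryVal, h]
      omega
  · simp [entryVal]

theorem length_bits_le_self (p : ℕ) : p.bits.length ≤ p := by
  rw [Nat.size_eq_bits_len]
  exact Nat.size_le.2 Nat.lt_two_pow_self

theorem length_encTokens_le (ts : List (Option ℕ)) :
    (encTokens ts).length ≤ (unaryTokens ts).length := by
  induction ts with
  | nil => exact le_rfl
  | cons t ts ih =>
    rcases t with _ | p
    · rw [unaryTokens_none]
      simpa [encTokens] using ih
    · rw [unaryTokens_some]
      have := length_bits_le_self p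
      simp [encTokens] at ih ⊢
      omega

end StackProg

namespace YoungDiagram

theorem getD_rowLens (μ : YoungDiagram) (a : ℕ) : μ.rowLens.getD a 0 = μ.rowLen a := by
  by_cases h : a < μ.rowLens.length
  · rw [List.getD_eq_getElem _ _ h, get_rowLens]
  · rw [List.getD_eq_default _ _ (not_lt.1 h),
      GelfandTsetlin.rowLen_eq_zero_of_length_le (not_lt.1 h)]

theorem sum_rowLens (μ : YoungDiagram) : μ.rowLens.sum = μ.card := by
  rw [← μ.sum_rowLen (N := μ.rowLens.length) fun i hi =>
    GelfandTsetlin.rowLen_eq_zero_of_length_le hi, length_rowLens]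
  rfl

theorem length_rowLens_le_card (μ : YoungDiagram) : μ.rowLens.length ≤ μ.card := by
  rw [← μ.sum_rowLens]
  exact List.length_le_sum_of_one_le _ fun p hp => μ.pos_of_mem_rowLens p hp

theorem rowLens_ne_nil {μ : YoungDiagram} (h : μ ≠ ⊥) : μ.rowLens ≠ [] := by
  refine fun h' => h (ext_rowLen fun i => ?_)
  rw [← getD_rowLens, ← getD_rowLens, h']
  have : (⊥ : YoungDiagram).rowLens = [] := by
    refine List.eq_nil_of_length_eq_zero (Nat.le_zero.1 ?_)
    exact (length_rowLens_le_card ⊥).trans (le_of_eq rfl)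
  rw [this]

end YoungDiagram

namespace GelfandTsetlin

theorem rowTokens_cons (α : YoungDiagram) (αs : List YoungDiagram) :
    rowTokens (α :: αs) = α.rowLens.map some ++ none :: rowTokens αs := by
  simp [rowTokens]

theorem GoodTokens.block {ts : List (Option ℕ)} (h : GoodTokens ts) {l : List ℕ} (hl : l ≠ []) :
    GoodTokens (l.map some ++ none :: ts) := by
  induction l with
  | nil => exact absurd rfl hl
  | cons p l ih =>
    rcases l with _ | ⟨q, l⟩
    · exact h
    · exact ih (by simp)

theorem goodTokens_rowTokens {αs : List YoungDiagram} (h : ∀ α ∈ αs, α ≠ ⊥) :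
    GoodTokens (rowTokens αs) := by
  induction αs with
  | nil => trivial
  | cons α αs ih =>
    rw [rowTokens_cons]
    exact (ih fun β hβ => h β (List.mem_cons_of_mem _ hβ)).block
      (YoungDiagram.rowLens_ne_nil (h α List.mem_cons_self))

theorem tokenSum_rowTokens (αs : List YoungDiagram) :
    tokenSum (rowTokens αs) = (αs.map YoungDiagram.card).sum := by
  induction αs with
  | nil => rfl
  | cons α αs ih =>
    rw [rowTokens_cons, List.map_cons, List.sum_cons, ← ih, ← α.sum_rowLens]
    simp [tokenSum, Function.comp_def]

/-- A nonempty partition has at most as many parts as boxes, and its end marker is paid for by a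
further box count. Without nonemptiness the number of separators would not be bounded by the number
of boxes. -/
theorem length_rowTokens_le {αs : List YoungDiagram} (h : ∀ α ∈ αs, α ≠ ⊥) :
    (rowTokens αs).length ≤ 2 * (αs.map YoungDiagram.card).sum := by
  induction αs with
  | nil => exact Nat.zero_le _
  | cons α αs ih =>
    have h₁ := ih fun β hβ => h β (List.mem_cons_of_mem _ hβ)
    have h₂ := α.length_rowLens_le_card
    have h₃ := List.length_pos_of_ne_nil (YoungDiagram.rowLens_ne_nil (h α List.mem_cons_self))
    rw [rowTokens_cons, List.map_cons, List.sum_cons, List.length_append, List.length_map,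
      List.length_cons]
    omega

end GelfandTsetlin

theorem encodePartition_eq (μ : YoungDiagram) :
    encodePartition μ = StackProg.encParts μ.rowLens ++ [.endPartition] := rfl

theorem flatMap_encodePartition (αs : List YoungDiagram) :
    αs.flatMap encodePartition = StackProg.encTokens (GelfandTsetlin.rowTokens αs) := by
  induction αs with
  | nil => rfl
  | cons α αs ih =>
    rw [List.flatMap_cons, ih, GelfandTsetlin.rowTokens_cons, encodePartition_eq]
    simp [StackProg.encTokens, StackProg.encParts, List.flatMap_map]

theorem encodeInput_eq (lam α : YoungDiagram) (αs : List YoungDiagram) :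
    encodeInput lam (α :: αs) = StackProg.encParts lam.rowLens ++ .endPartition ::
      (StackProg.encParts α.rowLens ++ .endPartition ::
        StackProg.encTokens (GelfandTsetlin.rowTokens αs)) := by
  rw [encodeInput, List.flatMap_cons, List.flatMap_cons, flatMap_encodePartition,
    encodePartition_eq, encodePartition_eq]
  simp

namespace StackProg

open GelfandTsetlin

/-- The dominant term is the exhaustive search: `2 ^ L` trials at a cost of order `(z + 1) * (L +
1)`, cubic in `k + 1`. The input enters through `E` only, with a factor linear in `k + 1`. -/
theorem multiLR_time {k E t D M U z L : ℕ} (ht : t ≤ 3 * k) (hU : U ≤ 3 * k) (hM : M ≤ E)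
    (hz : z ≤ 9 * k + 1) (hL : L ≤ 9 * k ^ 2) (hD : D ≤ k) :
    14 * E + 7 + (2 * t + 2 + ((6 * k + 9) * t + 2) + 2 * ((6 * k + 9) * E + 2) +
        (6 * D + 8 * M + 9) + 20 * (U + 1) ^ 2 + (100000 * ((z + 1) * (L + 1)) * 2 ^ L + 100) + 1) ≤
      10 ^ 7 * ((E + 1) * ((k + 1) ^ 3 * 2 ^ (9 * k ^ 2))) := by
  have h₁ : (z + 1) * (L + 1) ≤ 81 * (k + 1) ^ 3 :=
    (Nat.mul_le_mul (show z + 1 ≤ 9 * (k + 1) by omega)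
      (show L + 1 ≤ 9 * (k + 1) ^ 2 by nlinarith)).trans (by ring_nf; exact le_rfl)
  have h₂ : 2 ^ L ≤ 2 ^ (9 * k ^ 2) := Nat.pow_le_pow_right (by norm_num) hL
  have h₃ : (6 * k + 9) * t ≤ 27 * (k + 1) ^ 2 := by
    refine (Nat.mul_le_mul_left _ ht).trans ?_
    nlinarith
  have h₄ : (6 * k + 9) * E ≤ 9 * (k + 1) * E := Nat.mul_le_mul_right _ (by omega)
  have h₅ : (U + 1) ^ 2 ≤ 9 * (k + 1) ^ 2 := by
    calc (U + 1) ^ 2 ≤ (3 * (k + 1)) ^ 2 := Nat.pow_le_pow_left (by omega) 2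
      _ = 9 * (k + 1) ^ 2 := by ring
  have h₆ : 100000 * ((z + 1) * (L + 1)) * 2 ^ L ≤
      100000 * (81 * (k + 1) ^ 3) * 2 ^ (9 * k ^ 2) :=
    Nat.mul_le_mul (Nat.mul_le_mul_left _ h₁) h₂
  set P := 2 ^ (9 * k ^ 2)
  have hP : 1 ≤ P := Nat.one_le_two_pow
  have hK : 1 ≤ k + 1 := by omega
  set K := k + 1
  have b₁ : K ^ 3 * P ≤ (E + 1) * (K ^ 3 * P) := Nat.le_mul_of_pos_left _ (by omega)
  have b₂ : K ^ 2 ≤ K ^ 3 * P :=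
    (Nat.pow_le_pow_right hK (by norm_num)).trans (Nat.le_mul_of_pos_right _ hP)
  have b₃ : K ≤ K ^ 2 := by nlinarith
  have b₄ : K * E ≤ (E + 1) * (K ^ 3 * P) := by
    rw [mul_comm]
    exact Nat.mul_le_mul (by omega) (b₃.trans b₂)
  have b₅ : E ≤ K * E := Nat.le_mul_of_pos_left _ hK
  have b₆ : 100000 * (81 * K ^ 3) * P = 8100000 * (K ^ 3 * P) := by ring
  have b₇ : 9 * K * E = 9 * (K * E) := by ring
  have b₈ : k ≤ K := Nat.le_succ k
  omega

/-- The number of boxes which may be added to a row, but cannot be added in a single horizontal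
strip. -/
def lowVal (lam cur : ℕ → ℕ) (a : ℕ) : ℕ := if a = 0 then 0 else lam a - cur (a - 1)

theorem multiLR_correct {n k : ℕ} {lam α : YoungDiagram} {αs : List YoungDiagram}
    (hlam : lam.card = n) (hα : α.card + k = n) (hαs : (αs.map YoungDiagram.card).sum = k)
    (hne : ∀ a ∈ αs, a ≠ ⊥) (init : Reg) :
    ∃ s', Runs multiLR ⟨init, Function.update (fun _ => []) .inp (encodeInput lam (α :: αs)), []⟩ s'
        (10 ^ 7 * (((encParts lam.rowLens).length + 1) * ((k + 1) ^ 3 * 2 ^ (9 * k ^ 2)))) ∧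
      s'.out = (Nat.card {vs // RowSeq n lam.rowLen α.rowLen none (rowTokens αs) vs}).bits := by
  have hs : ∀ j, j ≠ .inp → Function.update (fun _ => []) Stk.inp (encodeInput lam (α :: αs)) j = [] :=
    fun j hj => Function.update_of_ne hj ..
  have hinp : Function.update (fun _ => []) Stk.inp (encodeInput lam (α :: αs)) .inp = _ :=
    (Function.update_self ..).trans (encodeInput_eq lam α αs)
  cases hf : fits lam.rowLens α.rowLens
  · obtain ⟨s', r', h'⟩ := multiLR_runs_of_not_fits (s := ⟨init, _, []⟩) hinp hs rfl hf
    refine ⟨s', r'.mono ?_, ?_⟩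
    · have : 1 ≤ (k + 1) ^ 3 * 2 ^ (9 * k ^ 2) := Nat.one_le_iff_ne_zero.2 (by positivity)
      have := Nat.le_mul_of_pos_right ((encParts lam.rowLens).length + 1) this
      omega
    -- A row of the first factor longer than that of `lam` excludes every sequence, since partitions
    -- only grow along it.
    · have : IsEmpty {vs // RowSeq n lam.rowLen α.rowLen none (rowTokens αs) vs} := by
        refine ⟨fun vs => ?_⟩
        obtain ⟨a, ha⟩ := exists_lt_getD_of_not_fits α.pos_of_mem_rowLens hf
        rw [YoungDiagram.getD_rowLens, YoungDiagram.getD_rowLens] at ha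
        exact absurd (RowSeq.le vs.2 a) (not_le.2 ha)
      rw [h', Nat.card_of_isEmpty]
      simp
  · have hle : ∀ a, α.rowLen a ≤ lam.rowLen a := by
      intro a
      rw [← YoungDiagram.getD_rowLens, ← YoungDiagram.getD_rowLens]
      exact getD_le_of_fits hf a
    set M := lam.rowLens.length with hM
    have hzero : ∀ a, M ≤ a → lam.rowLen a = 0 := fun a ha => rowLen_eq_zero_of_length_le ha
    have hMn : M ≤ n := hlam ▸ lam.length_rowLens_le_card
    let ts := rowTokens αs
    let g : ℕ → ℕ × ℕ × Bool := fun a => (lam.rowLen a - α.rowLen a, lowVal lam.rowLen α.rowLen a,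
      if a = 0 then false else decide (α.rowLen (a - 1) ≤ lam.rowLen a))
    let act : ℕ → Bool := fun a => decide (α.rowLen a < lam.rowLen a)
    -- For `a > 0` this is the minimum of the number of missing boxes and of the gap below the row
    -- above. It is computed from two differences which are at most `k`, whereas the gap itself may
    -- be large.
    let S : ℕ → ℕ := fun a => lam.rowLen a - α.rowLen a - lowVal lam.rowLen α.rowLen a
    have hlow : ∀ a, lowVal lam.rowLen α.rowLen a ≤ lam.rowLen a - α.rowLen a := by
      intro a
      rw [lowVal]
      split_ifs
      · exact Nat.zero_le _
      · exact Nat.sub_le_sub_left (α.rowLen_antitone (Nat.sub_le a 1)) _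
    have hfilter : ∀ {β : Type} (f : ℕ × ℕ × Bool → β),
        (((List.range M).map g).filter fun x => decide (0 < x.1)).map f =
          (activeRows M act).map fun a => f (g a) := by
      intro β f
      rw [List.filter_map, List.map_map, activeRows]
      congr 1
      refine List.filter_congr fun a _ => ?_
      simp [g, act]
    have hcomp : Compression M act lam.rowLen α.rowLen S := by
      refine ⟨α.rowLen_antitone, lam.rowLen_antitone, hle, fun a ha => ?_, fun a ha => ?_, hzero,
        fun a _ => ?_⟩
      · have : ¬ α.rowLen a < lam.rowLen a := of_decide_eq_false ha
        exact le_antisymm (hle a) (not_lt.1 this)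
      · have : α.rowLen a < lam.rowLen a := of_decide_eq_true ha
        by_contra! h
        rw [hzero a h] at this
        omega
      · have h₁ := α.rowLen_antitone (Nat.sub_le a 1)
        have h₂ := hle a
        simp only [S, lowVal]
        split_ifs <;> omega
    have hsum : ∑ a ∈ range n, (lam.rowLen a - α.rowLen a) = k := by
      have h₁ := lam.sum_rowLen (N := n) fun i hi => lam.rowLen_eq_zero (hlam.le.trans hi)
      have h₂ := α.sum_rowLen (N := n) fun i hi => α.rowLen_eq_zero (by omega)
      have h₃ : ∑ a ∈ range n, (lam.rowLen a - α.rowLen a) + ∑ a ∈ range n, α.rowLen a =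
          ∑ a ∈ range n, lam.rowLen a := by
        rw [← sum_add_distrib]
        exact sum_congr rfl fun a _ => Nat.sub_add_cancel (hle a)
      omega
    have hsumM : ((List.range M).map fun a => lam.rowLen a - α.rowLen a).sum = k := by
      rw [← hsum, sum_range_of_ge hMn fun i hi => by rw [hzero i hi, Nat.zero_sub]]
      rfl
    have htsum : tokenSum ts = k := (tokenSum_rowTokens αs).trans hαs
    have htlen : ts.length ≤ 2 * k := hαs ▸ length_rowTokens_le hne
    have hU : (unaryTokens ts).length ≤ 3 * k := by
      rw [length_unaryTokens]
      omega
    have hgood : GoodTokens ts := goodTokens_rowTokens hne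
    set td := (activeRows M act).map fun a => lam.rowLen a - α.rowLen a with htd
    have htdsum : td.sum = k := by
      rw [← hsumM, htd]
      have : (activeRows M act).map (fun a => lam.rowLen a - α.rowLen a) =
          (((List.range M).map fun a => lam.rowLen a - α.rowLen a).filter fun x => decide (0 < x)) := by
        rw [List.filter_map, activeRows]
        congr 1
        refine List.filter_congr fun a _ => ?_
        simp [act]
      rw [this]
      generalize (List.range M).map (fun a => lam.rowLen a - α.rowLen a) = l
      induction l with
      | nil => rfl
      | cons x l ih => rcases x with _ | x <;> simpa using ih
    have htdlen : td.length ≤ k := by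
      rw [← htdsum]
      refine List.length_le_sum_of_one_le _ fun x hx => ?_
      obtain ⟨a, ha, rfl⟩ := List.mem_map.1 hx
      have : α.rowLen a < lam.rowLen a := of_decide_eq_true (List.mem_filter.1 ha).2
      omega
    have hSsum : ((activeRows M act).map S).sum ≤ k := by
      rw [← htdsum, htd]
      exact List.sum_le_sum fun a _ => Nat.sub_le _ _
    have hSlen : ((activeRows M act).map S).length = td.length := by simp [htd]
    have htd₀ : ts ≠ [] → td ≠ [] := by
      intro h h'
      rw [h', List.sum_nil] at htdsum
      rw [← htdsum] at htlen
      exact h (List.eq_nil_of_length_eq_zero (by omega))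
    have hwf : (SearchState.start ((activeRows M act).map S ++ [0]) td td ts true).WF :=
      ⟨by simp [SearchState.start, ← hSlen], rfl, rfl, rfl, htd₀, hgood⟩
    have hsize : (SearchState.start ((activeRows M act).map S ++ [0]) td td ts true).size ≤ 9 * k + 1 := by
      have : (ts.map (Option.getD · 0)).sum = k := htsum
      simp only [SearchState.size, SearchState.start, List.sum_append, List.length_append, hSlen, this]
      simp
      omega
    obtain ⟨s', r', h'⟩ := multiLR_runs (s := ⟨init, _, []⟩) (rows := (List.range M).map g)
      (B := k) (E := (encParts lam.rowLens).length) hinp hs rfl hf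
      (by
        rw [difs_eq, List.map_map, List.map_map]
        refine List.map_congr_left fun a _ => ?_
        simp only [Function.comp_apply, g, entryVal, if_true, YoungDiagram.getD_rowLens]
        rw [digitsVal_sub (hle a)])
      (by
        rw [lows_eq, List.map_map, List.map_map]
        refine List.map_congr_left fun a _ => ?_
        simp only [Function.comp_apply, g, YoungDiagram.getD_rowLens, lowVal]
        split_ifs with h
        · rw [entryVal_sub]
          simp
        · have := entryVal_sub (lam.rowLen a) (α.rowLen (a - 1)) false
          rw [Bool.not_false, Bool.and_true] at this
          simp [this])
      (by
        intro x hx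
        obtain ⟨a, -, rfl⟩ := List.mem_map.1 hx
        exact hlow a)
      (by
        intro x hx
        obtain ⟨a, ha, rfl⟩ := List.mem_map.1 hx
        rw [← hsumM]
        exact List.single_le_sum (fun _ _ => Nat.zero_le _) _ (List.mem_map_of_mem ha))
      (by
        intro t ht
        rw [← htsum]
        exact List.single_le_sum (fun _ _ => Nat.zero_le _) _ (List.mem_map_of_mem ht))
      (length_word_difs ..).le (length_word_lows ..).le
      (by rw [hfilter]) (by rw [hfilter]) hwf hsize rfl
    refine ⟨s', r'.mono ?_, ?_⟩
    · refine multiLR_time ((length_encTokens_le ts).trans hU) hU ?_ le_rfl ?_ ?_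
      · rw [List.length_map, List.length_range, encParts, List.length_flatMap]
        simp [hM]
      · calc (unaryTokens ts).length ^ 2 ≤ (3 * k) ^ 2 := Nat.pow_le_pow_left hU 2
          _ = 9 * k ^ 2 := by ring
      · rw [List.map_map]
        exact hsumM.le
    · have hpv : ∀ a, act a = false → lam.rowLen a - α.rowLen a = 0 := fun a ha => by
        rw [hcomp.out a ha, Nat.sub_self]
      rw [h', hcomp.card_eq hMn (hsum.trans htsum.symm) hpv, SearchState.card_accepts hgood hSlen rfl]
      · exact or_iff_not_imp_left.2 htd₀
      -- The length suffices: with `T` tokens, `(k + T) ^ 2` is at least `k + k * T`, that is one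
      -- decision per box and one per entry.
      · have h₁ : ts.countP Option.isSome ≤ ts.length := List.countP_le_length
        have h₂ := Nat.mul_le_mul htdlen h₁
        have h₃ : k ≤ k ^ 2 := Nat.le_self_pow two_ne_zero k
        rw [length_unaryTokens, htsum]
        nlinarith

end StackProg

/-! ### The running time -/

theorem exists_two_pow_le : ∃ C : ℕ, ∀ k : ℕ, (k + 1) ^ 3 * 2 ^ (9 * k ^ 2) ≤ C * k ^ (2 * k ^ 2) := by
  -- The threshold is kept opaque so that `2 ^ (12 * D ^ 2)` is not evaluated.
  obtain ⟨D, hD⟩ : ∃ D, D = 64 := ⟨_, rfl⟩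
  refine ⟨2 ^ (12 * D ^ 2), fun k => ?_⟩
  have h : (k + 1) ^ 3 * 2 ^ (9 * k ^ 2) ≤ 2 ^ (12 * k ^ 2) := by
    calc (k + 1) ^ 3 * 2 ^ (9 * k ^ 2) ≤ (2 ^ k) ^ 3 * 2 ^ (9 * k ^ 2) :=
          Nat.mul_le_mul_right _ (Nat.pow_le_pow_left Nat.lt_two_pow_self 3)
      _ = 2 ^ (k * 3 + 9 * k ^ 2) := by rw [← pow_mul, ← pow_add]
      _ ≤ 2 ^ (12 * k ^ 2) := Nat.pow_le_pow_right two_pos (by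
          have : k ≤ k ^ 2 := Nat.le_self_pow two_ne_zero k
          omega)
  refine h.trans ?_
  by_cases hk : 64 ≤ k
  · calc 2 ^ (12 * k ^ 2) = 64 ^ (2 * k ^ 2) := by
          rw [show 64 = 2 ^ 6 from rfl, ← pow_mul]
          congr 1
          ring
      _ ≤ k ^ (2 * k ^ 2) := Nat.pow_le_pow_left hk _
      _ ≤ _ := Nat.le_mul_of_pos_left _ (pow_pos two_pos _)
  -- Below the threshold the left side is absorbed by the constant. The case `k = 0` uses `0 ^ 0 =
  -- 1`.
  · have h₁ : 1 ≤ k ^ (2 * k ^ 2) := by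
      rcases k with _ | k
      · exact le_rfl
      · exact Nat.one_le_pow _ _ (Nat.succ_pos k)
    refine le_trans ?_ (Nat.le_mul_of_pos_right _ h₁)
    exact Nat.pow_le_pow_right two_pos (Nat.mul_le_mul_left _ (Nat.pow_le_pow_left (by omega) 2))

theorem length_bits_le_logb {p q : ℕ} (h : p ≤ q) :
    (p.bits.length : ℝ) ≤ 1 + Real.logb 2 ((q : ℝ) + 1) := by
  rw [Nat.size_eq_bits_len]
  rcases hs : p.size with _ | m
  · have : 0 ≤ Real.logb 2 ((q : ℝ) + 1) := Real.logb_nonneg one_lt_two (by simp)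
    push_cast
    linarith
  · have h₁ : 2 ^ m ≤ p := Nat.lt_size.1 (by omega)
    have h₂ : (m : ℝ) ≤ Real.logb 2 ((q : ℝ) + 1) := by
      rw [Real.le_logb_iff_rpow_le one_lt_two (by positivity), Real.rpow_natCast]
      exact_mod_cast (h₁.trans h).trans (Nat.le_succ q)
    push_cast
    linarith

theorem length_encParts_le {l : List ℕ} {q : ℕ} (h : ∀ p ∈ l, p ≤ q) :
    ((StackProg.encParts l).length : ℝ) ≤ l.length * (2 + Real.logb 2 ((q : ℝ) + 1)) := by
  induction l with
  | nil => simp [StackProg.encParts]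
  | cons p l ih =>
    have h₁ := ih fun x hx => h x (List.mem_cons_of_mem _ hx)
    have h₂ := length_bits_le_logb (h p List.mem_cons_self)
    rw [StackProg.encParts_cons, List.length_append, List.length_map, List.length_cons,
      List.length_cons]
    push_cast
    linarith

/-- Every part takes at most `2 + log` symbols, including its end marker. For a nonempty partition
both the number of rows and the logarithm are at least one, so `2`, the logarithm and the additional
`1` together give the factor `4`. -/
theorem length_encParts_rowLens_le {lam : YoungDiagram} (h : 0 < lam.card) :
    ((StackProg.encParts lam.rowLens).length : ℝ) + 1 ≤
      4 * ((lam.colLen 0 : ℝ) * Real.logb 2 ((lam.rowLen 0 : ℝ) + 1)) := by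
  have hc : 0 < lam.colLen 0 := by
    by_contra! h₀
    have := lam.sum_rowLens
    have h₁ : lam.rowLens = [] :=
      List.eq_nil_of_length_eq_zero (by rw [YoungDiagram.length_rowLens]; omega)
    rw [h₁, List.sum_nil] at this
    omega
  have hr : 0 < lam.rowLen 0 :=
    YoungDiagram.mem_iff_lt_rowLen.1 (YoungDiagram.mem_iff_lt_colLen.2 hc)
  have h₁ : 1 ≤ Real.logb 2 ((lam.rowLen 0 : ℝ) + 1) := by
    rw [Real.le_logb_iff_rpow_le one_lt_two (by positivity), Real.rpow_one]
    have : (1 : ℝ) ≤ lam.rowLen 0 := by exact_mod_cast hr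
    linarith
  have h₂ := length_encParts_le (l := lam.rowLens) (q := lam.rowLen 0) fun p hp => by
    obtain ⟨i, hi, rfl⟩ := List.mem_iff_getElem.1 hp
    rw [YoungDiagram.get_rowLens]
    exact lam.rowLen_anti _ _ (Nat.zero_le i)
  rw [YoungDiagram.length_rowLens] at h₂
  have h₃ : (1 : ℝ) ≤ lam.colLen 0 := by exact_mod_cast hc
  nlinarith

theorem proposition4p3 :
    ∃ M : Turing.TM2ComputableAux InputSymbol Bool,
      (∀ s : M.tm.K, Finite (M.tm.Γ s)) ∧
      ∃ C : ℝ, ∀ (n k : ℕ) (lam α₁ : YoungDiagram) (αs : List YoungDiagram),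
        0 < n →
        lam.card = n →
        α₁.card + k = n →
        (αs.map YoungDiagram.card).sum = k →
        (∀ a ∈ αs, a ≠ ⊥) →
        ∃ m : ℕ, IsMultiLR (α₁ :: αs) lam m ∧
          OutputsWithin M (encodeInput lam (α₁ :: αs)) m.bits
            (C * ((lam.colLen 0 : ℝ) * Real.logb 2 ((lam.rowLen 0 : ℝ) + 1) *
              (k : ℝ) ^ (2 * k ^ 2))) := by
  let init : Reg := ⟨none, none, none, false, false, false, false, false⟩
  obtain ⟨C, hC⟩ := exists_two_pow_le
  -- The summand `1` of `10 ^ 7 + 1` pays for the halting step, and `4` comes from the length of the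
  -- code of `lam`.
  refine ⟨StackProg.multiLR.machine .inp init, StackProg.finite_alphabet _ _ _,
    (10 ^ 7 + 1) * (4 * C), fun n k lam α₁ αs hn hlam hα hαs hne => ⟨_,
      GelfandTsetlin.isMultiLR_card (N := n) (by omega), ?_⟩⟩
  obtain ⟨s', r', h'⟩ := StackProg.multiLR_correct hlam hα hαs hne init
  rw [← h']
  refine r'.outputsWithin ?_
  have h₁ := length_encParts_rowLens_le (lam := lam) (by omega)
  have h₂ : (((k + 1) ^ 3 * 2 ^ (9 * k ^ 2) : ℕ) : ℝ) ≤ C * (k : ℝ) ^ (2 * k ^ 2) := by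
    exact_mod_cast hC k
  have h₃ : (1 : ℝ) ≤ (((k + 1) ^ 3 * 2 ^ (9 * k ^ 2) : ℕ) : ℝ) := by
    exact_mod_cast Nat.one_le_iff_ne_zero.2 (by positivity)
  generalize (k + 1) ^ 3 * 2 ^ (9 * k ^ 2) = P at h₂ h₃ ⊢
  generalize (StackProg.encParts lam.rowLens).length = E at h₁ ⊢
  have h₄ := mul_le_mul h₁ h₂ (by positivity) (le_trans (by positivity) h₁)
  have h₅ : (1 : ℝ) ≤ (E + 1) * P := by
    have : (0 : ℝ) ≤ E := Nat.cast_nonneg E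
    nlinarith
  push_cast
  nlinarith
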